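/- Identify $\mathbb R^2$ with $\mathbb C$, $x=(x_1,x_2)=x_1+ix_2$. Let $2<\alpha<4$, $\vartheta=\arcsin\big(\tfrac12\sqrt{\alpha(4-\alpha)}\big)$, and let $$\psi_1(z)=\tfrac z\alpha,\quad \psi_2(z)=\tfrac z\alpha e^{i\vartheta}+\tfrac1\alpha,\quad \psi_3(z)=\tfrac z\alpha e^{-i\vartheta}+\tfrac12+i\sqrt{\tfrac1\alpha-\tfrac14},\quad \psi_4(z)=\tfrac{z-1}\alpha+1$$ be the Koch similitudes. For a word $w=(i_1,\dots,i_n)\in\{1,2,3,4\}^n$ put $\psi_w=\psi_{i_1}\circ\dots\circ\psi_{i_n}$; the $n$-th pre-fractal Koch curve is $\bigcup_{|w|=n}\psi_w([0,1])$. Let $m\ge 3$ and let $\Omega^0$ be the regular $m$-gon with side length $1$ that has $[0,1]$ as a side and lies below it. Let $\Omega_\alpha^n$ be the polygonal domain obtained by replacing every side of $\Omega^0$ by the (outward) $n$-th pre-fractal Koch curve, let $K^n=\partial\Omega^n_\alpha$ be the union of these $m$ curves, and let $\Omega_\alpha=\bigcup_n\Omega_\alpha^n$ be the limit domain, whose boundary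 consists of $m$ Koch curves. Let $0<\vartheta^-\le\min\{\tfrac\pi2-\vartheta,\tfrac\vartheta2\}$, and let $T_0^-$ be the open triangle with vertices $0$, $1$ and $\tfrac12-\tfrac i2\tan\vartheta^-$. Let $\Sigma_-^n$ be the union, over the $m$ sides of $\Omega^0$, of the sets $\bigcup_{|w|=n}\psi_w(T_0^-)$ transported from $[0,1]$ to that side by the rotation of $\Omega^0$. For $x\in\Sigma_-^n$ let $x^\perp$ be the orthogonal projection (nearest point) of $x$ on $\partial\Omega_\alpha^n$, and let $x^-$ be the first point of $\partial\Sigma_-^n\setminus K^n$ on the ray from $x^\perp$ through $x$. Define $\lambda_n$ on $\Omega_\alpha$ by $$\lambda_n(x)=\begin{cases}1,& x\in\Omega^n_\alpha\setminus\Sigma^n_-,\\[2pt] \dfrac{|x_1^\perp-x_1|+|x_2^\perp-x_2|}{|x_1^\perp-x_1^-|+|x_2^\perp-x_2^-|},& x\in\Sigma_-^n,\\[6pt] 0,& x\in\Omega_\alpha\setminus\Omega_\alpha^n.\end{cases}$$ For $1<p<\infty$ let $W^{1,p}(\Omega_\alpha)$ be the space of real functions in $L^p(\Omega_\alpha)$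 with weak gradient in $L^p(\Omega_\alpha)$, with the norm $\|v\|_{1,p}=(\|v\|_p^p+\|\nabla v\|_p^p)^{1/p}$, and let $W_0^{1,p}(\Omega_\alpha)$ be the closure of $C_c^\infty(\Omega_\alpha)$ in it. **Theorem.** Let $r>2$, $u\in W_0^{1,r}(\Omega_\alpha)$ and $w_n=\lambda_n u$, $n\ge 0$. Then for every $s$ with $2<s<r$: 1. $w_n\in W_0^{1,s}(\Omega_\alpha)$ for every $n$; 2. there is a constant $C$, independent of $n$, with $\|w_n\|_{1,s}\le C$ for every $n$; 3. $w_n\to u$ in $W_0^{1,s}(\Omega_\alpha)$, that is, $\|w_n-u\|_{1,s}\to0$ as $n\to\infty$. -/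

import Mathlib

open MeasureTheory Filter Topology Set
open scoped ENNReal NNReal ContDiff

noncomputable section

namespace KochFiber

/-! ### Sobolev spaces on a planar domain

The plane `ℝ²` is `ℂ` with its Euclidean norm, its real inner product and Lebesgue measure;
`x = (x₁, x₂)` has coordinates `x.re`, `x.im`. -/

/-- `φ ∈ C_c^∞(Ω)`. -/
def IsTestFunction (Ω : Set ℂ) (φ : ℂ → ℝ) : Prop :=
  ContDiff ℝ ∞ φ ∧ HasCompactSupport φ ∧ tsupport φ ⊆ Ω

/-- `g` is a weak gradient of `u` on the open set `Ω`. -/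
def HasWeakGradient (Ω : Set ℂ) (u : ℂ → ℝ) (g : ℂ → ℂ) : Prop :=
  LocallyIntegrableOn u Ω ∧ LocallyIntegrableOn g Ω ∧
    ∀ φ : ℂ → ℝ, IsTestFunction Ω φ → ∀ v : ℂ,
      ∫ x in Ω, u x * fderiv ℝ φ x v = -∫ x in Ω, inner ℝ (g x) v * φ x

/-- The norm `‖u‖_{1,p,Ω} = (‖u‖_p^p + ‖∇u‖_p^p)^{1/p}`, with value `∞` if `u` has no weak gradient
on `Ω`. The weak gradient is unique almost everywhere, so the infimum is over equal numbers. -/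
def sobolevNorm (Ω : Set ℂ) (p : ℝ) (u : ℂ → ℝ) : ℝ≥0∞ :=
  ⨅ (g : ℂ → ℂ) (_ : HasWeakGradient Ω u g),
    (eLpNorm u (ENNReal.ofReal p) (volume.restrict Ω) ^ p +
      eLpNorm g (ENNReal.ofReal p) (volume.restrict Ω) ^ p) ^ (1 / p)

/-- `u ∈ W^{1,p}(Ω)`. -/
def MemW1 (Ω : Set ℂ) (p : ℝ) (u : ℂ → ℝ) : Prop :=
  MemLp u (ENNReal.ofReal p) (volume.restrict Ω) ∧
    ∃ g : ℂ → ℂ, HasWeakGradient Ω u g ∧ MemLp g (ENNReal.ofReal p) (volume.restrict Ω)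

/-- `u ∈ W_0^{1,p}(Ω)`, the closure of `C_c^∞(Ω)` in `W^{1,p}(Ω)`. -/
def MemW10 (Ω : Set ℂ) (p : ℝ) (u : ℂ → ℝ) : Prop :=
  MemW1 Ω p u ∧ ∃ φ : ℕ → ℂ → ℝ, (∀ k, IsTestFunction Ω (φ k)) ∧
    Tendsto (fun k => sobolevNorm Ω p (u - φ k)) atTop (𝓝 0)

/-! ### Koch curves -/

/-- The rotation angle of the Koch similitudes. -/
def kochAngle (α : ℝ) : ℝ := Real.arcsin (√(α * (4 - α)) / 2)

/-- The tip of the first iteration of the Koch curve. -/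
def kochTip (α : ℝ) : ℂ := 1 / 2 + Complex.I * (√(1 / α - 1 / 4) : ℝ)

/-- The four similitudes of the Koch curve, with contraction factor `α⁻¹`. -/
def kochMap (α : ℝ) : Fin 4 → ℂ → ℂ :=
  ![fun z => z / α,
    fun z => z / α * Complex.exp (Complex.I * kochAngle α) + 1 / α,
    fun z => z / α * Complex.exp (-(Complex.I * kochAngle α)) + kochTip α,
    fun z => (z - 1) / α + 1]

/-- The composition `ψ_{i₁} ∘ ⋯ ∘ ψ_{iₙ}` for a word `[i₁, …, iₙ]`. -/
def wordMap (α : ℝ) : List (Fin 4) → ℂ → ℂ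
  | [] => id
  | i :: w => kochMap α i ∘ wordMap α w

/-- `⋃ ψ_w(S)` over the words `w` of length `n`. -/
def iterateSet (α : ℝ) (n : ℕ) (S : Set ℂ) : Set ℂ :=
  ⋃ w ∈ {w : List (Fin 4) | w.length = n}, wordMap α w '' S

/-! ### The regular polygon and the copies of a figure along its sides -/

/-- The rigid motion which carries each side of the regular `m`-gon to the next one: the `m`-gon has
side length one, lies below its first side, from `0` to `1`, and its vertices are listed
clockwise. -/
def sideMap (m : ℕ) (z : ℂ) : ℂ := 1 + Complex.exp (-(2 * Real.pi / m * Complex.I)) * z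

/-- The copies of `S`, given relative to the first side `[0, 1]`, along the `m` sides. -/
def onSides (m : ℕ) (S : Set ℂ) : Set ℂ := ⋃ j : Fin m, (sideMap m)^[j] '' S

/-- The closed regular `m`-gon. -/
def closedPolygon (m : ℕ) : Set ℂ := convexHull ℝ (onSides m {0})

/-- The closed triangle between the middle part of `[0, 1]` and the two sides which replace it in
the first iteration of the Koch curve. -/
def bump (α : ℝ) : Set ℂ := convexHull ℝ {(1 / α : ℂ), kochTip α, (1 - 1 / α : ℂ)}

/-- The pre-fractal domain `Ω_α^n`, the polygonal domain obtained from the regular `m`-gon by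
replacing each side by the `n`-th pre-fractal Koch curve. Passing from the `k`-th to the `(k+1)`-th
curve replaces the middle part of each segment by two segments on its outer side, which adjoins to
the domain the triangle between them, a copy of `bump α`. -/
def prefractalDomain (m : ℕ) (α : ℝ) (n : ℕ) : Set ℂ :=
  interior (closedPolygon m ∪ ⋃ k ∈ {k : ℕ | k < n}, onSides m (iterateSet α k (bump α)))

/-- The limit domain `Ω_α` of the increasing sequence `Ω_α^n`; its boundary consists of `m` copies
of the Koch curve `K_α`. -/
def fractalDomain (m : ℕ) (α : ℝ) : Set ℂ := ⋃ n : ℕ, prefractalDomain m α n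

/-- The union over the sides of the `m`-gon of the `n`-th pre-fractal Koch curves `K_α^n`. -/
def prefractalCurves (m : ℕ) (α : ℝ) (n : ℕ) : Set ℂ :=
  onSides m (iterateSet α n (segment ℝ 0 1))

/-! ### Inner fibers and the coefficient functions -/

/-- The open isosceles triangle `T_0^-` below `[0, 1]`, with base angles `η`. -/
def innerTriangle (η : ℝ) : Set ℂ :=
  interior (convexHull ℝ {(0 : ℂ), (1 : ℂ), 1 / 2 - Complex.I * (Real.tan η / 2 : ℝ)})

/-- The array `Σ_-^n` of inner fibers. -/
def innerFiber (m : ℕ) (α η : ℝ) (n : ℕ) : Set ℂ :=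
  onSides m (iterateSet α n (innerTriangle η))

/-- A point of `S` nearest to `x`: the orthogonal projection of `x` on `S`. -/
def projOn (S : Set ℂ) (x : ℂ) : ℂ :=
  Classical.epsilon fun y => y ∈ S ∧ dist x y = Metric.infDist x S

/-- `P_⊥`, the orthogonal projection of `x` on `∂Ω_α^n`. -/
def footPoint (m : ℕ) (α : ℝ) (n : ℕ) (x : ℂ) : ℂ :=
  projOn (frontier (prefractalDomain m α n)) x

/-- The inner intersection `P_-` of the line through `x` and `P_⊥` with `∂Σ_-^n ∖ K^n`: the first
point of that set on the ray which starts at `P_⊥` and passes through `x`. -/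
def innerPoint (m : ℕ) (α η : ℝ) (n : ℕ) (x : ℂ) : ℂ :=
  let y := footPoint m α n x
  let t := sInf {t : ℝ | 0 < t ∧
    y + t * (x - y) ∈ frontier (innerFiber m α η n) \ prefractalCurves m α n}
  y + t * (x - y)

/-- The norm `|x₁| + |x₂|`. -/
def l1Norm (z : ℂ) : ℝ := |z.re| + |z.im|

open Classical in
/-- The coefficient function `λ_n`. It is the quotient of the two distances on `Σ_-^n`, it is `1` on
the closure of `Ω_α^n ∖ closure Σ_-^n`, and `0` outside `Ω_α^n`. If two triangles of `Σ_-^n` have a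
common edge, then `λ_n` is extended by continuity, with value `1`, to this null set. -/
def coeff (m : ℕ) (α η : ℝ) (n : ℕ) (x : ℂ) : ℝ :=
  if x ∈ innerFiber m α η n then
    l1Norm (footPoint m α n x - x) / l1Norm (footPoint m α n x - innerPoint m α η n x)
  else if x ∈ prefractalDomain m α n ∪
      closure (prefractalDomain m α n \ closure (innerFiber m α η n)) then 1
  else 0

end KochFiber

end

/-! The coefficient function is singular only at the vertices of the pre-fractal curve, where its
gradient grows at most like the reciprocal of the distance to the vertex. The constant in this bound
is the same in every generation, because each cell is a similar copy of one model triangle and the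
bound is scale invariant. A vertex of some generation stays on all later curves, so it lies outside
the open limit domain and every test function vanishes there (`vertex_notMem_fractalDomain`). For r
> 2 in the plane, Hardy's inequality with respect to a point, ∫ (|φ|/|x - P|)^r ≤ C ∫ |∇φ|^r on a
set star-shaped about P with φ(P) = 0 (`exists_hardy_const`), absorbs the singularity. Each inner
triangle is cut into two halves, each star-shaped about its own base vertex. The triangles are
disjoint, so the local estimates add up to ‖∇(λ_n φ)‖_r ≤ C ‖∇φ‖_r with C independent of n
(`exists_eLpNorm_gradient_cutoff_mul_le`).

The rest of the analysis is abstract (`multiplier_convergence`). If test functions φ_k tend to u,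
the uniform bound makes ∇(λ_n φ_k) Cauchy in k at a rate independent of n, which gives the weak
gradient of λ_n u and its bound. For fixed k the product λ_n φ_k equals φ_k once n is large, because
the support of φ_k stays away from all vertices while the inner triangles shrink towards them
(`eventually_cutoff_mul_eq`). All estimates are made in the exponent r, and s enters through the
embedding of L^r in L^s on a domain of finite measure. Membership in W_0 follows by mollifying the
Lipschitz functions λ_n φ_k.

The geometry has to identify λ_n. In the coordinates of a cell it is |y| / (t min(x, 1 - x))
(`coeff_cellMap`), provided that the nearest boundary point is the foot on the cell's own segment. A
disc about a point of an inner triangle that touches the base lies in the triangle with doubled base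
angles 2ϑ⁻, apart from the point of contact. The hypothesis ϑ⁻ ≤ min(π/2 - ϑ, ϑ/2) says exactly that
2ϑ⁻ ≤ min(π - 2ϑ, ϑ), so the doubled triangle fits into `invariantKite`. This kite is mapped into
itself by the similitudes, and a strong form of the open set condition holds for it (`cellMap_ne`),
so no other part of the curve enters the disc. Off the null set of the curves, λ_n agrees with
`cutoff`, whose products with test functions are Lipschitz on the plane. -/

namespace KochFiber

/-! ### Weak gradients and Lipschitz functions -/

section Sobolev

variable {Ω : Set ℂ} {u v : ℂ → ℝ} {g h : ℂ → ℂ} {p : ℝ}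

lemma norm_gradient (f : ℂ → ℝ) (x : ℂ) : ‖gradient f x‖ = ‖fderiv ℝ f x‖ := by
  simp [gradient]

lemma measurable_gradient (f : ℂ → ℝ) : Measurable (gradient f) :=
  (InnerProductSpace.toDual ℝ ℂ).symm.continuous.measurable.comp (measurable_fderiv ℝ f)

lemma norm_gradient_le_of_lipschitz {f : ℂ → ℝ} {C : ℝ≥0} (hf : LipschitzWith C f) (x : ℂ) :
    ‖gradient f x‖ ≤ C := by
  rw [norm_gradient]
  exact norm_fderiv_le_of_lipschitz ℝ hf

lemma locallyIntegrable_of_measurable_of_bound {E : Type*} [NormedAddCommGroup E]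
    [SecondCountableTopology E] [MeasurableSpace E] [BorelSpace E]
    {f : ℂ → E} (hf : Measurable f) (C : ℝ) (hC : ∀ x, ‖f x‖ ≤ C) :
    LocallyIntegrable f volume :=
  (memLp_top_of_bound hf.aestronglyMeasurable C (ae_of_all _ hC)).locallyIntegrable le_top

lemma IsTestFunction.exists_lipschitz {φ : ℂ → ℝ} (hφ : IsTestFunction Ω φ) :
    ∃ C, LipschitzWith C φ :=
  ContDiff.lipschitzWith_of_hasCompactSupport hφ.2.1 hφ.1 (by simp)

lemma IsTestFunction.sub {φ ψ : ℂ → ℝ} (hφ : IsTestFunction Ω φ) (hψ : IsTestFunction Ω ψ) :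
    IsTestFunction Ω (φ - ψ) := by
  refine ⟨hφ.1.sub hψ.1, hφ.2.1.sub hψ.2.1, ?_⟩
  exact (tsupport_sub φ ψ).trans (union_subset hφ.2.2 hψ.2.2)

lemma HasWeakGradient.congr_ae (hu : HasWeakGradient Ω u g)
    (huv : u =ᵐ[volume.restrict Ω] v) : HasWeakGradient Ω v g := by
  obtain ⟨h1, h2, h3⟩ := hu
  refine ⟨?_, h2, fun φ hφ w => ?_⟩
  · intro x hx
    obtain ⟨s, hs, hi⟩ := h1 x hx
    refine ⟨s ∩ Ω, inter_mem hs self_mem_nhdsWithin, ?_⟩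
    have h := hi.mono_set (inter_subset_left : s ∩ Ω ⊆ s)
    exact h.congr (ae_restrict_of_ae_restrict_of_subset inter_subset_right huv)
  · rw [← h3 φ hφ w]
    refine integral_congr_ae ?_
    filter_upwards [huv] with x hx
    rw [hx]

lemma HasWeakGradient.sub (hu : HasWeakGradient Ω u g) (hv : HasWeakGradient Ω v h) :
    HasWeakGradient Ω (u - v) (g - h) := by
  obtain ⟨h1, h2, h3⟩ := hu
  obtain ⟨k1, k2, k3⟩ := hv
  refine ⟨h1.sub k1, h2.sub k2, fun φ hφ w => ?_⟩
  -- Local integrability suffices to split the integrals, since φ and its derivative have compact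
  -- support inside Ω.
  have key1 : ∀ f : ℂ → ℝ, LocallyIntegrableOn f Ω →
      Integrable (fun x => f x * fderiv ℝ φ x w) (volume.restrict Ω) := by
    intro f hf
    have hc : Continuous fun x => fderiv ℝ φ x w :=
      (hφ.1.continuous_fderiv (by simp)).clm_apply continuous_const
    have hs : HasCompactSupport fun x => fderiv ℝ φ x w := by
      refine (hφ.2.1.fderiv ℝ).comp_left (g := fun L : ℂ →L[ℝ] ℝ => L w) (by simp)
    have hsub : tsupport (fun x => fderiv ℝ φ x w) ⊆ Ω := by
      refine Subset.trans (closure_mono ?_) ((tsupport_fderiv_subset ℝ).trans hφ.2.2)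
      intro x hx hx0
      exact hx (by simp only [hx0]; rfl)
    have hi : IntegrableOn f (tsupport fun x => fderiv ℝ φ x w) :=
      hf.integrableOn_compact_subset hsub hs
    have h4 := hi.mul_continuousOn hc.continuousOn hs
    have h5 : Integrable (fun x => f x * fderiv ℝ φ x w) volume := by
      refine (integrableOn_iff_integrable_of_support_subset ?_).1 h4
      intro x hx
      exact subset_tsupport _ (right_ne_zero_of_mul hx)
    exact h5.restrict
  have key2 : ∀ f : ℂ → ℂ, LocallyIntegrableOn f Ω →
      Integrable (fun x => inner ℝ (f x) w * φ x) (volume.restrict Ω) := by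
    intro f hf
    have hi : IntegrableOn f (tsupport φ) := hf.integrableOn_compact_subset hφ.2.2 hφ.2.1
    have hi' : IntegrableOn (fun x => inner ℝ (f x) w) (tsupport φ) := hi.inner_const w
    have h4 := hi'.mul_continuousOn hφ.1.continuous.continuousOn hφ.2.1
    have h5 : Integrable (fun x => inner ℝ (f x) w * φ x) volume := by
      refine (integrableOn_iff_integrable_of_support_subset ?_).1 h4
      intro x hx
      exact subset_tsupport _ (right_ne_zero_of_mul hx)
    exact h5.restrict
  simp only [Pi.sub_apply, inner_sub_left, sub_mul]
  rw [integral_sub (key1 u h1) (key1 v k1), integral_sub (key2 g h2) (key2 h k2), h3 φ hφ w,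
    k3 φ hφ w]
  ring

/-- By Rademacher's theorem the classical gradient exists almost everywhere, and integration by
parts for line derivatives of Lipschitz functions identifies it as the weak gradient. -/
lemma hasWeakGradient_of_lipschitz {f : ℂ → ℝ} {C : ℝ≥0} (hf : LipschitzWith C f) (Ω : Set ℂ) :
    HasWeakGradient Ω f (gradient f) := by
  refine ⟨hf.continuous.locallyIntegrable.locallyIntegrableOn _,
    (locallyIntegrable_of_measurable_of_bound (measurable_gradient f) C
      (norm_gradient_le_of_lipschitz hf)).locallyIntegrableOn _, fun φ hφ w => ?_⟩
  obtain ⟨D, hD⟩ := hφ.exists_lipschitz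
  have h0 : ∀ x, x ∉ Ω → φ x = 0 := fun x hx =>
    image_eq_zero_of_notMem_tsupport fun h => hx (hφ.2.2 h)
  have h1 : ∀ x, x ∉ Ω → fderiv ℝ φ x = 0 := fun x hx =>
    image_eq_zero_of_notMem_tsupport fun h => hx (hφ.2.2 (tsupport_fderiv_subset ℝ h))
  -- Both integrands vanish off Ω, so the identity may be proved on the whole plane.
  rw [setIntegral_eq_integral_of_forall_compl_eq_zero (fun x hx => by rw [h1 x hx]; simp),
    setIntegral_eq_integral_of_forall_compl_eq_zero (fun x hx => by rw [h0 x hx]; simp)]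
  have := hf.integral_lineDeriv_mul_eq (μ := volume) hD hφ.2.1 w
  have h2 : ∫ x, lineDeriv ℝ f x w * φ x = ∫ x, inner ℝ (gradient f x) w * φ x := by
    refine integral_congr_ae ?_
    filter_upwards [hf.ae_differentiableAt (μ := volume)] with x hx
    rw [hx.lineDeriv_eq_fderiv, inner_gradient_left]
  rw [← h2, this, ← integral_neg]
  refine integral_congr_ae (ae_of_all _ fun x => ?_)
  have hx : DifferentiableAt ℝ φ x := hφ.1.differentiable (by simp) x
  simp only [hx.lineDeriv_eq_fderiv, map_neg]
  ring

/-- The fundamental lemma of the calculus of variations annihilates each component of g - h; the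
directions 1 and i suffice. -/
lemma HasWeakGradient.ae_eq (hΩ : IsOpen Ω) (hg : HasWeakGradient Ω u g)
    (hh : HasWeakGradient Ω u h) : g =ᵐ[volume.restrict Ω] h := by
  have key : ∀ w : ℂ, ∀ᵐ x, x ∈ Ω → inner ℝ (g x - h x) w = 0 := by
    intro w
    have h0 := hg.sub hh
    have hli : LocallyIntegrableOn (fun x => inner ℝ (g x - h x) w) Ω := by
      intro x hx
      obtain ⟨s, hs, hi⟩ := h0.2.1 x hx
      exact ⟨s, hs, hi.inner_const w⟩
    refine IsOpen.ae_eq_zero_of_integral_contDiff_smul_eq_zero hΩ hli ?_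
    intro φ h1 h2 h3
    have := h0.2.2 φ ⟨h1, h2, h3⟩ w
    simp only [sub_self, zero_mul, integral_zero, Pi.sub_apply] at this
    rw [← setIntegral_eq_integral_of_forall_compl_eq_zero (s := Ω)]
    · simp only [smul_eq_mul, mul_comm (φ _)]
      linarith
    · intro x hx
      rw [image_eq_zero_of_notMem_tsupport fun h => hx (h3 h), zero_smul]
  rw [EventuallyEq, ae_restrict_iff' hΩ.measurableSet]
  filter_upwards [key 1, key Complex.I] with x h1 h2 hx
  have e1 := h1 hx
  have e2 := h2 hx
  simp [Complex.inner] at e1 e2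
  apply Complex.ext <;> linarith

/-- Uniqueness of the weak gradient makes all terms of the infimum equal. -/
lemma sobolevNorm_eq (hΩ : IsOpen Ω) (hg : HasWeakGradient Ω u g) (p : ℝ) :
    sobolevNorm Ω p u = (eLpNorm u (ENNReal.ofReal p) (volume.restrict Ω) ^ p +
      eLpNorm g (ENNReal.ofReal p) (volume.restrict Ω) ^ p) ^ (1 / p) := by
  refine le_antisymm (iInf₂_le g hg) (le_iInf₂ fun h hh => ?_)
  rw [eLpNorm_congr_ae (hg.ae_eq hΩ hh)]

lemma sobolevNorm_le (hg : HasWeakGradient Ω u g) (hp : 1 ≤ p) :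
    sobolevNorm Ω p u ≤ eLpNorm u (ENNReal.ofReal p) (volume.restrict Ω) +
      eLpNorm g (ENNReal.ofReal p) (volume.restrict Ω) :=
  (iInf₂_le g hg).trans (ENNReal.rpow_add_rpow_le_add _ _ hp)

lemma eLpNorm_le_sobolevNorm (hΩ : IsOpen Ω) (hg : HasWeakGradient Ω u g) (hp : 0 < p) :
    eLpNorm u (ENNReal.ofReal p) (volume.restrict Ω) ≤ sobolevNorm Ω p u ∧
      eLpNorm g (ENNReal.ofReal p) (volume.restrict Ω) ≤ sobolevNorm Ω p u := by
  rw [sobolevNorm_eq hΩ hg, one_div, ENNReal.le_rpow_inv_iff hp, ENNReal.le_rpow_inv_iff hp]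
  exact ⟨le_self_add, le_add_self⟩

/-- The weak gradient is a closed operator: on a set of finite measure, L^q convergence implies L^1
convergence, so both sides of the defining identity pass to the limit against bounded test factors.
-/
lemma HasWeakGradient.of_tendsto {f : ℕ → ℂ → ℝ} {G : ℕ → ℂ → ℂ} {q : ℝ≥0∞}
    (hfin : volume Ω ≠ ⊤)
    (hq : 1 ≤ q) (hfG : ∀ k, HasWeakGradient Ω (f k) (G k))
    (hf : ∀ k, MemLp (f k) q (volume.restrict Ω)) (hG : ∀ k, MemLp (G k) q (volume.restrict Ω))
    (hu : MemLp u q (volume.restrict Ω)) (hg : MemLp g q (volume.restrict Ω))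
    (hfu : Tendsto (fun k => eLpNorm (f k - u) q (volume.restrict Ω)) atTop (𝓝 0))
    (hGg : Tendsto (fun k => eLpNorm (G k - g) q (volume.restrict Ω)) atTop (𝓝 0)) :
    HasWeakGradient Ω u g := by
  have : IsFiniteMeasure (volume.restrict Ω) := ⟨by simpa using hfin.lt_top⟩
  refine ⟨?_, ?_, fun φ hφ w => ?_⟩
  · exact IntegrableOn.locallyIntegrableOn (hu.integrable hq)
  · exact IntegrableOn.locallyIntegrableOn (hg.integrable hq)
  have conv : ∀ (F : ℕ → ℂ → ℝ) (F₀ : ℂ → ℝ) (ψ : ℂ → ℝ) (M : ℝ),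
      (∀ k, MemLp (F k) q (volume.restrict Ω)) → MemLp F₀ q (volume.restrict Ω) →
      Continuous ψ → (∀ x, ‖ψ x‖ ≤ M) →
      Tendsto (fun k => eLpNorm (F k - F₀) q (volume.restrict Ω)) atTop (𝓝 0) →
      Tendsto (fun k => ∫ x in Ω, F k x * ψ x) atTop (𝓝 (∫ x in Ω, F₀ x * ψ x)) := by
    intro F F₀ ψ M hF hF₀ hψ hM hlim
    have hint : ∀ f : ℂ → ℝ, MemLp f q (volume.restrict Ω) →
        Integrable (fun x => f x * ψ x) (volume.restrict Ω) := fun f hf =>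
      (hf.integrable hq).mul_bdd hψ.aestronglyMeasurable (ae_of_all _ hM)
    refine tendsto_integral_of_L1' _ (hint _ hF₀).aestronglyMeasurable (Eventually.of_forall fun k => hint _ (hF k)) ?_
    set c := volume.restrict Ω univ ^ (1 / (1 : ℝ≥0∞).toReal - 1 / q.toReal)
    have hc : c ≠ ⊤ := by
      refine ENNReal.rpow_ne_top_of_nonneg ?_ (measure_ne_top _ _)
      rcases eq_or_ne q ⊤ with rfl | hq'
      · simp
      · have : 1 ≤ q.toReal := by
          rw [← ENNReal.toReal_one]; exact ENNReal.toReal_mono hq' hq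
        simp only [ENNReal.toReal_one, sub_nonneg]
        gcongr
    have hbound : ∀ k, eLpNorm ((fun x => F k x * ψ x) - fun x => F₀ x * ψ x) 1
        (volume.restrict Ω) ≤ ENNReal.ofReal M * (eLpNorm (F k - F₀) q (volume.restrict Ω) * c) := by
      intro k
      refine le_trans (eLpNorm_le_mul_eLpNorm_of_ae_le_mul (g := F k - F₀) (c := M) ?_ 1) ?_
      · refine ae_of_all _ fun x => ?_
        simp only [Pi.sub_apply, ← sub_mul, norm_mul]
        rw [mul_comm]
        exact mul_le_mul_of_nonneg_right (hM x) (norm_nonneg _)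
      · gcongr
        exact eLpNorm_le_eLpNorm_mul_rpow_measure_univ hq ((hF k).sub hF₀).aestronglyMeasurable
    refine tendsto_of_tendsto_of_tendsto_of_le_of_le tendsto_const_nhds ?_ (fun _ => zero_le) hbound
    have : Tendsto (fun k => ENNReal.ofReal M * (eLpNorm (F k - F₀) q (volume.restrict Ω) * c))
        atTop (𝓝 (ENNReal.ofReal M * (0 * c))) :=
      ENNReal.Tendsto.const_mul (ENNReal.Tendsto.mul_const hlim (Or.inr hc))
        (Or.inr ENNReal.ofReal_ne_top)
    simpa using this
  obtain ⟨D, hD⟩ := hφ.exists_lipschitz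
  obtain ⟨M, hM⟩ := hφ.2.1.exists_bound_of_continuous hφ.1.continuous
  have t1 := conv f u (fun x => fderiv ℝ φ x w) (D * ‖w‖) hf hu
    ((hφ.1.continuous_fderiv (by simp)).clm_apply continuous_const)
    (fun x => (ContinuousLinearMap.le_opNorm _ _).trans
      (mul_le_mul_of_nonneg_right (norm_fderiv_le_of_lipschitz ℝ hD) (norm_nonneg _))) hfu
  have hGw : Tendsto (fun k => eLpNorm ((fun x => inner ℝ (G k x) w) - fun x => inner ℝ (g x) w) q
      (volume.restrict Ω)) atTop (𝓝 0) := by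
    refine tendsto_of_tendsto_of_tendsto_of_le_of_le tendsto_const_nhds
      (h := fun k => ENNReal.ofReal ‖w‖ * eLpNorm (G k - g) q (volume.restrict Ω)) ?_
      (fun _ => zero_le) ?_
    · have := ENNReal.Tendsto.const_mul (a := ENNReal.ofReal ‖w‖) hGg
        (Or.inr ENNReal.ofReal_ne_top)
      simpa using this
    · intro k
      refine eLpNorm_le_mul_eLpNorm_of_ae_le_mul (ae_of_all _ fun x => ?_) q
      simp only [Pi.sub_apply, ← inner_sub_left]
      rw [mul_comm]
      exact norm_inner_le_norm _ _
  have t2 := conv (fun k x => inner ℝ (G k x) w) (fun x => inner ℝ (g x) w) φ M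
    (fun k => (hG k).inner_const w) (hg.inner_const w) hφ.1.continuous hM hGw
  refine tendsto_nhds_unique t1 ?_
  simp_rw [(hfG _).2.2 φ hφ w]
  exact t2.neg

end Sobolev

/-! ### Mollification of Lipschitz functions -/

lemma tendsto_eLpNorm_zero_of_bound {E : Type*} [NormedAddCommGroup E] [MeasurableSpace E]
    [BorelSpace E] {μ : Measure ℂ} [IsFiniteMeasure μ] {q : ℝ≥0∞} (hq0 : q ≠ 0) (hq : q ≠ ⊤)
    {h : ℕ → ℂ → E} (hm : ∀ k, Measurable (h k)) {M : ℝ≥0}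
    (hM : ∀ k x, ‖h k x‖₊ ≤ M) (hlim : ∀ᵐ x ∂μ, Tendsto (fun k => h k x) atTop (𝓝 0)) :
    Tendsto (fun k => eLpNorm (h k) q μ) atTop (𝓝 0) := by
  have hp : 0 < q.toReal := ENNReal.toReal_pos hq0 hq
  have h1 : Tendsto (fun k => ∫⁻ x, ‖h k x‖ₑ ^ q.toReal ∂μ) atTop (𝓝 (∫⁻ _, 0 ∂μ)) := by
    refine tendsto_lintegral_of_dominated_convergence (fun _ => (M : ℝ≥0∞) ^ q.toReal)
      (fun k => (hm k).enorm.pow_const _) (fun k => ae_of_all _ fun x => ?_) ?_ ?_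
    · dsimp only
      gcongr
      exact_mod_cast hM k x
    · rw [lintegral_const]
      exact ENNReal.mul_ne_top (ENNReal.rpow_ne_top_of_nonneg hp.le ENNReal.coe_ne_top)
        (measure_ne_top _ _)
    · filter_upwards [hlim] with x hx
      have := (hx.enorm).ennrpow_const q.toReal
      simpa [hp] using this
  have h2 := h1.ennrpow_const (1 / q.toReal)
  rw [lintegral_zero, ENNReal.zero_rpow_of_pos (by positivity)] at h2
  simpa only [eLpNorm_eq_lintegral_rpow_enorm_toReal hq0 hq] using h2

/-- The gradient of a mollification is the mollification of the almost everywhere gradient. Values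
and gradients therefore converge almost everywhere by Lebesgue differentiation and stay bounded, and
dominated convergence on a set of finite measure gives convergence in L^q. -/
lemma exists_testFunction_near_lipschitz {Ω : Set ℂ} (hΩ : IsOpen Ω) (hfin : volume Ω ≠ ⊤)
    {f : ℂ → ℝ} {C : ℝ≥0} (hf : LipschitzWith C f) (hfc : HasCompactSupport f)
    (hfs : tsupport f ⊆ Ω) {q : ℝ≥0∞} (hq0 : q ≠ 0) (hq : q ≠ ⊤) {ε : ℝ≥0∞} (hε : 0 < ε) :
    ∃ χ, IsTestFunction Ω χ ∧ eLpNorm (f - χ) q (volume.restrict Ω) +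
      eLpNorm (gradient f - gradient χ) q (volume.restrict Ω) ≤ ε := by
  have : IsFiniteMeasure (volume.restrict Ω) := ⟨by simpa using hfin.lt_top⟩
  -- The outer radius is twice the inner one, because the differentiation theorem needs a bounded
  -- ratio of the two radii.
  let b : ℕ → ContDiffBump (0 : ℂ) := fun i =>
    ⟨1 / ((i : ℝ) + 1), 2 * (1 / ((i : ℝ) + 1)), by positivity,
      by have : 0 < 1 / ((i : ℝ) + 1) := by positivity
         linarith⟩
  have hbout : Tendsto (fun i => (b i).rOut) atTop (𝓝 0) := by
    have := (tendsto_one_div_add_atTop_nhds_zero_nat (𝕜 := ℝ)).const_mul 2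
    simpa [b] using this
  let L := ContinuousLinearMap.lsmul ℝ ℝ (E := ℝ)
  let L' := ContinuousLinearMap.lsmul ℝ ℝ (E := ℂ →L[ℝ] ℝ)
  let χ : ℕ → ℂ → ℝ := fun i => convolution ((b i).normed volume) f L volume
  obtain ⟨M, hM⟩ := hfc.exists_bound_of_continuous hf.continuous
  have hint : ∀ i, ∫ t, (b i).normed volume t = 1 := fun i => (b i).integral_normed
  have hχsmooth : ∀ i, ContDiff ℝ ∞ (χ i) := fun i =>
    (b i).hasCompactSupport_normed.contDiff_convolution_left L (b i).contDiff_normed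
      hf.continuous.locallyIntegrable
  -- The derivative is put on f instead of on the mollifier; the Lipschitz bound on f supplies the
  -- dominating function.
  have hderiv : ∀ i x, HasFDerivAt (χ i)
      (convolution ((b i).normed volume) (fderiv ℝ f) L' volume x) x := by
    intro i x
    have hm : Measurable fun t => fderiv ℝ f (x - t) :=
      (measurable_fderiv ℝ f).comp (measurable_const.sub measurable_id)
    refine (hasFDerivAt_integral_of_dominated_loc_of_lip
      (F := fun y t => L ((b i).normed volume t) (f (y - t)))
      (bound := fun t => C * (b i).normed volume t) univ_mem ?_ ?_ ?_ ?_ ?_ ?_).2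
    · refine Eventually.of_forall fun y => Continuous.aestronglyMeasurable ?_
      exact (b i).continuous_normed.smul (hf.continuous.comp (continuous_const.sub continuous_id))
    · refine Continuous.integrable_of_hasCompactSupport ?_ ?_
      · exact (b i).continuous_normed.smul (hf.continuous.comp (continuous_const.sub continuous_id))
      · exact (b i).hasCompactSupport_normed.smul_right
    · exact ((b i).continuous_normed.measurable.smul hm).aestronglyMeasurable
    · refine ae_of_all _ fun t => LipschitzOnWith.of_dist_le_mul fun y _ z _ => ?_
      have h0 := (b i).nonneg_normed (μ := volume) t
      simp only [L, ContinuousLinearMap.lsmul_apply, smul_eq_mul, dist_eq_norm, ← mul_sub,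
        norm_mul, Real.coe_nnabs]
      have := hf.dist_le_mul (y - t) (z - t)
      rw [dist_sub_right, dist_eq_norm, dist_eq_norm] at this
      rw [Real.norm_of_nonneg h0, abs_of_nonneg (by positivity), mul_comm (C : ℝ), mul_assoc]
      gcongr
    · exact (b i).integrable_normed.const_mul _
    · have h1 : ∀ᵐ t, DifferentiableAt ℝ f (x - t) :=
        (Measure.measurePreserving_sub_left volume x).quasiMeasurePreserving.ae
          (hf.ae_differentiableAt (μ := volume))
      filter_upwards [h1] with t ht
      have h2 : HasFDerivAt (fun y => f (y - t)) (fderiv ℝ f (x - t)) x := by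
        have h3 := ht.hasFDerivAt.comp x ((hasFDerivAt_id x).sub_const t)
        rwa [ContinuousLinearMap.comp_id] at h3
      exact h2.const_smul ((b i).normed volume t)
  have hfd : ∀ i x, fderiv ℝ (χ i) x =
      convolution ((b i).normed volume) (fderiv ℝ f) L' volume x := fun i x => (hderiv i x).fderiv
  have hli : LocallyIntegrable (fderiv ℝ f) volume :=
    locallyIntegrable_of_measurable_of_bound (measurable_fderiv ℝ f) C
      fun x => norm_fderiv_le_of_lipschitz ℝ hf
  have hratio : ∀ᶠ i in atTop, (b i).rOut ≤ 2 * (b i).rIn := Eventually.of_forall fun i => le_rfl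
  have hlimg : ∀ᵐ x, Tendsto (fun i => gradient f x - gradient (χ i) x) atTop (𝓝 0) := by
    filter_upwards [ContDiffBump.ae_convolution_tendsto_right_of_locallyIntegrable
      (μ := volume) hbout hratio hli] with x hx
    have h1 : Tendsto (fun i => fderiv ℝ (χ i) x) atTop (𝓝 (fderiv ℝ f x)) := by
      simpa only [hfd] using hx
    have h2 := ((InnerProductSpace.toDual ℝ ℂ).symm.continuous.tendsto _).comp h1
    have h3 := (tendsto_const_nhds (x := gradient f x)).sub h2
    simpa [gradient] using h3
  have hlim : ∀ᵐ x, Tendsto (fun i => f x - χ i x) atTop (𝓝 0) := by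
    filter_upwards [ContDiffBump.ae_convolution_tendsto_right_of_locallyIntegrable
      (μ := volume) hbout hratio hf.continuous.locallyIntegrable] with x hx
    have h3 := (tendsto_const_nhds (x := f x)).sub hx
    simpa using h3
  have hconvbound : ∀ {E : Type} [NormedAddCommGroup E] [NormedSpace ℝ E] (k : ℂ → E) (K : ℝ) (i : ℕ)
      (x : ℂ), (∀ y, ‖k y‖ ≤ K) → ‖convolution ((b i).normed volume) k
        (ContinuousLinearMap.lsmul ℝ ℝ) volume x‖ ≤ K := by
    intro E _ _ k K i x hK
    calc ‖convolution ((b i).normed volume) k (ContinuousLinearMap.lsmul ℝ ℝ) volume x‖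
        ≤ ∫ t, K * (b i).normed volume t := by
          refine norm_integral_le_of_norm_le ((b i).integrable_normed.const_mul _)
            (ae_of_all _ fun t => ?_)
          have h0 := (b i).nonneg_normed (μ := volume) t
          rw [ContinuousLinearMap.lsmul_apply, norm_smul, Real.norm_of_nonneg h0, mul_comm]
          gcongr
          exact hK _
      _ = K := by rw [integral_const_mul, hint, mul_one]
  have hM0 : 0 ≤ M := (norm_nonneg _).trans (hM 0)
  have t1 : Tendsto (fun i => eLpNorm (f - χ i) q (volume.restrict Ω)) atTop (𝓝 0) := by
    refine tendsto_eLpNorm_zero_of_bound hq0 hq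
      (fun i => (hf.continuous.sub (hχsmooth i).continuous).measurable)
      (M := (M + M).toNNReal) (fun i x => ?_) (ae_restrict_of_ae hlim)
    rw [← NNReal.coe_le_coe, coe_nnnorm, Real.coe_toNNReal _ (by positivity)]
    exact (norm_sub_le _ _).trans (add_le_add (hM x) (hconvbound f M i x hM))
  have t2 : Tendsto (fun i => eLpNorm (gradient f - gradient (χ i)) q (volume.restrict Ω)) atTop
      (𝓝 0) := by
    refine tendsto_eLpNorm_zero_of_bound hq0 hq
      (fun i => (measurable_gradient f).sub (measurable_gradient _))
      (M := C + C) (fun i x => ?_) (ae_restrict_of_ae hlimg)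
    rw [← NNReal.coe_le_coe, coe_nnnorm]
    refine (norm_sub_le _ _).trans (add_le_add (norm_gradient_le_of_lipschitz hf x) ?_)
    rw [norm_gradient, hfd]
    exact hconvbound (fderiv ℝ f) C i x fun y => norm_fderiv_le_of_lipschitz ℝ hf
  have t3 := t1.add t2
  rw [add_zero] at t3
  -- Mollification at a radius below δ enlarges the support by less than δ, hence keeps it inside Ω.
  obtain ⟨δ, hδ, hδΩ⟩ := hfc.isCompact.exists_cthickening_subset_open hΩ hfs
  have e1 := t3.eventually (eventually_le_nhds hε)
  have e2 := hbout.eventually (eventually_lt_nhds hδ)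
  obtain ⟨i, hi1, hi2⟩ := (e1.and e2).exists
  refine ⟨χ i, ⟨hχsmooth i, (b i).hasCompactSupport_normed.convolution L hfc, ?_⟩, hi1⟩
  refine Subset.trans (closure_minimal ?_ Metric.isClosed_cthickening) hδΩ
  refine (support_convolution_subset L).trans ?_
  rintro x ⟨y, hy, z, hz, rfl⟩
  rw [(b i).support_normed_eq] at hy
  refine Metric.mem_cthickening_of_dist_le _ z _ _ (subset_tsupport f hz) ?_
  have : dist y 0 < δ := (Metric.mem_ball.1 hy).trans hi2
  simpa [dist_eq_norm] using this.le

/-! ### Convergence of multipliers -/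

lemma exists_eLpNorm_limit_of_cauchy {E : Type*} [NormedAddCommGroup E] [CompleteSpace E]
    {μ : Measure ℂ} {q : ℝ≥0∞} (hq : 1 ≤ q) {f : ℕ → ℂ → E} (hf : ∀ k, MemLp (f k) q μ)
    {e : ℕ → ℝ≥0∞} (he : Tendsto e atTop (𝓝 0))
    (hfe : ∀ k l, eLpNorm (f k - f l) q μ ≤ e k + e l) :
    ∃ g, MemLp g q μ ∧ Tendsto (fun k => eLpNorm (f k - g) q μ) atTop (𝓝 0) := by
  have : Fact (1 ≤ q) := ⟨hq⟩
  have hc : CauchySeq fun k => (hf k).toLp := by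
    rw [EMetric.cauchySeq_iff]
    intro ε hε
    have h2 : 0 < ε / 2 := ENNReal.half_pos hε.ne'
    obtain ⟨N, hN⟩ := eventually_atTop.1 (he.eventually (eventually_lt_nhds h2))
    refine ⟨N, fun m hm n hn => ?_⟩
    rw [Lp.edist_toLp_toLp]
    calc _ ≤ e m + e n := hfe m n
      _ < ε / 2 + ε / 2 := ENNReal.add_lt_add (hN m hm) (hN n hn)
      _ = ε := ENNReal.add_halves ε
  obtain ⟨g, hg⟩ := cauchySeq_tendsto_of_complete hc
  refine ⟨g, Lp.memLp g, ?_⟩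
  rw [Lp.tendsto_Lp_iff_tendsto_eLpNorm'] at hg
  refine hg.congr fun k => eLpNorm_congr_ae ?_
  filter_upwards [(hf k).coeFn_toLp] with x hx
  simp [hx]

lemma gradient_sub_ae {f g : ℂ → ℝ} {C D : ℝ≥0} (hf : LipschitzWith C f) (hg : LipschitzWith D g) :
    gradient (f - g) =ᵐ[volume] gradient f - gradient g := by
  filter_upwards [hf.ae_differentiableAt (μ := volume), hg.ae_differentiableAt (μ := volume)]
    with x h1 h2
  simp [gradient, fderiv_sub h1 h2]

lemma memLp_of_lipschitz {Ω : Set ℂ} (hfin : volume Ω ≠ ⊤) {f : ℂ → ℝ} {C : ℝ≥0}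
    (hf : LipschitzWith C f) (hfc : HasCompactSupport f) (q : ℝ≥0∞) :
    MemLp f q (volume.restrict Ω) ∧ MemLp (gradient f) q (volume.restrict Ω) := by
  have : IsFiniteMeasure (volume.restrict Ω) := ⟨by simpa using hfin.lt_top⟩
  obtain ⟨M, hM⟩ := hfc.exists_bound_of_continuous hf.continuous
  exact ⟨MemLp.of_bound hf.continuous.aestronglyMeasurable M (ae_of_all _ hM),
    MemLp.of_bound (measurable_gradient f).aestronglyMeasurable C
      (ae_of_all _ (norm_gradient_le_of_lipschitz hf))⟩

/-- If the multipliers `Λ n` act boundedly on the gradients of test functions, uniformly in `n`,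
and each test function is eventually unchanged, then `Λ n * u` converges to `u`. -/
theorem multiplier_convergence {Ω : Set ℂ} (hΩ : IsOpen Ω) (hfin : volume Ω ≠ ⊤) {r s : ℝ}
    (hs : 1 < s) (hsr : s < r) {u : ℂ → ℝ} (hu : MemW10 Ω r u) {c Λ : ℕ → ℂ → ℝ}
    (hcΛ : ∀ n, c n =ᵐ[volume.restrict Ω] Λ n) (hmeas : ∀ n, Measurable (Λ n))
    (hΛ1 : ∀ n x, ‖Λ n x‖ ≤ 1)
    (hlip : ∀ n φ, IsTestFunction Ω φ → ∃ L, LipschitzWith L fun x => Λ n x * φ x)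
    {C : ℝ≥0} (hgrad : ∀ n φ, IsTestFunction Ω φ →
      eLpNorm (gradient fun x => Λ n x * φ x) (ENNReal.ofReal r) (volume.restrict Ω) ≤
        C * eLpNorm (gradient φ) (ENNReal.ofReal r) (volume.restrict Ω))
    (hev : ∀ φ, IsTestFunction Ω φ → ∀ᶠ n in atTop, ∀ x, Λ n x * φ x = φ x) :
    (∀ n, MemW10 Ω s fun x => c n x * u x) ∧
    (∃ B : ℝ≥0, ∀ n, sobolevNorm Ω s (fun x => c n x * u x) ≤ B) ∧
    Tendsto (fun n => sobolevNorm Ω s fun x => c n x * u x - u x) atTop (𝓝 0) := by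
  have hfinm : IsFiniteMeasure (volume.restrict Ω) := ⟨by simpa using hfin.lt_top⟩
  obtain ⟨⟨hur, G, hG, hGr⟩, φ, hφ, hφu⟩ := hu
  set μ := volume.restrict Ω with hμ
  set q := ENNReal.ofReal r with hqdef
  set q' := ENNReal.ofReal s with hq'def
  have hr1 : 1 < r := hs.trans hsr
  have hq : 1 ≤ q := by rw [hqdef, ← ENNReal.ofReal_one]; exact ENNReal.ofReal_le_ofReal hr1.le
  have hqq : q' ≤ q := ENNReal.ofReal_le_ofReal hsr.le
  have hq'0 : q' ≠ 0 := by
    rw [hq'def, Ne, ENNReal.ofReal_eq_zero]; linarith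
  have hq't : q' ≠ ⊤ := ENNReal.ofReal_ne_top
  -- the comparison constant between the two exponents
  obtain ⟨A, hA, hA1, hA2⟩ : ∃ A : ℝ≥0∞, A ≠ ⊤ ∧
      (∀ f : ℂ → ℝ, MemLp f q μ → eLpNorm f q' μ ≤ A * eLpNorm f q μ) ∧
      (∀ f : ℂ → ℂ, MemLp f q μ → eLpNorm f q' μ ≤ A * eLpNorm f q μ) := by
    refine ⟨μ univ ^ (1 / q'.toReal - 1 / q.toReal),
      ENNReal.rpow_ne_top_of_nonneg ?_ (measure_ne_top _ _), fun f hf => ?_, fun f hf => ?_⟩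
    · rw [hqdef, hq'def, ENNReal.toReal_ofReal (by linarith), ENNReal.toReal_ofReal (by linarith),
        sub_nonneg]
      exact one_div_le_one_div_of_le (by linarith) hsr.le
    · rw [mul_comm]
      exact eLpNorm_le_eLpNorm_mul_rpow_measure_univ hqq hf.1
    · rw [mul_comm]
      exact eLpNorm_le_eLpNorm_mul_rpow_measure_univ hqq hf.1
  have hsob : ∀ (v : ℂ → ℝ) (g : ℂ → ℂ), HasWeakGradient Ω v g → MemLp v q μ → MemLp g q μ →
      sobolevNorm Ω s v ≤ A * (eLpNorm v q μ + eLpNorm g q μ) := by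
    intro v g hvg hv hg
    rw [mul_add]
    exact (sobolevNorm_le hvg hs.le).trans (add_le_add (hA1 v hv) (hA2 g hg))
  have hφlip : ∀ k, ∃ D, LipschitzWith D (φ k) := fun k => (hφ k).exists_lipschitz
  have hφmem : ∀ k, MemLp (φ k) q μ ∧ MemLp (gradient (φ k)) q μ := fun k => by
    obtain ⟨D, hD⟩ := hφlip k
    exact memLp_of_lipschitz hfin hD (hφ k).2.1 q
  have hφgrad : ∀ k, HasWeakGradient Ω (φ k) (gradient (φ k)) := fun k => by
    obtain ⟨D, hD⟩ := hφlip k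
    exact hasWeakGradient_of_lipschitz hD Ω
  -- All later errors are expressed by `a k` and `e k`, which do not involve n.
  set a : ℕ → ℝ≥0∞ := fun k => eLpNorm (u - φ k) q μ with ha
  set e : ℕ → ℝ≥0∞ := fun k => eLpNorm (G - gradient (φ k)) q μ with he
  have ha0 : Tendsto a atTop (𝓝 0) :=
    tendsto_of_tendsto_of_tendsto_of_le_of_le tendsto_const_nhds hφu (fun _ => zero_le)
      fun k => (eLpNorm_le_sobolevNorm hΩ (hG.sub (hφgrad k)) (by linarith)).1
  have he0 : Tendsto e atTop (𝓝 0) :=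
    tendsto_of_tendsto_of_tendsto_of_le_of_le tendsto_const_nhds hφu (fun _ => zero_le)
      fun k => (eLpNorm_le_sobolevNorm hΩ (hG.sub (hφgrad k)) (by linarith)).2
  have het : ∀ k, e k ≠ ⊤ := fun k => (hGr.sub (hφmem k).2).2.ne
  have hee : ∀ k l, eLpNorm (gradient (φ k) - gradient (φ l)) q μ ≤ e k + e l := by
    intro k l
    have : gradient (φ k) - gradient (φ l) =
        (G - gradient (φ l)) - (G - gradient (φ k)) := by abel
    rw [this, add_comm]
    exact eLpNorm_sub_le (hGr.sub (hφmem l).2).1 (hGr.sub (hφmem k).2).1 hq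
  -- multiplication by `Λ n`
  set f : ℕ → ℕ → ℂ → ℝ := fun n k x => Λ n x * φ k x with hf
  set F : ℕ → ℂ → ℝ := fun n x => Λ n x * u x with hF
  have hcF : ∀ n, F n =ᵐ[μ] fun x => c n x * u x := fun n => by
    filter_upwards [hcΛ n] with x hx
    rw [hx]
  have hΛmul : ∀ (n : ℕ) (v : ℂ → ℝ), eLpNorm (fun x => Λ n x * v x) q μ ≤ eLpNorm v q μ := by
    intro n v
    refine eLpNorm_mono fun x => ?_
    rw [norm_mul]
    exact mul_le_of_le_one_left (norm_nonneg _) (hΛ1 n x)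
  have hFmem : ∀ n, MemLp (F n) q μ := fun n =>
    ⟨(hmeas n).aestronglyMeasurable.mul hur.1, (hΛmul n u).trans_lt hur.2⟩
  have hfcs : ∀ n k, HasCompactSupport (f n k) := fun n k => (hφ k).2.1.mul_left
  have hfsupp : ∀ n k, tsupport (f n k) ⊆ Ω := fun n k =>
    (tsupport_mul_subset_right).trans (hφ k).2.2
  have hfmem : ∀ n k, MemLp (f n k) q μ ∧ MemLp (gradient (f n k)) q μ := fun n k => by
    obtain ⟨D, hD⟩ := hlip n (φ k) (hφ k)
    exact memLp_of_lipschitz hfin hD (hfcs n k) q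
  have hfgrad : ∀ n k, HasWeakGradient Ω (f n k) (gradient (f n k)) := fun n k => by
    obtain ⟨D, hD⟩ := hlip n (φ k) (hφ k)
    exact hasWeakGradient_of_lipschitz hD Ω
  have hFf : ∀ n k, eLpNorm (F n - f n k) q μ ≤ a k := fun n k => by
    have : F n - f n k = fun x => Λ n x * (u - φ k) x := by
      funext x; simp [hF, hf, mul_sub]
    rw [this]
    exact hΛmul n _
  -- The multiplier is linear, so the gradient bound can be applied to the test function φ_k - φ_l.
  -- The resulting Cauchy estimate is uniform in n.
  have hgf : ∀ n k l, eLpNorm (gradient (f n k) - gradient (f n l)) q μ ≤ C * (e k + e l) := by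
    intro n k l
    obtain ⟨D, hD⟩ := hlip n (φ k) (hφ k)
    obtain ⟨D', hD'⟩ := hlip n (φ l) (hφ l)
    have h1 : gradient (f n k - f n l) =ᵐ[μ] gradient (f n k) - gradient (f n l) :=
      ae_restrict_of_ae (gradient_sub_ae hD hD')
    have h2 : f n k - f n l = fun x => Λ n x * (φ k - φ l) x := by
      funext x; simp [hf, mul_sub]
    obtain ⟨B, hB⟩ := hφlip k
    obtain ⟨B', hB'⟩ := hφlip l
    have h3 : gradient (φ k - φ l) =ᵐ[μ] gradient (φ k) - gradient (φ l) :=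
      ae_restrict_of_ae (gradient_sub_ae hB hB')
    rw [← eLpNorm_congr_ae h1, h2]
    refine (hgrad n _ ((hφ k).sub (hφ l))).trans ?_
    rw [eLpNorm_congr_ae h3]
    gcongr
    exact hee k l
  have hCe0 : Tendsto (fun k => C * e k) atTop (𝓝 0) := by
    simpa using ENNReal.Tendsto.const_mul he0 (Or.inr ENNReal.coe_ne_top)
  -- The limit `H n` will be the weak gradient of Λ_n u; no product rule for u is needed.
  have hlimit : ∀ n, ∃ H, MemLp H q μ ∧
      Tendsto (fun k => eLpNorm (gradient (f n k) - H) q μ) atTop (𝓝 0) := fun n =>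
    exists_eLpNorm_limit_of_cauchy hq (fun k => (hfmem n k).2) hCe0
      fun k l => by rw [← mul_add]; exact hgf n k l
  choose H hHmem hHlim using hlimit
  have hHf : ∀ n k, eLpNorm (H n - gradient (f n k)) q μ ≤ C * e k := by
    intro n k
    have h1 : Tendsto (fun l => C * (e k + e l) + eLpNorm (gradient (f n l) - H n) q μ) atTop
        (𝓝 (C * (e k + 0) + 0)) :=
      (ENNReal.Tendsto.const_mul (tendsto_const_nhds.add he0) (Or.inr ENNReal.coe_ne_top)).add
        (hHlim n)
    rw [add_zero, add_zero] at h1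
    refine ge_of_tendsto' h1 fun l => ?_
    rw [eLpNorm_sub_comm]
    have : gradient (f n k) - H n =
        (gradient (f n k) - gradient (f n l)) + (gradient (f n l) - H n) := by abel
    rw [this]
    exact (eLpNorm_add_le ((hfmem n k).2.sub (hfmem n l).2).1
      ((hfmem n l).2.sub (hHmem n)).1 hq).trans (add_le_add_left (hgf n k l) _)
  have hFH : ∀ n, HasWeakGradient Ω (F n) (H n) := fun n => by
    refine HasWeakGradient.of_tendsto hfin hq (hfgrad n) (fun k => (hfmem n k).1)
      (fun k => (hfmem n k).2) (hFmem n) (hHmem n) ?_ (hHlim n)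
    refine tendsto_of_tendsto_of_tendsto_of_le_of_le tendsto_const_nhds ha0 (fun _ => zero_le)
      fun k => ?_
    dsimp only
    rw [eLpNorm_sub_comm]
    exact hFf n k
  have hcH : ∀ n, HasWeakGradient Ω (fun x => c n x * u x) (H n) := fun n =>
    (hFH n).congr_ae (hcF n)
  have hcmem : ∀ n, MemLp (fun x => c n x * u x) q μ := fun n =>
    (memLp_congr_ae (hcF n)).1 (hFmem n)
  have hcf : ∀ n k, eLpNorm ((fun x => c n x * u x) - f n k) q μ ≤ a k := fun n k => by
    refine (eLpNorm_congr_ae ?_).trans_le (hFf n k)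
    exact (hcF n).symm.sub EventuallyEq.rfl
  refine ⟨fun n => ⟨⟨(hcmem n).mono_exponent hqq, H n, hcH n, (hHmem n).mono_exponent hqq⟩, ?_⟩,
    ?_, ?_⟩
  -- The functions `f n k` are only Lipschitz with compact support in Ω. They are replaced by smooth
  -- ones with an error 1/(k+1).
  · have hχ : ∀ k : ℕ, ∃ χ, IsTestFunction Ω χ ∧ eLpNorm (f n k - χ) q' μ +
        eLpNorm (gradient (f n k) - gradient χ) q' μ ≤ ((k : ℝ≥0∞) + 1)⁻¹ := fun k => by
      obtain ⟨D, hD⟩ := hlip n (φ k) (hφ k)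
      exact exists_testFunction_near_lipschitz hΩ hfin hD (hfcs n k) (hfsupp n k) hq'0 hq't
        (by simp)
    choose χ hχt hχe using hχ
    refine ⟨χ, hχt, ?_⟩
    have hlim : Tendsto (fun k : ℕ => A * (a k + C * e k) + ((k : ℝ≥0∞) + 1)⁻¹) atTop (𝓝 0) := by
      have h1 := ENNReal.Tendsto.const_mul (a := A) (ha0.add hCe0) (Or.inr hA)
      have h2 : Tendsto (fun k : ℕ => ((k : ℝ≥0∞) + 1)⁻¹) atTop (𝓝 0) := by
        have := (tendsto_add_atTop_iff_nat 1).2 ENNReal.tendsto_inv_nat_nhds_zero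
        simpa using this
      simpa using h1.add h2
    refine tendsto_of_tendsto_of_tendsto_of_le_of_le tendsto_const_nhds hlim (fun _ => zero_le)
      fun k => ?_
    have hw : HasWeakGradient Ω ((fun x => c n x * u x) - χ k) (H n - gradient (χ k)) := by
      obtain ⟨D, hD⟩ := (hχt k).exists_lipschitz
      exact (hcH n).sub (hasWeakGradient_of_lipschitz hD Ω)
    have hχm : MemLp (χ k) q μ ∧ MemLp (gradient (χ k)) q μ := by
      obtain ⟨D, hD⟩ := (hχt k).exists_lipschitz
      exact memLp_of_lipschitz hfin hD (hχt k).2.1 q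
    have hq'1 : 1 ≤ q' := by
      rw [hq'def, ← ENNReal.ofReal_one]; exact ENNReal.ofReal_le_ofReal hs.le
    refine (sobolevNorm_le hw hs.le).trans ?_
    have h1 : eLpNorm ((fun x => c n x * u x) - χ k) q' μ ≤
        A * a k + eLpNorm (f n k - χ k) q' μ := by
      have : (fun x => c n x * u x) - χ k =
          ((fun x => c n x * u x) - f n k) + (f n k - χ k) := by abel
      rw [this]
      refine (eLpNorm_add_le ((hcmem n).sub (hfmem n k).1).1
        ((hfmem n k).1.sub hχm.1).1 hq'1).trans (add_le_add_left ?_ _)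
      exact (hA1 _ ((hcmem n).sub (hfmem n k).1)).trans (mul_le_mul_right (hcf n k) A)
    have h2 : eLpNorm (H n - gradient (χ k)) q' μ ≤
        A * (C * e k) + eLpNorm (gradient (f n k) - gradient (χ k)) q' μ := by
      have : H n - gradient (χ k) =
          (H n - gradient (f n k)) + (gradient (f n k) - gradient (χ k)) := by abel
      rw [this]
      refine (eLpNorm_add_le ((hHmem n).sub (hfmem n k).2).1
        ((hfmem n k).2.sub hχm.2).1 hq'1).trans (add_le_add_left ?_ _)
      exact (hA2 _ ((hHmem n).sub (hfmem n k).2)).trans (mul_le_mul_right (hHf n k) A)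
    calc _ ≤ (A * a k + eLpNorm (f n k - χ k) q' μ) +
          (A * (C * e k) + eLpNorm (gradient (f n k) - gradient (χ k)) q' μ) := add_le_add h1 h2
      _ = A * (a k + C * e k) + (eLpNorm (f n k - χ k) q' μ +
          eLpNorm (gradient (f n k) - gradient (χ k)) q' μ) := by ring
      _ ≤ _ := add_le_add_right (hχe k) _
  -- Any fixed index k would do here; k = 0 is taken.
  · have hHb : ∀ n, eLpNorm (H n) q μ ≤ C * e 0 + C * eLpNorm (gradient (φ 0)) q μ := fun n => by
      have : H n = (H n - gradient (f n 0)) + gradient (f n 0) := by abel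
      rw [this]
      exact (eLpNorm_add_le ((hHmem n).sub (hfmem n 0).2).1 (hfmem n 0).2.1 hq).trans
        (add_le_add (hHf n 0) (hgrad n _ (hφ 0)))
    have hub : ∀ n, eLpNorm (fun x => c n x * u x) q μ ≤ eLpNorm u q μ := fun n => by
      rw [← eLpNorm_congr_ae (hcF n)]
      exact hΛmul n u
    set B := A * (eLpNorm u q μ + (C * e 0 + C * eLpNorm (gradient (φ 0)) q μ)) with hB
    have hBt : B ≠ ⊤ := by
      refine ENNReal.mul_ne_top hA (ENNReal.add_ne_top.2 ⟨hur.2.ne, ENNReal.add_ne_top.2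
        ⟨ENNReal.mul_ne_top ENNReal.coe_ne_top (het 0),
          ENNReal.mul_ne_top ENNReal.coe_ne_top (hφmem 0).2.2.ne⟩⟩)
    refine ⟨B.toNNReal, fun n => ?_⟩
    rw [ENNReal.coe_toNNReal hBt]
    refine (hsob _ _ (hcH n) (hcmem n) (hHmem n)).trans ?_
    rw [hB]
    gcongr
    exacts [hub n, hHb n]
  · have hw : ∀ n, HasWeakGradient Ω (fun x => c n x * u x - u x) (H n - G) := fun n =>
      (hcH n).sub hG
    rw [ENNReal.tendsto_nhds_zero]
    intro ε hε
    have hlim : Tendsto (fun k => A * ((a k + a k) + (C * e k + e k))) atTop (𝓝 0) := by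
      have h1 := ENNReal.Tendsto.const_mul (a := A) ((ha0.add ha0).add (hCe0.add he0)) (Or.inr hA)
      simpa using h1
    -- The index k is fixed first by the uniform estimate; then n is taken so large that Λ_n φ_k =
    -- φ_k, and the two approximation errors add up.
    obtain ⟨k, hk⟩ := (hlim.eventually (eventually_le_nhds hε)).exists
    filter_upwards [hev (φ k) (hφ k)] with n hn
    have hfn : f n k = φ k := funext hn
    refine (hsob _ _ (hw n) ((hcmem n).sub hur) ((hHmem n).sub hGr)).trans (le_trans ?_ hk)
    gcongr
    · have : (fun x => c n x * u x - u x) =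
          ((fun x => c n x * u x) - f n k) - (u - φ k) := by
        rw [hfn]; funext x; simp
      rw [this]
      exact (eLpNorm_sub_le ((hcmem n).sub (hfmem n k).1).1 (hur.sub (hφmem k).1).1 hq).trans
        (add_le_add_left (hcf n k) _)
    · have : H n - G = (H n - gradient (f n k)) - (G - gradient (φ k)) := by
        rw [hfn]; abel
      rw [this]
      exact (eLpNorm_sub_le ((hHmem n).sub (hfmem n k).2).1 (hGr.sub (hφmem k).2).1 hq).trans
        (add_le_add_left (hHf n k) _)

/-! ### A Hardy inequality on star-shaped sets -/

lemma lintegral_rpow_Ioo_lt_top {a : ℝ} (ha : -1 < a) :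
    ∫⁻ t in Ioo (0 : ℝ) 1, ENNReal.ofReal (t ^ a) < ⊤ := by
  have h1 : IntervalIntegrable (fun t : ℝ => t ^ a) volume 0 1 :=
    intervalIntegral.intervalIntegrable_rpow' ha
  have h2 : IntegrableOn (fun t : ℝ => t ^ a) (Ioo 0 1) volume :=
    (intervalIntegrable_iff_integrableOn_Ioo_of_le zero_le_one).1 h1
  exact h2.lintegral_lt_top

/-- The exponent -2 is minus the real dimension of the plane. -/
lemma lintegral_comp_homothety (f : ℂ → ℝ≥0∞) (hf : Measurable f) (P : ℂ) {t : ℝ} (ht : 0 < t) :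
    ∫⁻ x, f (P + t • (x - P)) = ENNReal.ofReal (t ^ (-2 : ℝ)) * ∫⁻ x, f x := by
  have h1 : ∫⁻ x, f (P + t • (x - P)) = ∫⁻ x, f (P + t • x) :=
    lintegral_sub_right_eq_self (fun x => f (P + t • x)) P
  have h2 : Measurable fun x : ℂ => f (P + x) := hf.comp (measurable_const.add measurable_id)
  have h3 : ∫⁻ x, f (P + t • x) = ∫⁻ x, f (P + x) ∂(Measure.map (t • ·) volume) :=
    (lintegral_map h2 (measurable_const_smul t)).symm
  rw [h1, h3, Measure.map_addHaar_smul _ ht.ne', lintegral_smul_measure,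
    lintegral_add_left_eq_self]
  congr 2
  rw [Complex.finrank_real_complex, abs_of_pos (by positivity), Real.rpow_neg ht.le]
  norm_cast

/-- This is the fundamental theorem of calculus along the segment from P to x. If x = P, the left
side is zero by the convention for division. -/
lemma enorm_div_le_lintegral {φ : ℂ → ℝ} (hφ : ContDiff ℝ ∞ φ) {P : ℂ} (hP : φ P = 0) (x : ℂ) :
    ENNReal.ofReal (|φ x| / ‖x - P‖) ≤
      ∫⁻ t in Ioo (0 : ℝ) 1, ‖fderiv ℝ φ (P + t • (x - P))‖ₑ := by
  have hcf : Continuous (fderiv ℝ φ) := hφ.continuous_fderiv (by simp)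
  have hline : Continuous fun t : ℝ => P + t • (x - P) := by fun_prop
  have hd : ∀ t : ℝ, HasDerivAt (fun t : ℝ => φ (P + t • (x - P)))
      (fderiv ℝ φ (P + t • (x - P)) (x - P)) t := by
    intro t
    have h1 : HasDerivAt (fun t : ℝ => P + t • (x - P)) (x - P) t := by
      simpa using ((hasDerivAt_id t).smul_const (x - P)).const_add P
    exact ((hφ.differentiable (by simp)) _).hasFDerivAt.comp_hasDerivAt t h1
  have hc : Continuous fun t : ℝ => fderiv ℝ φ (P + t • (x - P)) (x - P) :=
    (hcf.comp hline).clm_apply continuous_const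
  have h2 := intervalIntegral.integral_eq_sub_of_hasDerivAt (fun t _ => hd t)
    (hc.intervalIntegrable 0 1)
  simp only [one_smul, add_sub_cancel, zero_smul, add_zero, hP, sub_zero] at h2
  have hcn : Continuous fun t : ℝ => ‖fderiv ℝ φ (P + t • (x - P))‖ := (hcf.comp hline).norm
  have h3 : |φ x| ≤ (∫ t in (0 : ℝ)..1, ‖fderiv ℝ φ (P + t • (x - P))‖) * ‖x - P‖ := by
    rw [← h2, ← Real.norm_eq_abs, ← intervalIntegral.integral_mul_const]
    refine intervalIntegral.norm_integral_le_of_norm_le zero_le_one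
      (ae_of_all _ fun t _ => ContinuousLinearMap.le_opNorm _ _)
      ((hcn.mul continuous_const).intervalIntegrable 0 1)
  have h0 : 0 ≤ ∫ t in (0 : ℝ)..1, ‖fderiv ℝ φ (P + t • (x - P))‖ :=
    intervalIntegral.integral_nonneg zero_le_one fun _ _ => norm_nonneg _
  have h4 : |φ x| / ‖x - P‖ ≤ ∫ t in (0 : ℝ)..1, ‖fderiv ℝ φ (P + t • (x - P))‖ :=
    div_le_of_le_mul₀ (norm_nonneg _) h0 h3
  refine (ENNReal.ofReal_le_ofReal h4).trans ?_
  rw [intervalIntegral.integral_of_le zero_le_one, integral_Ioc_eq_integral_Ioo,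
    ofReal_integral_eq_lintegral_ofReal _ (ae_of_all _ fun _ => norm_nonneg _)]
  · simp only [ofReal_norm]
    exact le_rfl
  · exact (hcn.integrableOn_Icc).mono_set Ioo_subset_Icc_self

/-- The quotient is bounded by the mean of |∇φ| over the segment from P. Hölder's inequality with
the weight t^(-1/2) · t^(1/2) and Fubini reduce the claim to the homotheties x ↦ P + t(x - P), whose
Jacobian contributes t^(-2). The constant depends on r only, in particular not on the size of S. -/
theorem exists_hardy_const {r : ℝ} (hr : 2 < r) : ∃ C : ℝ≥0, ∀ (φ : ℂ → ℝ), ContDiff ℝ ∞ φ →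
    ∀ (P : ℂ), φ P = 0 → ∀ S : Set ℂ, MeasurableSet S →
    (∀ x ∈ S, ∀ t ∈ Ioo (0 : ℝ) 1, P + t • (x - P) ∈ S) →
    ∫⁻ x in S, ENNReal.ofReal (|φ x| / ‖x - P‖) ^ r ≤ C * ∫⁻ x in S, ‖fderiv ℝ φ x‖ₑ ^ r := by
  have hr0 : 0 < r := by linarith
  set r' := r.conjExponent with hr'
  have hconj : r.HolderConjugate r' := Real.HolderConjugate.conjExponent (by linarith)
  have hr'2 : r' < 2 := by
    rw [hr', Real.conjExponent, div_lt_iff₀ (by linarith)]; linarith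
  have hr'0 : 0 < r' := hconj.symm.pos
  set K := (∫⁻ t in Ioo (0 : ℝ) 1, ENNReal.ofReal (t ^ (-(1 / 2) * r'))) ^ (1 / r') with hK
  set J := ∫⁻ t in Ioo (0 : ℝ) 1, ENNReal.ofReal (t ^ (1 / 2 * r + -2)) with hJ
  -- Both integrals converge because r > 2: this gives r' < 2, hence -r'/2 > -1, and also r/2 - 2 >
  -- -1.
  have hKt : K ≠ ⊤ := ENNReal.rpow_ne_top_of_nonneg (by positivity)
    (lintegral_rpow_Ioo_lt_top (by linarith)).ne
  have hJt : J ≠ ⊤ := (lintegral_rpow_Ioo_lt_top (by linarith)).ne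
  refine ⟨(K ^ r * J).toNNReal, fun φ hφ P hP S hS hstar => ?_⟩
  rw [ENNReal.coe_toNNReal (ENNReal.mul_ne_top (ENNReal.rpow_ne_top_of_nonneg hr0.le hKt) hJt)]
  have hcf : Continuous (fderiv ℝ φ) := hφ.continuous_fderiv (by simp)
  have hmD : Measurable fun y => ‖fderiv ℝ φ y‖ₑ ^ r := hcf.enorm.measurable.pow_const _
  have hmt : ∀ a : ℝ, Measurable fun t : ℝ => ENNReal.ofReal (t ^ a) := fun a =>
    (measurable_id.pow_const a).ennreal_ofReal
  have hpt : ∀ x, ENNReal.ofReal (|φ x| / ‖x - P‖) ^ r ≤ K ^ r * ∫⁻ t in Ioo (0 : ℝ) 1,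
      ENNReal.ofReal (t ^ (1 / 2 * r)) * ‖fderiv ℝ φ (P + t • (x - P))‖ₑ ^ r := by
    intro x
    have hline : Continuous fun t : ℝ => P + t • (x - P) := by fun_prop
    have hmx : Measurable fun t : ℝ => ‖fderiv ℝ φ (P + t • (x - P))‖ₑ :=
      (hcf.comp hline).enorm.measurable
    have h1 := ENNReal.lintegral_mul_le_Lp_mul_Lq (volume.restrict (Ioo (0 : ℝ) 1)) hconj.symm
      (f := fun t => ENNReal.ofReal (t ^ (-(1 / 2) : ℝ)))
      (g := fun t => ENNReal.ofReal (t ^ (1 / 2 : ℝ)) * ‖fderiv ℝ φ (P + t • (x - P))‖ₑ)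
      (hmt _).aemeasurable ((hmt _).mul hmx).aemeasurable
    have e1 : ∫⁻ t in Ioo (0 : ℝ) 1, ‖fderiv ℝ φ (P + t • (x - P))‖ₑ =
        ∫⁻ t in Ioo (0 : ℝ) 1, ((fun t => ENNReal.ofReal (t ^ (-(1 / 2) : ℝ))) *
          fun t => ENNReal.ofReal (t ^ (1 / 2 : ℝ)) * ‖fderiv ℝ φ (P + t • (x - P))‖ₑ) t := by
      refine setLIntegral_congr_fun measurableSet_Ioo fun t ht => ?_
      have ht0 : 0 < t := ht.1
      simp only [Pi.mul_apply]
      rw [← mul_assoc, ← ENNReal.ofReal_mul (by positivity), ← Real.rpow_add ht0]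
      simp
    have e2 : ∫⁻ t in Ioo (0 : ℝ) 1, ENNReal.ofReal (t ^ (-(1 / 2) : ℝ)) ^ r' =
        ∫⁻ t in Ioo (0 : ℝ) 1, ENNReal.ofReal (t ^ (-(1 / 2) * r')) := by
      refine setLIntegral_congr_fun measurableSet_Ioo fun t ht => ?_
      have ht0 : 0 < t := ht.1
      rw [ENNReal.ofReal_rpow_of_nonneg (by positivity) hr'0.le, ← Real.rpow_mul ht0.le]
    have e3 : ∫⁻ t in Ioo (0 : ℝ) 1,
        (ENNReal.ofReal (t ^ (1 / 2 : ℝ)) * ‖fderiv ℝ φ (P + t • (x - P))‖ₑ) ^ r =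
        ∫⁻ t in Ioo (0 : ℝ) 1,
          ENNReal.ofReal (t ^ (1 / 2 * r)) * ‖fderiv ℝ φ (P + t • (x - P))‖ₑ ^ r := by
      refine setLIntegral_congr_fun measurableSet_Ioo fun t ht => ?_
      have ht0 : 0 < t := ht.1
      rw [ENNReal.mul_rpow_of_nonneg _ _ hr0.le,
        ENNReal.ofReal_rpow_of_nonneg (by positivity) hr0.le, ← Real.rpow_mul ht0.le]
    rw [← e1, e2, e3] at h1
    have h2 := (enorm_div_le_lintegral hφ hP x).trans h1
    refine (ENNReal.rpow_le_rpow h2 hr0.le).trans_eq ?_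
    rw [ENNReal.mul_rpow_of_nonneg _ _ hr0.le, one_div r, ENNReal.rpow_inv_rpow hr0.ne']
  have hjoint : Measurable fun p : ℂ × ℝ =>
      ENNReal.ofReal (p.2 ^ (1 / 2 * r)) * ‖fderiv ℝ φ (P + p.2 • (p.1 - P))‖ₑ ^ r := by
    have hc : Continuous fun p : ℂ × ℝ => P + p.2 • (p.1 - P) := by fun_prop
    exact ((hmt _).comp measurable_snd).mul (hmD.comp hc.measurable)
  calc ∫⁻ x in S, ENNReal.ofReal (|φ x| / ‖x - P‖) ^ r
      ≤ ∫⁻ x in S, K ^ r * ∫⁻ t in Ioo (0 : ℝ) 1,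
          ENNReal.ofReal (t ^ (1 / 2 * r)) * ‖fderiv ℝ φ (P + t • (x - P))‖ₑ ^ r :=
        lintegral_mono fun x => hpt x
    _ = K ^ r * ∫⁻ t in Ioo (0 : ℝ) 1, ∫⁻ x in S,
          ENNReal.ofReal (t ^ (1 / 2 * r)) * ‖fderiv ℝ φ (P + t • (x - P))‖ₑ ^ r := by
        rw [lintegral_const_mul _ hjoint.lintegral_prod_right',
          lintegral_lintegral_swap hjoint.aemeasurable]
    _ ≤ K ^ r * ∫⁻ t in Ioo (0 : ℝ) 1, ENNReal.ofReal (t ^ (1 / 2 * r + -2)) *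
          ∫⁻ x in S, ‖fderiv ℝ φ x‖ₑ ^ r := by
        refine mul_le_mul_right (setLIntegral_mono' measurableSet_Ioo fun t ht => ?_) _
        have ht0 : 0 < t := ht.1
        have hhom : Measurable fun x : ℂ => P + t • (x - P) := by fun_prop
        have hmx : Measurable fun x : ℂ => ‖fderiv ℝ φ (P + t • (x - P))‖ₑ ^ r := hmD.comp hhom
        rw [lintegral_const_mul _ hmx, Real.rpow_add ht0,
          ENNReal.ofReal_mul (by positivity), mul_assoc]
        refine mul_le_mul_right ?_ _
        -- Star-shapedness permits the insertion of the indicator of S at the contracted point, so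
        -- that the integral after the change of variables is again over S.
        calc ∫⁻ x in S, ‖fderiv ℝ φ (P + t • (x - P))‖ₑ ^ r
            ≤ ∫⁻ x in S, S.indicator (fun y => ‖fderiv ℝ φ y‖ₑ ^ r) (P + t • (x - P)) := by
              refine setLIntegral_mono' hS fun x hx => ?_
              rw [indicator_of_mem (hstar x hx t ht)]
          _ ≤ ∫⁻ x, S.indicator (fun y => ‖fderiv ℝ φ y‖ₑ ^ r) (P + t • (x - P)) :=
              setLIntegral_le_lintegral _ _
          _ = ENNReal.ofReal (t ^ (-2 : ℝ)) * ∫⁻ x in S, ‖fderiv ℝ φ x‖ₑ ^ r := by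
              rw [lintegral_comp_homothety _ (hmD.indicator hS) P ht0, lintegral_indicator hS]
    _ = K ^ r * J * ∫⁻ x in S, ‖fderiv ℝ φ x‖ₑ ^ r := by
        rw [lintegral_mul_const _ (hmt _), mul_assoc]

/-! ### Rational parametrization of the Koch similitudes -/

/-- `κ` is the tangent of half the angle of the Koch similitudes and `t` the tangent of the base
angle of the inner triangles; all coefficients of the similitudes are polynomials in `κ`. -/
structure KochParam (α η κ t : ℝ) : Prop where
  κ_pos : 0 < κ
  κ_lt : κ < 1
  α_eq : α = 4 / (1 + κ ^ 2)
  cos_eq : Real.cos (kochAngle α) = (1 - κ ^ 2) / (1 + κ ^ 2)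
  sin_eq : Real.sin (kochAngle α) = 2 * κ / (1 + κ ^ 2)
  sqrt_eq : √(1 / α - 1 / 4) = κ / 2
  t_pos : 0 < t
  t_le : t ≤ κ
  κt_le : 2 * κ * t ≤ 1 - κ ^ 2
  t_eq : Real.tan η = t

/-- With κ² = 4/α - 1 the half-angle formulas make all data rational. Of the two bounds on η, η ≤
ϑ/2 becomes t ≤ κ, and η ≤ π/2 - ϑ becomes 2κt ≤ 1 - κ² through cos(η + ϑ) ≥ 0. -/
lemma exists_kochParam {α η : ℝ} (hα2 : 2 < α) (hα4 : α < 4) (hη0 : 0 < η)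
    (hη : η ≤ min (Real.pi / 2 - kochAngle α) (kochAngle α / 2)) :
    ∃ κ t, KochParam α η κ t := by
  have hα0 : 0 < α := by linarith
  have hpos : 0 < 4 / α - 1 := by
    rw [sub_pos, lt_div_iff₀ hα0]; linarith
  set κ := √(4 / α - 1) with hκ
  have hκ2 : κ ^ 2 = 4 / α - 1 := Real.sq_sqrt hpos.le
  have hκ0 : 0 < κ := Real.sqrt_pos.2 hpos
  have hκ1 : κ < 1 := by
    have : κ ^ 2 < 1 := by
      rw [hκ2, sub_lt_iff_lt_add, div_lt_iff₀ hα0]; linarith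
    nlinarith
  have hακ : α = 4 / (1 + κ ^ 2) := by
    rw [hκ2]; field_simp; ring
  have hκ' : 0 < 1 + κ ^ 2 := by positivity
  have hs : √(α * (4 - α)) / 2 = 2 * κ / (1 + κ ^ 2) := by
    have h1 : α * (4 - α) = (4 * κ / (1 + κ ^ 2)) ^ 2 := by
      rw [hακ]; field_simp; ring
    rw [h1, Real.sqrt_sq (by positivity)]
    field_simp; ring
  have hle : 2 * κ / (1 + κ ^ 2) ≤ 1 := by
    rw [div_le_one hκ']; nlinarith [sq_nonneg (1 - κ)]
  have hnn : 0 < 2 * κ / (1 + κ ^ 2) := by positivity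
  have hsin : Real.sin (kochAngle α) = 2 * κ / (1 + κ ^ 2) := by
    rw [kochAngle, hs, Real.sin_arcsin (by linarith) hle]
  have hcos : Real.cos (kochAngle α) = (1 - κ ^ 2) / (1 + κ ^ 2) := by
    rw [kochAngle, hs, Real.cos_arcsin]
    have : 1 - (2 * κ / (1 + κ ^ 2)) ^ 2 = ((1 - κ ^ 2) / (1 + κ ^ 2)) ^ 2 := by
      field_simp; ring
    rw [this, Real.sqrt_sq]
    apply div_nonneg _ hκ'.le
    nlinarith
  have hcpos : 0 < Real.cos (kochAngle α) := by
    rw [hcos]; apply div_pos _ hκ'; nlinarith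
  have hθ0 : 0 < kochAngle α := by rw [kochAngle, hs]; exact Real.arcsin_pos.2 hnn
  have hθle : kochAngle α ≤ Real.pi / 2 := Real.arcsin_le_pi_div_two _
  have hη1 : η ≤ Real.pi / 2 - kochAngle α := hη.trans (min_le_left _ _)
  have hη2 : η ≤ kochAngle α / 2 := hη.trans (min_le_right _ _)
  have hpi := Real.pi_pos
  have hcη : 0 < Real.cos η := Real.cos_pos_of_mem_Ioo ⟨by linarith, by linarith⟩
  have hsη : 0 < Real.sin η := Real.sin_pos_of_pos_of_lt_pi hη0 (by linarith)
  have htη : Real.tan η * Real.cos η = Real.sin η := Real.tan_mul_cos hcη.ne'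
  have ht0 : 0 < Real.tan η := Real.tan_pos_of_pos_of_lt_pi_div_two hη0 (by linarith)
  have hh : Real.tan (kochAngle α / 2) = κ := by
    have hc : 0 < Real.cos (kochAngle α / 2) :=
      Real.cos_pos_of_mem_Ioo ⟨by linarith, by linarith⟩
    have h1 := Real.cos_sq (kochAngle α / 2)
    have h2 := Real.sin_two_mul (kochAngle α / 2)
    rw [mul_div_cancel₀ _ two_ne_zero] at h1 h2
    rw [Real.tan_eq_sin_div_cos, div_eq_iff hc.ne']
    have h3 : Real.sin (kochAngle α / 2) * Real.cos (kochAngle α / 2) =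
        κ * Real.cos (kochAngle α / 2) * Real.cos (kochAngle α / 2) := by
      rw [hsin] at h2
      rw [hcos] at h1
      have : κ * Real.cos (kochAngle α / 2) * Real.cos (kochAngle α / 2) =
        κ * Real.cos (kochAngle α / 2) ^ 2 := by ring
      rw [this, h1]
      have h4 : Real.sin (kochAngle α / 2) * Real.cos (kochAngle α / 2) =
        2 * κ / (1 + κ ^ 2) / 2 := by rw [h2]; ring
      rw [h4]
      field_simp
      ring
    exact mul_right_cancel₀ hc.ne' h3
  refine ⟨κ, Real.tan η, hκ0, hκ1, hακ, hcos, hsin, ?_, ht0, ?_, ?_, rfl⟩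
  · have : 1 / α - 1 / 4 = (κ / 2) ^ 2 := by
      rw [hακ]; field_simp; ring
    rw [this, Real.sqrt_sq (by positivity)]
  · rw [← hh]
    rcases hη2.eq_or_lt with h | h
    · rw [h]
    · exact (Real.tan_lt_tan_of_lt_of_lt_pi_div_two (by linarith) (by linarith) h).le
  · have h1 : 0 ≤ Real.cos (η + kochAngle α) :=
      Real.cos_nonneg_of_neg_pi_div_two_le_of_le (by linarith) (by linarith)
    rw [Real.cos_add, hcos, hsin, ← htη] at h1
    have h2 : Real.cos η * ((1 - κ ^ 2) / (1 + κ ^ 2)) -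
        Real.tan η * Real.cos η * (2 * κ / (1 + κ ^ 2)) =
        Real.cos η / (1 + κ ^ 2) * ((1 - κ ^ 2) - 2 * κ * Real.tan η) := by
      field_simp
    rw [h2] at h1
    have := nonneg_of_mul_nonneg_right h1 (by positivity)
    linarith

/-- The linear parts of the Koch similitudes. -/
noncomputable def kochLin (κ : ℝ) : Fin 4 → ℂ :=
  ![⟨(1 + κ ^ 2) / 4, 0⟩, ⟨(1 - κ ^ 2) / 4, 2 * κ / 4⟩, ⟨(1 - κ ^ 2) / 4, -(2 * κ) / 4⟩,
    ⟨(1 + κ ^ 2) / 4, 0⟩]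

/-- The translation parts of the Koch similitudes. -/
noncomputable def kochOff (κ : ℝ) : Fin 4 → ℂ :=
  ![0, ⟨(1 + κ ^ 2) / 4, 0⟩, ⟨1 / 2, κ / 2⟩, ⟨(3 - κ ^ 2) / 4, 0⟩]

namespace KochParam

variable {α η κ t : ℝ} (h : KochParam α η κ t)
include h

lemma κ_sq_lt : κ ^ 2 < 1 := by nlinarith [h.κ_pos, h.κ_lt]

lemma inv_α : (α : ℂ)⁻¹ = ((1 + κ ^ 2) / 4 : ℝ) := by
  rw [h.α_eq, ← Complex.ofReal_inv, inv_div]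

lemma kochTip_eq : kochTip α = ⟨1 / 2, κ / 2⟩ := by
  rw [kochTip, h.sqrt_eq]
  apply Complex.ext <;> simp

/-- The factor 1 + κ² in 1/α = (1 + κ²)/4 cancels the denominators of cos ϑ and sin ϑ, so the
coefficients become polynomials in κ. -/
lemma kochMap_eq (i : Fin 4) (z : ℂ) : kochMap α i z = kochLin κ i * z + kochOff κ i := by
  have hκ : (1 + κ ^ 2) ≠ 0 := by positivity
  have hexp : Complex.exp (Complex.I * kochAngle α) =
      ⟨(1 - κ ^ 2) / (1 + κ ^ 2), 2 * κ / (1 + κ ^ 2)⟩ := by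
    apply Complex.ext <;> simp [Complex.exp_re, Complex.exp_im, h.cos_eq, h.sin_eq]
  have hexp' : Complex.exp (-(Complex.I * kochAngle α)) =
      ⟨(1 - κ ^ 2) / (1 + κ ^ 2), -(2 * κ / (1 + κ ^ 2))⟩ := by
    apply Complex.ext <;> simp [Complex.exp_re, Complex.exp_im, h.cos_eq, h.sin_eq]
  have e1 : (1 / α : ℂ) = ⟨(1 + κ ^ 2) / 4, 0⟩ := by
    rw [one_div, h.inv_α]; rfl
  have e2 : ∀ z : ℂ, z / α = ⟨z.re * ((1 + κ ^ 2) / 4), z.im * ((1 + κ ^ 2) / 4)⟩ := by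
    intro z
    rw [div_eq_mul_inv, h.inv_α]
    apply Complex.ext
    · rw [Complex.re_mul_ofReal]
    · rw [Complex.im_mul_ofReal]
  fin_cases i
  · change z / α = (⟨(1 + κ ^ 2) / 4, 0⟩ : ℂ) * z + 0
    rw [e2]
    apply Complex.ext <;> simp <;> ring
  · change z / α * Complex.exp (Complex.I * kochAngle α) + 1 / α =
      (⟨(1 - κ ^ 2) / 4, 2 * κ / 4⟩ : ℂ) * z + ⟨(1 + κ ^ 2) / 4, 0⟩
    rw [hexp, e1, e2]
    apply Complex.ext <;> simp <;> field_simp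
    ring
  · change z / α * Complex.exp (-(Complex.I * kochAngle α)) + kochTip α =
      (⟨(1 - κ ^ 2) / 4, -(2 * κ) / 4⟩ : ℂ) * z + ⟨1 / 2, κ / 2⟩
    rw [hexp', h.kochTip_eq, e2]
    apply Complex.ext <;> simp <;> field_simp <;> ring
  · change (z - 1) / α + 1 = (⟨(1 + κ ^ 2) / 4, 0⟩ : ℂ) * z + ⟨(3 - κ ^ 2) / 4, 0⟩
    rw [e2]
    apply Complex.ext <;> simp <;> ring

omit h in
lemma norm_kochLin (κ : ℝ) (i : Fin 4) : ‖kochLin κ i‖ = (1 + κ ^ 2) / 4 := by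
  have h0 : (0 : ℝ) ≤ (1 + κ ^ 2) / 4 := by positivity
  rw [← abs_of_nonneg h0, ← abs_norm, ← sq_eq_sq_iff_abs_eq_abs, Complex.sq_norm,
    Complex.normSq_apply]
  fin_cases i <;> simp [kochLin] <;> ring

end KochParam

/-! ### Triangles -/

/-- An affine function which is at most `c` on an open set is less than `c` there. -/
lemma lt_of_isOpen_of_le {U : Set ℂ} (hU : IsOpen U) {a b c : ℝ} (hab : a ≠ 0 ∨ b ≠ 0)
    (h : ∀ z ∈ U, a * z.re + b * z.im ≤ c) {z : ℂ} (hz : z ∈ U) : a * z.re + b * z.im < c := by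
  have hc : Continuous fun ε : ℝ => z + ε * (⟨a, b⟩ : ℂ) := by fun_prop
  have h1 : ∀ᶠ ε : ℝ in 𝓝[>] 0, z + ε * (⟨a, b⟩ : ℂ) ∈ U := by
    refine (hc.tendsto 0).eventually_mem ?_ |>.filter_mono nhdsWithin_le_nhds
    simpa using hU.mem_nhds hz
  obtain ⟨ε, hε, hε0⟩ := (h1.and self_mem_nhdsWithin).exists
  have h2 := h _ hε
  have h3 : 0 < a ^ 2 + b ^ 2 := by
    rcases hab with h | h <;> positivity
  simp only [Complex.add_re, Complex.mul_re, Complex.ofReal_re, Complex.ofReal_im, Complex.add_im,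
    Complex.mul_im, zero_mul, sub_zero, add_zero] at h2
  nlinarith [mul_pos (show 0 < ε from hε0) h3]

/-- The quotient im z / h is the barycentric weight of the apex. Dividing by h treats triangles
above and below the base together. -/
lemma convexHull_isosceles {p q h : ℝ} (hpq : p < q) (hh : h ≠ 0) :
    convexHull ℝ {(p : ℂ), (q : ℂ), (⟨(p + q) / 2, h⟩ : ℂ)} =
      {z : ℂ | 0 ≤ z.im / h ∧ z.im / h * ((q - p) / 2) ≤ z.re - p ∧
        z.im / h * ((q - p) / 2) ≤ q - z.re} := by
  apply Subset.antisymm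
  · refine convexHull_min ?_ ?_
    · rintro z (rfl | rfl | rfl)
      · simp; linarith
      · simp; linarith
      · simp [hh]; constructor <;> linarith
    · rintro x ⟨x1, x2, x3⟩ y ⟨y1, y2, y3⟩ a b ha hb hab
      have e : (a • x + b • y).im / h = a * (x.im / h) + b * (y.im / h) := by
        simp; ring
      have e' : (a • x + b • y).re = a * x.re + b * y.re := by simp
      simp only [mem_ofPred_eq, e, e']
      have hb' : b = 1 - a := by linarith
      have m1 := mul_nonneg ha x1
      have m2 := mul_nonneg hb y1
      have m3 := mul_le_mul_of_nonneg_left x2 ha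
      have m4 := mul_le_mul_of_nonneg_left y2 hb
      have m5 := mul_le_mul_of_nonneg_left x3 ha
      have m6 := mul_le_mul_of_nonneg_left y3 hb
      refine ⟨by linarith, ?_, ?_⟩
      · have : p = a * p + b * p := by rw [← add_mul, hab, one_mul]
        linarith
      · have : q = a * q + b * q := by rw [← add_mul, hab, one_mul]
        linarith
  · rintro z ⟨z1, z2, z3⟩
    have hd : 0 < q - p := by linarith
    have hc := convex_convexHull ℝ {(p : ℂ), (q : ℂ), (⟨(p + q) / 2, h⟩ : ℂ)}
    have hp : (p : ℂ) ∈ convexHull ℝ {(p : ℂ), (q : ℂ), (⟨(p + q) / 2, h⟩ : ℂ)} :=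
      subset_convexHull ℝ _ (by simp)
    have hq : (q : ℂ) ∈ convexHull ℝ {(p : ℂ), (q : ℂ), (⟨(p + q) / 2, h⟩ : ℂ)} :=
      subset_convexHull ℝ _ (by simp)
    have ht : (⟨(p + q) / 2, h⟩ : ℂ) ∈ convexHull ℝ {(p : ℂ), (q : ℂ), (⟨(p + q) / 2, h⟩ : ℂ)} :=
      subset_convexHull ℝ _ (by simp)
    set w := z.im / h with hw
    have hzw : z.im = w * h := by rw [hw]; field_simp
    have key := hc.sum_mem (t := (Finset.univ : Finset (Fin 3)))
      (w := ![(q - z.re - w * ((q - p) / 2)) / (q - p), (z.re - p - w * ((q - p) / 2)) / (q - p), w])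
      (z := ![(p : ℂ), (q : ℂ), (⟨(p + q) / 2, h⟩ : ℂ)]) ?_ ?_ ?_
    · convert key
      rw [Fin.sum_univ_three]
      simp only [Matrix.cons_val_zero, Matrix.cons_val_one, Matrix.cons_val]
      apply Complex.ext
      · simp only [Complex.add_re, Complex.smul_re, Complex.ofReal_re, smul_eq_mul]
        field_simp
        ring
      · simp only [Complex.add_im, Complex.smul_im, Complex.ofReal_im, smul_eq_mul, hzw]
        ring
    · intro i _
      fin_cases i
      · exact div_nonneg (by linarith) hd.le
      · exact div_nonneg (by linarith) hd.le
      · exact z1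
    · rw [Fin.sum_univ_three]
      simp
      field_simp
      ring
    · intro i _
      fin_cases i
      exacts [hp, hq, ht]

/-- The closed triangle above `[0, 1]` with base angles of tangent `κ`. -/
noncomputable def upperTriangle (κ : ℝ) : Set ℂ :=
  {z | 0 ≤ z.im ∧ z.im ≤ κ * z.re ∧ z.im ≤ κ * (1 - z.re)}

/-- The open triangle above `[0, 1]` with base angles of tangent `κ`. -/
noncomputable def upperTriangleInt (κ : ℝ) : Set ℂ :=
  {z | 0 < z.im ∧ z.im < κ * z.re ∧ z.im < κ * (1 - z.re)}

/-- The open triangle below `[0, 1]` with base angles of tangent `t`. -/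
noncomputable def lowerTriangle (t : ℝ) : Set ℂ :=
  {z | z.im < 0 ∧ -z.im < t * z.re ∧ -z.im < t * (1 - z.re)}

/-- The open triangle below `[0, 1]` with base angles `2 arctan t`. -/
noncomputable def doubleTriangle (t : ℝ) : Set ℂ :=
  {z | z.im < 0 ∧ (1 - t ^ 2) * -z.im < 2 * t * z.re ∧ (1 - t ^ 2) * -z.im < 2 * t * (1 - z.re)}

/-- A closed kite with diagonal `[0, 1]` which is mapped into itself by the Koch similitudes. -/
noncomputable def invariantKite (κ : ℝ) : Set ℂ :=
  {z | (z.im ≤ κ * z.re ∧ z.im ≤ κ * (1 - z.re)) ∧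
    ((1 - κ ^ 2) * -z.im ≤ 2 * κ * z.re ∧ (1 - κ ^ 2) * -z.im ≤ 2 * κ * (1 - z.re)) ∧
    (4 * κ ^ 2 - (1 - κ ^ 2) ^ 2) * -z.im ≤ 4 * κ * (1 - κ ^ 2) * z.re ∧
    (4 * κ ^ 2 - (1 - κ ^ 2) ^ 2) * -z.im ≤ 4 * κ * (1 - κ ^ 2) * (1 - z.re)}

lemma innerTriangle_eq {η t : ℝ} (ht : 0 < t) (h : Real.tan η = t) :
    innerTriangle η = lowerTriangle t := by
  have e : convexHull ℝ {(0 : ℂ), (1 : ℂ), 1 / 2 - Complex.I * (Real.tan η / 2 : ℝ)} =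
      {z | 0 ≤ -z.im ∧ -z.im ≤ t * z.re ∧ -z.im ≤ t * (1 - z.re)} := by
    have := convexHull_isosceles (p := 0) (q := 1) (h := -(t / 2)) zero_lt_one
      (by simp [ht.ne'])
    have e2 : (1 / 2 - Complex.I * (Real.tan η / 2 : ℝ) : ℂ) = ⟨(0 + 1) / 2, -(t / 2)⟩ := by
      rw [h]; apply Complex.ext <;> simp
    rw [e2]
    simp only [Complex.ofReal_zero, Complex.ofReal_one] at this
    rw [this]
    ext z
    have e3 : z.im / -(t / 2) = 2 * (-z.im / t) := by field_simp
    have e4 : 2 * (-z.im / t) * ((1 - 0) / 2) = -z.im / t := by ring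
    have e5 : 0 ≤ 2 * (-z.im / t) ↔ 0 ≤ -z.im := by
      rw [mul_nonneg_iff_of_pos_left two_pos, le_div_iff₀ ht, zero_mul]
    simp only [mem_ofPred_eq, e3, e4, e5]
    rw [sub_zero, div_le_iff₀ ht, div_le_iff₀ ht, mul_comm t, mul_comm t]
  rw [innerTriangle, e]
  apply Subset.antisymm
  · intro z hz
    have hU := isOpen_interior (s := {z : ℂ | 0 ≤ -z.im ∧ -z.im ≤ t * z.re ∧ -z.im ≤ t * (1 - z.re)})
    have h1 := lt_of_isOpen_of_le (a := 0) (b := 1) (c := 0) hU (by simp)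
      (fun z hz => by have := (interior_subset hz).1; linarith) hz
    have h2 := lt_of_isOpen_of_le (a := -t) (b := -1) (c := 0) hU (by simp)
      (fun z hz => by have := (interior_subset hz).2.1; linarith) hz
    have h3 := lt_of_isOpen_of_le (a := t) (b := -1) (c := t) hU (by simp)
      (fun z hz => by have := (interior_subset hz).2.2; linarith) hz
    exact ⟨by linarith, by linarith, by linarith⟩
  · refine interior_maximal ?_ ?_
    · rintro z ⟨z1, z2, z3⟩
      exact ⟨by linarith, z2.le, z3.le⟩
    · have hc1 : Continuous fun z : ℂ => -z.im := by fun_prop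
      have hc2 : Continuous fun z : ℂ => t * z.re := by fun_prop
      have hc3 : Continuous fun z : ℂ => t * (1 - z.re) := by fun_prop
      exact (isOpen_lt Complex.continuous_im continuous_const).inter
        ((isOpen_lt hc1 hc2).inter (isOpen_lt hc1 hc3))

lemma isOpen_lowerTriangle (t : ℝ) : IsOpen (lowerTriangle t) := by
  have hc1 : Continuous fun z : ℂ => -z.im := by fun_prop
  have hc2 : Continuous fun z : ℂ => t * z.re := by fun_prop
  have hc3 : Continuous fun z : ℂ => t * (1 - z.re) := by fun_prop
  exact (isOpen_lt Complex.continuous_im continuous_const).inter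
    ((isOpen_lt hc1 hc2).inter (isOpen_lt hc1 hc3))

lemma isOpen_doubleTriangle (t : ℝ) : IsOpen (doubleTriangle t) := by
  have hc1 : Continuous fun z : ℂ => (1 - t ^ 2) * -z.im := by fun_prop
  have hc2 : Continuous fun z : ℂ => 2 * t * z.re := by fun_prop
  have hc3 : Continuous fun z : ℂ => 2 * t * (1 - z.re) := by fun_prop
  exact (isOpen_lt Complex.continuous_im continuous_const).inter
    ((isOpen_lt hc1 hc2).inter (isOpen_lt hc1 hc3))

lemma isOpen_upperTriangleInt (κ : ℝ) : IsOpen (upperTriangleInt κ) := by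
  have hc2 : Continuous fun z : ℂ => κ * z.re := by fun_prop
  have hc3 : Continuous fun z : ℂ => κ * (1 - z.re) := by fun_prop
  exact (isOpen_lt continuous_const Complex.continuous_im).inter
    ((isOpen_lt Complex.continuous_im hc2).inter (isOpen_lt Complex.continuous_im hc3))

lemma upperTriangleInt_subset (κ : ℝ) : upperTriangleInt κ ⊆ upperTriangle κ :=
  fun _ hz => ⟨hz.1.le, hz.2.1.le, hz.2.2.le⟩

namespace KochParam

variable {α η κ t : ℝ} (h : KochParam α η κ t)
include h

lemma bump_eq : bump α = {z | 0 ≤ z.im ∧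
    (1 - κ ^ 2) * z.im ≤ 2 * κ * (z.re - (1 + κ ^ 2) / 4) ∧
    (1 - κ ^ 2) * z.im ≤ 2 * κ * (1 - (1 + κ ^ 2) / 4 - z.re)} := by
  have hκ := h.κ_pos
  have hκ2 := h.κ_sq_lt
  have := convexHull_isosceles (p := (1 + κ ^ 2) / 4) (q := 1 - (1 + κ ^ 2) / 4) (h := κ / 2)
    (by linarith) (by positivity)
  have e1 : (1 / α : ℂ) = ((1 + κ ^ 2) / 4 : ℝ) := by rw [one_div, h.inv_α]
  have e2 : (1 - 1 / α : ℂ) = (1 - (1 + κ ^ 2) / 4 : ℝ) := by rw [e1]; push_cast; ring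
  have e3 : kochTip α = ⟨((1 + κ ^ 2) / 4 + (1 - (1 + κ ^ 2) / 4)) / 2, κ / 2⟩ := by
    rw [h.kochTip_eq]; apply Complex.ext <;> simp
  rw [bump, e2, e1, e3, pair_comm, this]
  ext z
  have e4 : z.im / (κ / 2) * ((1 - (1 + κ ^ 2) / 4 - (1 + κ ^ 2) / 4) / 2) =
      (1 - κ ^ 2) * z.im / (2 * κ) := by
    field_simp; ring
  have e5 : 0 ≤ z.im / (κ / 2) ↔ 0 ≤ z.im := by
    rw [le_div_iff₀ (by positivity), zero_mul]
  have h2κ : 0 < 2 * κ := by positivity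
  simp only [mem_ofPred_eq, e4, e5, div_le_iff₀ h2κ, mul_comm (2 * κ)]

end KochParam

/-! ### The open set condition for the Koch similitudes -/

lemma lowerTriangle_subset_doubleTriangle {t : ℝ} (ht : 0 < t) :
    lowerTriangle t ⊆ doubleTriangle t := by
  rintro z ⟨z1, z2, z3⟩
  have h1 : 0 < t ^ 2 * -z.im := by
    have : 0 < -z.im := by linarith
    positivity
  exact ⟨z1, by linarith, by linarith⟩

lemma fin_four_cases (i : Fin 4) : i = 0 ∨ i = 1 ∨ i = 2 ∨ i = 3 := by
  fin_cases i <;> simp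

namespace KochParam

variable {α η κ t : ℝ} (h : KochParam α η κ t)
include h

lemma kochMap_re_im (z : ℂ) :
    ((kochMap α 0 z).re = (1 + κ ^ 2) / 4 * z.re ∧ (kochMap α 0 z).im = (1 + κ ^ 2) / 4 * z.im) ∧
    ((kochMap α 1 z).re = ((1 - κ ^ 2) * z.re - 2 * κ * z.im) / 4 + (1 + κ ^ 2) / 4 ∧
      (kochMap α 1 z).im = (2 * κ * z.re + (1 - κ ^ 2) * z.im) / 4) ∧
    ((kochMap α 2 z).re = ((1 - κ ^ 2) * z.re + 2 * κ * z.im) / 4 + 1 / 2 ∧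
      (kochMap α 2 z).im = (-(2 * κ) * z.re + (1 - κ ^ 2) * z.im) / 4 + κ / 2) ∧
    ((kochMap α 3 z).re = (1 + κ ^ 2) / 4 * z.re + (3 - κ ^ 2) / 4 ∧
      (kochMap α 3 z).im = (1 + κ ^ 2) / 4 * z.im) := by
  simp only [h.kochMap_eq, Complex.add_re, Complex.add_im, Complex.mul_re, Complex.mul_im]
  simp only [kochLin, kochOff, Matrix.cons_val, Complex.zero_re, Complex.zero_im]
  refine ⟨⟨?_, ?_⟩, ⟨?_, ?_⟩, ⟨?_, ?_⟩, ?_, ?_⟩ <;> ring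

omit h in
lemma re_mem_of_invariantKite (hκ0 : 0 < κ) (hκ1 : κ < 1) {z : ℂ} (hz : z ∈ invariantKite κ) :
    0 ≤ z.re ∧ z.re ≤ 1 := by
  have hκ2 : κ ^ 2 < 1 := by nlinarith
  obtain ⟨⟨z1, z2⟩, ⟨z3, z4⟩, -⟩ := hz
  rcases le_total 0 z.im with hy | hy
  · constructor <;> by_contra! hc <;> nlinarith
  · have : 0 ≤ (1 - κ ^ 2) * -z.im := mul_nonneg (by linarith) (by linarith)
    constructor <;> by_contra! hc <;> nlinarith

lemma upperTriangle_subset_invariantKite : upperTriangle κ ⊆ invariantKite κ := by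
  rintro z ⟨z1, z2, z3⟩
  have hκ := h.κ_pos
  have hκ2 := h.κ_sq_lt
  have x0 : 0 ≤ z.re := by by_contra! hc; nlinarith
  have x1 : 0 ≤ 1 - z.re := by by_contra! hc; nlinarith
  have m1 : 0 ≤ (1 - κ ^ 2) * z.im := mul_nonneg (by linarith) z1
  have m2 : 0 ≤ κ * z.re := by positivity
  have m3 : 0 ≤ κ * (1 - z.re) := by positivity
  have m4 : -(4 * κ * (1 - κ ^ 2) * z.re) ≤ (4 * κ ^ 2 - (1 - κ ^ 2) ^ 2) * z.im := by
    have a1 := mul_le_mul_of_nonneg_left z2 (show 0 ≤ (1 - κ ^ 2) by linarith)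
    have a2 : 0 ≤ (1 - κ ^ 2) * (κ * z.re) := mul_nonneg (by linarith) m2
    have a3 : 0 ≤ κ ^ 2 * ((1 - κ ^ 2) * z.im) := by positivity
    nlinarith [mul_nonneg (sq_nonneg κ) z1]
  have m5 : -(4 * κ * (1 - κ ^ 2) * (1 - z.re)) ≤ (4 * κ ^ 2 - (1 - κ ^ 2) ^ 2) * z.im := by
    have a1 := mul_le_mul_of_nonneg_left z3 (show 0 ≤ (1 - κ ^ 2) by linarith)
    have a2 : 0 ≤ (1 - κ ^ 2) * (κ * (1 - z.re)) := mul_nonneg (by linarith) m3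
    have a3 : 0 ≤ κ ^ 2 * ((1 - κ ^ 2) * z.im) := by positivity
    nlinarith [mul_nonneg (sq_nonneg κ) z1]
  exact ⟨⟨z2, z3⟩, ⟨by linarith, by linarith⟩, by linarith, by linarith⟩

/-- The lower base angles of the kite are min(ϑ, π - 2ϑ), and both hypotheses on η are used: t ≤ κ
says 2η ≤ ϑ, and 2κt ≤ 1 - κ² says 2η ≤ π - 2ϑ. -/
lemma doubleTriangle_subset_invariantKite : doubleTriangle t ⊆ invariantKite κ := by
  rintro z ⟨z1, z2, z3⟩
  have hκ := h.κ_pos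
  have hκ2 := h.κ_sq_lt
  have ht := h.t_pos
  have htκ := h.t_le
  have htκ2 : t ^ 2 ≤ κ ^ 2 := by gcongr
  have hkt : 0 ≤ 1 - κ ^ 2 - 2 * κ * t := by linarith [h.κt_le]
  have key : ∀ X : ℝ, (1 - t ^ 2) * -z.im < 2 * t * X → 0 ≤ X ∧
      (1 - κ ^ 2) * -z.im ≤ 2 * κ * X ∧
      (4 * κ ^ 2 - (1 - κ ^ 2) ^ 2) * -z.im ≤ 4 * κ * (1 - κ ^ 2) * X := by
    intro X hX
    have hY : 0 < -z.im := by linarith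
    generalize -z.im = Y at *
    have hX0 : 0 ≤ X := by
      by_contra! hc
      have : 0 ≤ (1 - t ^ 2) * Y := mul_nonneg (by linarith) hY.le
      nlinarith
    refine ⟨hX0, ?_, ?_⟩
    · have a1 : (1 - κ ^ 2) * Y ≤ (1 - t ^ 2) * Y := by gcongr
      have a2 : t * X ≤ κ * X := by gcongr
      linarith
    -- The difference of the two sides factors as (1 - κ² - 2κt)(2κ + (1 - κ²)t).
    · have b1 : (4 * κ ^ 2 - (1 - κ ^ 2) ^ 2) * t ≤ 2 * κ * (1 - κ ^ 2) * (1 - t ^ 2) := by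
        have : 0 ≤ (1 - κ ^ 2 - 2 * κ * t) * (2 * κ + (1 - κ ^ 2) * t) := by
          have : 0 ≤ (1 - κ ^ 2) * t := mul_nonneg (by linarith) ht.le
          positivity
        nlinarith
      have b2 := mul_le_mul_of_nonneg_right b1 hY.le
      have b3 := mul_le_mul_of_nonneg_left hX.le
        (show 0 ≤ 2 * κ * (1 - κ ^ 2) from mul_nonneg (by positivity) (by linarith))
      have b4 : t * ((4 * κ ^ 2 - (1 - κ ^ 2) ^ 2) * Y) ≤ t * (4 * κ * (1 - κ ^ 2) * X) := by
        linarith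
      exact le_of_mul_le_mul_left b4 ht
  obtain ⟨x0, k1, k2⟩ := key _ z2
  obtain ⟨x1, k3, k4⟩ := key _ z3
  have m2 : 0 ≤ κ * z.re := by positivity
  have m3 : 0 ≤ κ * (1 - z.re) := by positivity
  exact ⟨⟨by linarith, by linarith⟩, ⟨k1, k3⟩, k2, k4⟩

/-- Two linear consequences of the inequalities which define the invariant kite. -/
lemma kite_bounds {x y : ℝ} (hx : y ≤ κ * x) (h2 : (1 - κ ^ 2) * -y ≤ 2 * κ * x)
    (h3 : (4 * κ ^ 2 - (1 - κ ^ 2) ^ 2) * -y ≤ 4 * κ * (1 - κ ^ 2) * x) :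
    0 ≤ κ * (3 - κ ^ 2) * x + (1 - 3 * κ ^ 2) * y ∧
    0 ≤ κ * (3 - κ ^ 2) * x - (1 - 3 * κ ^ 2) * y := by
  have hκ := h.κ_pos
  have hκ2 := h.κ_sq_lt
  rcases le_total 0 y with hy | hy
  · have a1 := mul_nonneg (show 0 ≤ 3 - κ ^ 2 by linarith) (sub_nonneg.2 hx)
    have a2 := mul_nonneg (show 0 ≤ 1 - κ ^ 2 by linarith) hy
    have a3 := mul_nonneg (sq_nonneg κ) hy
    constructor <;> linarith
  · have hY : 0 ≤ -y := by linarith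
    constructor
    · have hc : 2 * (1 - 3 * κ ^ 2) ≤ (3 - κ ^ 2) * (1 - κ ^ 2) := by
        nlinarith [sq_nonneg (κ ^ 2)]
      have a1 := mul_le_mul_of_nonneg_right hc hY
      have a2 := mul_le_mul_of_nonneg_left h2 (show 0 ≤ 3 - κ ^ 2 by linarith)
      linarith
    -- The difference of the two sides is exactly (1 + κ²)³.
    · have hc : 4 * (1 - κ ^ 2) * (3 * κ ^ 2 - 1) ≤
          (3 - κ ^ 2) * (4 * κ ^ 2 - (1 - κ ^ 2) ^ 2) := by
        have : 0 ≤ (1 + κ ^ 2) ^ 3 := by positivity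
        linarith
      have a1 := mul_le_mul_of_nonneg_right hc hY
      have a2 := mul_le_mul_of_nonneg_left h3 (show 0 ≤ 3 - κ ^ 2 by linarith)
      have a3 : 4 * (1 - κ ^ 2) * ((3 * κ ^ 2 - 1) * -y) ≤
          4 * (1 - κ ^ 2) * (κ * (3 - κ ^ 2) * x) := by linarith
      have a4 := le_of_mul_le_mul_left a3 (by linarith)
      linarith

/-- The middle maps turn the kite by ±ϑ. Its lower base angle is at most ϑ, so it stays above the
real axis; one bound of slope κ is an upper edge of the kite turned, and the other is `kite_bounds`.
-/
lemma kochMap_mapsTo_of_middle {z : ℂ} (hz : z ∈ invariantKite κ) :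
    kochMap α 1 z ∈ upperTriangle κ ∧ kochMap α 2 z ∈ upperTriangle κ := by
  obtain ⟨-, ⟨r1, i1⟩, ⟨r2, i2⟩, -⟩ := h.kochMap_re_im z
  have hκ := h.κ_pos
  have hκ2 := h.κ_sq_lt
  have hκ' : 0 ≤ 1 + κ ^ 2 := by positivity
  obtain ⟨⟨z1, z2⟩, ⟨z3, z4⟩, z5, z6⟩ := hz
  obtain ⟨-, a1⟩ := h.kite_bounds z1 z3 z5
  obtain ⟨-, b1⟩ := h.kite_bounds z2 z4 z6
  have c1 := mul_le_mul_of_nonneg_left z1 hκ'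
  have c2 := mul_le_mul_of_nonneg_left z2 hκ'
  simp only [upperTriangle, mem_ofPred_eq, r1, i1, r2, i2]
  refine ⟨⟨by linarith, by linarith, by linarith⟩, by linarith, by linarith, by linarith⟩

lemma kochMap_mapsTo_upperTriangle (i : Fin 4) :
    MapsTo (kochMap α i) (upperTriangle κ) (upperTriangle κ) := by
  intro z hz
  have hz' := h.upperTriangle_subset_invariantKite hz
  obtain ⟨⟨r0, i0⟩, -, -, r3, i3⟩ := h.kochMap_re_im z
  have hκ := h.κ_pos
  have hκ2 := h.κ_sq_lt
  have hκ' : 0 ≤ (1 + κ ^ 2) / 4 := by positivity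
  have hκ'' : 0 ≤ κ * (3 - κ ^ 2) := mul_nonneg hκ.le (by linarith)
  obtain ⟨z1, z2, z3⟩ := hz
  have c0 := mul_nonneg hκ' z1
  have c1 := mul_le_mul_of_nonneg_left z2 hκ'
  have c2 := mul_le_mul_of_nonneg_left z3 hκ'
  obtain rfl | rfl | rfl | rfl := fin_four_cases i
  · simp only [upperTriangle, mem_ofPred_eq, r0, i0]
    refine ⟨c0, by linarith, by nlinarith⟩
  · exact (h.kochMap_mapsTo_of_middle hz').1
  · exact (h.kochMap_mapsTo_of_middle hz').2
  · simp only [upperTriangle, mem_ofPred_eq, r3, i3]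
    refine ⟨c0, by nlinarith, by linarith⟩

/-- The outer maps contract towards 0 and 1, both points of this convex set, and the middle maps
even send the kite into the upper triangle. -/
lemma kochMap_mapsTo_invariantKite (i : Fin 4) :
    MapsTo (kochMap α i) (invariantKite κ) (invariantKite κ) := by
  intro z hz
  obtain ⟨⟨r0, i0⟩, -, -, r3, i3⟩ := h.kochMap_re_im z
  have hκ := h.κ_pos
  have hκ2 := h.κ_sq_lt
  have hκ' : 0 ≤ (1 + κ ^ 2) / 4 := by positivity
  have hκ3 : 0 ≤ (3 - κ ^ 2) / 4 := by linarith
  have hκ'' : 0 ≤ κ * ((3 - κ ^ 2) / 4) := by positivity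
  have hκ4 : 0 ≤ 4 * κ * (1 - κ ^ 2) * ((3 - κ ^ 2) / 4) :=
    mul_nonneg (mul_nonneg (by positivity) (by linarith)) hκ3
  have hz' := hz
  obtain ⟨⟨z1, z2⟩, ⟨z3, z4⟩, z5, z6⟩ := hz
  have c1 := mul_le_mul_of_nonneg_left z1 hκ'
  have c2 := mul_le_mul_of_nonneg_left z2 hκ'
  have c3 := mul_le_mul_of_nonneg_left z3 hκ'
  have c4 := mul_le_mul_of_nonneg_left z4 hκ'
  have c5 := mul_le_mul_of_nonneg_left z5 hκ'
  have c6 := mul_le_mul_of_nonneg_left z6 hκ'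
  obtain rfl | rfl | rfl | rfl := fin_four_cases i
  · simp only [invariantKite, mem_ofPred_eq, r0, i0]
    refine ⟨⟨by linarith, by linarith⟩, ⟨by linarith, by linarith⟩, by linarith, by linarith⟩
  · exact h.upperTriangle_subset_invariantKite (h.kochMap_mapsTo_of_middle hz').1
  · exact h.upperTriangle_subset_invariantKite (h.kochMap_mapsTo_of_middle hz').2
  · simp only [invariantKite, mem_ofPred_eq, r3, i3]
    refine ⟨⟨by linarith, by linarith⟩, ⟨by linarith, by linarith⟩, by linarith, by linarith⟩

/-- Distinct Koch similitudes map the invariant kite and the upper triangle to opposite sides of a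
line. -/
lemma exists_separating_line {i j : Fin 4} (hij : i ≠ j) : ∃ a b c : ℝ, (a ≠ 0 ∨ b ≠ 0) ∧
    (∀ z ∈ invariantKite κ, a * (kochMap α i z).re + b * (kochMap α i z).im ≤ c) ∧
    ∀ z ∈ upperTriangle κ, c ≤ a * (kochMap α j z).re + b * (kochMap α j z).im := by
  have hκ := h.κ_pos
  have hκ2 := h.κ_sq_lt
  have hκ' : 0 ≤ 1 + κ ^ 2 := by positivity
  have hκe : 0 < κ * (1 - κ ^ 2) := mul_pos hκ (by linarith)
  -- the two sides of each of the four lines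
  have Q0 : ∀ z ∈ invariantKite κ, (kochMap α 0 z).re * κ + (kochMap α 0 z).im ≤
      κ * ((1 + κ ^ 2) / 4) := by
    intro z hz
    obtain ⟨⟨r0, i0⟩, -⟩ := h.kochMap_re_im z
    rw [r0, i0]
    have := mul_le_mul_of_nonneg_left hz.1.2 hκ'
    linarith
  have Q3 : ∀ z ∈ invariantKite κ, κ * (1 - (kochMap α 3 z).re) + (kochMap α 3 z).im ≤
      κ * ((1 + κ ^ 2) / 4) := by
    intro z hz
    obtain ⟨-, -, -, r0, i0⟩ := h.kochMap_re_im z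
    rw [r0, i0]
    have := mul_le_mul_of_nonneg_left hz.1.1 hκ'
    linarith
  have Q1 : ∀ z ∈ invariantKite κ, (1 - κ ^ 2) * (kochMap α 1 z).im +
      2 * κ * (kochMap α 1 z).re ≤ 2 * κ * (1 - (1 + κ ^ 2) / 4) := by
    intro z hz
    obtain ⟨-, ⟨r0, i0⟩, -⟩ := h.kochMap_re_im z
    rw [r0, i0]
    have := hz.2.2.2
    linarith
  have Q2 : ∀ z ∈ invariantKite κ, (1 - κ ^ 2) * (kochMap α 2 z).im -
      2 * κ * (kochMap α 2 z).re ≤ -(2 * κ * ((1 + κ ^ 2) / 4)) := by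
    intro z hz
    obtain ⟨-, -, ⟨r0, i0⟩, -⟩ := h.kochMap_re_im z
    rw [r0, i0]
    have := hz.2.2.1
    linarith
  have facts : ∀ z ∈ upperTriangle κ, 0 ≤ z.re ∧ 0 ≤ 1 - z.re ∧ 0 ≤ κ * z.re ∧
      0 ≤ κ * (1 - z.re) ∧ 0 ≤ (1 + κ ^ 2) * z.im ∧ 0 ≤ κ * (1 - κ ^ 2) * z.re ∧
      0 ≤ κ * (1 - κ ^ 2) * (1 - z.re) ∧ 0 ≤ (1 + κ ^ 2) ^ 2 * z.im ∧
      0 ≤ κ * ((1 + κ ^ 2) * z.re) ∧ 0 ≤ κ * ((1 + κ ^ 2) * (1 - z.re)) ∧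
      0 ≤ (1 - κ ^ 2) * ((1 + κ ^ 2) * z.im) := by
    intro z hz
    obtain ⟨x0, x1⟩ := re_mem_of_invariantKite hκ h.κ_lt (h.upperTriangle_subset_invariantKite hz)
    have hy := hz.1
    have x1' : 0 ≤ 1 - z.re := by linarith
    have he : 0 ≤ 1 - κ ^ 2 := by linarith
    refine ⟨x0, x1', ?_, ?_, ?_, ?_, ?_, ?_, ?_, ?_, ?_⟩ <;> positivity
  -- Most of the twelve ordered pairs use the edge line of the kite of cell i given by `Q0` to `Q3`.
  -- The pairs (1,0) and (2,3) use the lines of `Q0` and `Q3` from the other side, and the pairs of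
  -- outer cells use vertical lines.
  obtain rfl | rfl | rfl | rfl := fin_four_cases i <;>
    obtain rfl | rfl | rfl | rfl := fin_four_cases j <;> first | exact absurd rfl hij | skip
  · refine ⟨κ, 1, κ * ((1 + κ ^ 2) / 4), by simp, fun z hz => by linarith [Q0 z hz],
      fun z hz => ?_⟩
    obtain ⟨-, ⟨r, i⟩, -⟩ := h.kochMap_re_im z
    have hz' := h.upperTriangle_subset_invariantKite hz
    have := (h.kite_bounds hz'.1.1 hz'.2.1.1 hz'.2.2.1).1
    simp only [r, i]
    linarith
  · refine ⟨κ, 1, κ * ((1 + κ ^ 2) / 4), by simp, fun z hz => by linarith [Q0 z hz],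
      fun z hz => ?_⟩
    obtain ⟨-, -, ⟨r, i⟩, -⟩ := h.kochMap_re_im z
    obtain ⟨f1, f2, f3, f4, f5, f6, f7, f8, f9, f10, f11⟩ := facts z hz
    simp only [r, i]
    linarith
  · refine ⟨1, 0, (1 + κ ^ 2) / 4, by simp, fun z hz => ?_, fun z hz => ?_⟩
    · obtain ⟨⟨r, i⟩, -⟩ := h.kochMap_re_im z
      obtain ⟨x0, x1⟩ := re_mem_of_invariantKite hκ h.κ_lt hz
      have := mul_le_mul_of_nonneg_left x1 hκ'
      simp only [r, i]
      linarith
    · obtain ⟨-, -, -, r, i⟩ := h.kochMap_re_im z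
      obtain ⟨f1, -⟩ := facts z hz
      have := mul_nonneg hκ' f1
      simp only [r, i]
      linarith
  · refine ⟨-κ, -1, -(κ * ((1 + κ ^ 2) / 4)), by simp, fun z hz => ?_, fun z hz => ?_⟩
    · obtain ⟨-, ⟨r, i⟩, -⟩ := h.kochMap_re_im z
      have := (h.kite_bounds hz.1.1 hz.2.1.1 hz.2.2.1).1
      simp only [r, i]
      linarith
    ·      linarith [Q0 z (h.upperTriangle_subset_invariantKite hz)]
  · refine ⟨2 * κ, 1 - κ ^ 2, 2 * κ * (1 - (1 + κ ^ 2) / 4), by simp [hκ.ne'],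
      fun z hz => by linarith [Q1 z hz], fun z hz => ?_⟩
    obtain ⟨-, -, ⟨r, i⟩, -⟩ := h.kochMap_re_im z
    obtain ⟨f1, f2, f3, f4, f5, f6, f7, f8, f9, f10, f11⟩ := facts z hz
    simp only [r, i]
    linarith
  · refine ⟨2 * κ, 1 - κ ^ 2, 2 * κ * (1 - (1 + κ ^ 2) / 4), by simp [hκ.ne'],
      fun z hz => by linarith [Q1 z hz], fun z hz => ?_⟩
    obtain ⟨-, -, -, r, i⟩ := h.kochMap_re_im z
    obtain ⟨f1, f2, f3, f4, f5, f6, f7, f8, f9, f10, f11⟩ := facts z hz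
    simp only [r, i]
    linarith
  · refine ⟨-(2 * κ), 1 - κ ^ 2, -(2 * κ * ((1 + κ ^ 2) / 4)), by simp [hκ.ne'],
      fun z hz => by linarith [Q2 z hz], fun z hz => ?_⟩
    obtain ⟨⟨r, i⟩, -⟩ := h.kochMap_re_im z
    obtain ⟨f1, f2, f3, f4, f5, f6, f7, f8, f9, f10, f11⟩ := facts z hz
    simp only [r, i]
    linarith
  · refine ⟨-(2 * κ), 1 - κ ^ 2, -(2 * κ * ((1 + κ ^ 2) / 4)), by simp [hκ.ne'],
      fun z hz => by linarith [Q2 z hz], fun z hz => ?_⟩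
    obtain ⟨-, ⟨r, i⟩, -⟩ := h.kochMap_re_im z
    obtain ⟨f1, f2, f3, f4, f5, f6, f7, f8, f9, f10, f11⟩ := facts z hz
    simp only [r, i]
    linarith
  · refine ⟨κ, -1, κ - κ * ((1 + κ ^ 2) / 4), by simp, fun z hz => ?_, fun z hz => ?_⟩
    · obtain ⟨-, -, ⟨r, i⟩, -⟩ := h.kochMap_re_im z
      have := (h.kite_bounds hz.1.2 hz.2.1.2 hz.2.2.2).1
      simp only [r, i]
      linarith
    ·      linarith [Q3 z (h.upperTriangle_subset_invariantKite hz)]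
  · refine ⟨-1, 0, -((3 - κ ^ 2) / 4), by simp, fun z hz => ?_, fun z hz => ?_⟩
    · obtain ⟨-, -, -, r, i⟩ := h.kochMap_re_im z
      obtain ⟨x0, x1⟩ := re_mem_of_invariantKite hκ h.κ_lt hz
      have := mul_nonneg hκ' x0
      simp only [r, i]
      linarith
    · obtain ⟨⟨r, i⟩, -⟩ := h.kochMap_re_im z
      obtain ⟨f1, f2, -⟩ := facts z hz
      have := mul_nonneg hκ' f2
      simp only [r, i]
      linarith
  · refine ⟨-κ, 1, κ * ((1 + κ ^ 2) / 4) - κ, by simp, fun z hz => ?_, fun z hz => ?_⟩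
    ·      linarith [Q3 z hz]
    · obtain ⟨-, ⟨r, i⟩, -⟩ := h.kochMap_re_im z
      obtain ⟨f1, f2, f3, f4, f5, f6, f7, f8, f9, f10, f11⟩ := facts z hz
      simp only [r, i]
      linarith
  · refine ⟨-κ, 1, κ * ((1 + κ ^ 2) / 4) - κ, by simp, fun z hz => ?_, fun z hz => ?_⟩
    ·      linarith [Q3 z hz]
    · obtain ⟨-, -, ⟨r, i⟩, -⟩ := h.kochMap_re_im z
      have hz' := h.upperTriangle_subset_invariantKite hz
      have := (h.kite_bounds hz'.1.2 hz'.2.1.2 hz'.2.2.2).1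
      simp only [r, i]
      linarith

lemma bump_subset_upperTriangle : bump α ⊆ upperTriangle κ := by
  rw [h.bump_eq]
  rintro z ⟨z1, z2, z3⟩
  have hκ := h.κ_pos
  have hκ2 := h.κ_sq_lt
  have he : 0 < 1 - κ ^ 2 := by linarith
  refine ⟨z1, ?_, ?_⟩
  · by_contra! hc
    nlinarith [mul_nonneg hκ.le z1, mul_pos he hκ]
  · by_contra! hc
    nlinarith [mul_nonneg hκ.le z1, mul_pos he hκ]

/-- The left edge of the bump separates it from the upper triangles of cells 0 and 1, the right edge
from those of cells 2 and 3. -/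
lemma exists_separating_line_bump (i : Fin 4) : ∃ a b c : ℝ, (a ≠ 0 ∨ b ≠ 0) ∧
    (∀ z ∈ upperTriangle κ, a * (kochMap α i z).re + b * (kochMap α i z).im ≤ c) ∧
    ∀ z ∈ bump α, c ≤ a * z.re + b * z.im := by
  have hκ := h.κ_pos
  have hκ2 := h.κ_sq_lt
  have hκ' : 0 ≤ 1 + κ ^ 2 := by positivity
  have he : 0 ≤ 1 - κ ^ 2 := by linarith
  have facts : ∀ z ∈ upperTriangle κ, 0 ≤ z.re ∧ 0 ≤ 1 - z.re ∧ 0 ≤ κ * ((1 + κ ^ 2) * z.re) ∧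
      0 ≤ κ * ((1 + κ ^ 2) * (1 - z.re)) ∧ 0 ≤ (1 - κ ^ 2) * ((1 + κ ^ 2) * z.im) ∧
      0 ≤ (1 + κ ^ 2) ^ 2 * z.im := by
    intro z hz
    obtain ⟨x0, x1⟩ := re_mem_of_invariantKite hκ h.κ_lt (h.upperTriangle_subset_invariantKite hz)
    have hy := hz.1
    have x1' : 0 ≤ 1 - z.re := by linarith
    refine ⟨x0, x1', ?_, ?_, ?_, ?_⟩ <;> positivity
  have B1 : ∀ z ∈ bump α, 2 * κ * ((1 + κ ^ 2) / 4) ≤ 2 * κ * z.re + -(1 - κ ^ 2) * z.im := by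
    rw [h.bump_eq]
    rintro z ⟨-, z2, -⟩
    linarith
  have B2 : ∀ z ∈ bump α, 2 * κ * ((1 + κ ^ 2) / 4) - 2 * κ ≤
      -(2 * κ) * z.re + -(1 - κ ^ 2) * z.im := by
    rw [h.bump_eq]
    rintro z ⟨-, -, z2⟩
    linarith
  obtain rfl | rfl | rfl | rfl := fin_four_cases i
  · refine ⟨_, _, _, by simp [hκ.ne'], fun z hz => ?_, B1⟩
    obtain ⟨⟨r, i⟩, -⟩ := h.kochMap_re_im z
    obtain ⟨f1, f2, f3, f4, f5, f6⟩ := facts z hz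
    simp only [r, i]
    linarith
  · refine ⟨_, _, _, by simp [hκ.ne'], fun z hz => ?_, B1⟩
    obtain ⟨-, ⟨r, i⟩, -⟩ := h.kochMap_re_im z
    obtain ⟨f1, f2, f3, f4, f5, f6⟩ := facts z hz
    simp only [r, i]
    linarith
  · refine ⟨_, _, _, by simp [hκ.ne'], fun z hz => ?_, B2⟩
    obtain ⟨-, -, ⟨r, i⟩, -⟩ := h.kochMap_re_im z
    obtain ⟨f1, f2, f3, f4, f5, f6⟩ := facts z hz
    simp only [r, i]
    linarith
  · refine ⟨_, _, _, by simp [hκ.ne'], fun z hz => ?_, B2⟩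
    obtain ⟨-, -, -, r, i⟩ := h.kochMap_re_im z
    obtain ⟨f1, f2, f3, f4, f5, f6⟩ := facts z hz
    simp only [r, i]
    linarith

/-- The outer maps shrink the triangle towards a base vertex, and the middle maps place it inside
the newly added triangle. This is the induction step for `cellMap_lowerTriangle_mem`. -/
lemma kochMap_mapsTo_lowerTriangle (i : Fin 4) {z : ℂ} (hz : z ∈ lowerTriangle t) :
    kochMap α i z ∈ lowerTriangle t ∪ bump α := by
  have hκ := h.κ_pos
  have hκ2 := h.κ_sq_lt
  have ht := h.t_pos
  have hκ' : 0 < (1 + κ ^ 2) / 4 := by positivity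
  have hκ3 : 0 ≤ t * ((3 - κ ^ 2) / 4) := mul_nonneg ht.le (by linarith)
  have hQ := h.doubleTriangle_subset_invariantKite (lowerTriangle_subset_doubleTriangle ht hz)
  obtain ⟨⟨r0, i0⟩, ⟨r1, i1⟩, ⟨r2, i2⟩, r3, i3⟩ := h.kochMap_re_im z
  obtain ⟨z1, z2, z3⟩ := hz
  have c1 := mul_lt_mul_of_pos_left z1 hκ'
  have c2 := mul_lt_mul_of_pos_left z2 hκ'
  have c3 := mul_lt_mul_of_pos_left z3 hκ'
  have c4 : (1 - κ ^ 2) * ((1 - κ ^ 2) * z.im) + 4 * κ ^ 2 * z.im ≤ 0 := by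
    nlinarith [mul_pos hκ hκ, sq_nonneg (1 - κ ^ 2)]
  obtain ⟨-, ⟨q1, q2⟩, q3, q4⟩ := hQ
  rw [h.bump_eq]
  obtain rfl | rfl | rfl | rfl := fin_four_cases i
  · left
    simp only [lowerTriangle, mem_ofPred_eq, r0, i0]
    exact ⟨by linarith, by linarith, by linarith⟩
  · right
    simp only [mem_ofPred_eq, r1, i1]
    exact ⟨by linarith, by linarith, by linarith⟩
  · right
    simp only [mem_ofPred_eq, r2, i2]
    exact ⟨by linarith, by linarith, by linarith⟩
  · left
    simp only [lowerTriangle, mem_ofPred_eq, r3, i3]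
    exact ⟨by linarith, by linarith, by linarith⟩

end KochParam

/-! ### The regular polygon -/

lemma cos_le_cos_of_mem {φ x : ℝ} (hφ : 0 ≤ φ) (h1 : φ ≤ x) (h2 : x ≤ 2 * Real.pi - φ) :
    Real.cos x ≤ Real.cos φ := by
  rcases le_total x Real.pi with hx | hx
  · exact Real.cos_le_cos_of_nonneg_of_le_pi hφ hx h1
  · rw [← Real.cos_two_pi_sub x]
    exact Real.cos_le_cos_of_nonneg_of_le_pi hφ (by linarith) (by linarith)

/-- The inradius of the regular `m`-gon with side length one. -/
noncomputable def inradius (m : ℕ) : ℝ := Real.cos (Real.pi / m) / (2 * Real.sin (Real.pi / m))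

section Polygon

variable {m : ℕ} (hm : 3 ≤ m)
include hm

lemma polygon_angle_bounds : 0 < Real.pi / m ∧ Real.pi / m ≤ Real.pi / 3 ∧
    0 < Real.sin (Real.pi / m) ∧ 0 < Real.cos (Real.pi / m) ∧ m * (Real.pi / m) = Real.pi := by
  have hm' : (3 : ℝ) ≤ m := by exact_mod_cast hm
  have hpi := Real.pi_pos
  have h1 : 0 < Real.pi / m := by positivity
  have h2 : Real.pi / m ≤ Real.pi / 3 := by gcongr
  refine ⟨h1, h2, Real.sin_pos_of_pos_of_lt_pi h1 (by linarith),
    Real.cos_pos_of_mem_Ioo ⟨by linarith, by linarith⟩, ?_⟩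
  field_simp

lemma inradius_pos : 0 < inradius m := by
  obtain ⟨-, -, hs, hc, -⟩ := polygon_angle_bounds hm
  unfold inradius
  positivity

lemma two_mul_sin_mul_inradius :
    2 * Real.sin (Real.pi / m) * inradius m = Real.cos (Real.pi / m) := by
  obtain ⟨-, -, hs, hc, -⟩ := polygon_angle_bounds hm
  unfold inradius
  field_simp

omit hm in
lemma sideMap_re_im (m : ℕ) (z : ℂ) :
    (sideMap m z).re = 1 + (Real.cos (2 * (Real.pi / m)) * z.re +
      Real.sin (2 * (Real.pi / m)) * z.im) ∧
    (sideMap m z).im = Real.cos (2 * (Real.pi / m)) * z.im -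
      Real.sin (2 * (Real.pi / m)) * z.re := by
  have e : Complex.exp (-(2 * Real.pi / m * Complex.I)) =
      ⟨Real.cos (2 * (Real.pi / m)), -Real.sin (2 * (Real.pi / m))⟩ := by
    have e1 : (-(2 * Real.pi / m * Complex.I) : ℂ) =
        ((-(2 * (Real.pi / m)) : ℝ) : ℂ) * Complex.I := by push_cast; ring
    rw [e1]
    apply Complex.ext
    · rw [Complex.exp_ofReal_mul_I_re, Real.cos_neg]
    · rw [Complex.exp_ofReal_mul_I_im, Real.sin_neg]
  constructor
  · simp [sideMap, e]
  · simp [sideMap, e]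
    ring

/-- The map is the rotation by -2π/m about the centre 1/2 - i · `inradius m` of the polygon. -/
lemma sideMap_iterate_re_im (k : ℕ) (z : ℂ) :
    ((sideMap m)^[k] z).re - 1 / 2 = (z.re - 1 / 2) * Real.cos (k * (2 * (Real.pi / m))) +
      (z.im + inradius m) * Real.sin (k * (2 * (Real.pi / m))) ∧
    ((sideMap m)^[k] z).im + inradius m =
      (z.im + inradius m) * Real.cos (k * (2 * (Real.pi / m))) -
      (z.re - 1 / 2) * Real.sin (k * (2 * (Real.pi / m))) := by
  obtain ⟨-, -, hs, hc, -⟩ := polygon_angle_bounds hm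
  have hH := two_mul_sin_mul_inradius hm
  induction k with
  | zero => simp
  | succ k ih =>
    rw [Function.iterate_succ_apply']
    obtain ⟨r, i⟩ := sideMap_re_im m ((sideMap m)^[k] z)
    obtain ⟨ih1, ih2⟩ := ih
    have e : ((k + 1 : ℕ) : ℝ) * (2 * (Real.pi / m)) =
        k * (2 * (Real.pi / m)) + 2 * (Real.pi / m) := by push_cast; ring
    rw [e, Real.cos_add, Real.sin_add, r, i]
    have r' := eq_add_of_sub_eq ih1
    have i' := eq_sub_of_add_eq ih2
    rw [r', i']
    have c2 : Real.cos (2 * (Real.pi / m)) = 1 - 2 * Real.sin (Real.pi / m) ^ 2 := by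
      rw [Real.cos_two_mul, Real.cos_sq']; ring
    have s2 := Real.sin_two_mul (Real.pi / m)
    -- `k1` and `k2` say that the real and imaginary parts of the centre are fixed.
    have k1 : Real.sin (2 * (Real.pi / m)) * inradius m = (1 + Real.cos (2 * (Real.pi / m))) / 2 := by
      rw [s2, Real.cos_two_mul]
      linear_combination (Real.cos (Real.pi / m)) * hH
    have k2 : (1 - Real.cos (2 * (Real.pi / m))) * inradius m = Real.sin (2 * (Real.pi / m)) / 2 := by
      rw [s2, c2]
      linear_combination (Real.sin (Real.pi / m)) * hH
    constructor
    · linear_combination (-1 : ℝ) * k1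
    · linear_combination k2

lemma sideMap_iterate_self (z : ℂ) : (sideMap m)^[m] z = z := by
  obtain ⟨h1, h2⟩ := sideMap_iterate_re_im hm m z
  obtain ⟨-, -, -, -, hp⟩ := polygon_angle_bounds hm
  have e : (m : ℝ) * (2 * (Real.pi / m)) = 2 * Real.pi := by linear_combination 2 * hp
  rw [e, Real.cos_two_pi, Real.sin_two_pi] at h1 h2
  apply Complex.ext <;> linarith

omit hm in
lemma sideMap_eq (m : ℕ) : ∃ ζ : ℂ, ‖ζ‖ = 1 ∧ ∀ z, sideMap m z = ζ * z + 1 := by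
  refine ⟨Complex.exp (-(2 * Real.pi / m * Complex.I)), ?_, fun z => by rw [sideMap, add_comm]⟩
  have e1 : (-(2 * Real.pi / m * Complex.I) : ℂ) =
      ((-(2 * (Real.pi / m)) : ℝ) : ℂ) * Complex.I := by push_cast; ring
  rw [e1, Complex.norm_exp_ofReal_mul_I]

omit hm in
lemma sideMap_injective (m : ℕ) : Function.Injective (sideMap m) := by
  obtain ⟨ζ, hζ, h⟩ := sideMap_eq m
  intro x y hxy
  rw [h, h] at hxy
  have : ζ ≠ 0 := by rintro rfl; simp at hζ
  simpa [this] using hxy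

/-- Trigonometric form of the fact that the polygon lies below each of its sides. -/
lemma abs_sin_mul_le {k : ℕ} (hk0 : 0 < k) (hk : k < m) :
    |Real.sin (k * (2 * (Real.pi / m)))| ≤
      (1 - Real.cos (k * (2 * (Real.pi / m)))) * (2 * inradius m) := by
  obtain ⟨h0, h1, hs, hc, hp⟩ := polygon_angle_bounds hm
  have hk0' : (1 : ℝ) ≤ k := by exact_mod_cast hk0
  have hk' : (k : ℝ) + 1 ≤ m := by exact_mod_cast hk
  set φ := Real.pi / m with hφ
  have hb : (k : ℝ) * φ + φ ≤ Real.pi := by rw [← hp]; nlinarith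
  have hb' : φ ≤ (k : ℝ) * φ := by nlinarith
  have c1 := cos_le_cos_of_mem h0.le (x := k * (2 * φ) - φ) (by linarith) (by linarith)
  have c2 := cos_le_cos_of_mem h0.le (x := k * (2 * φ) + φ) (by linarith) (by linarith)
  rw [Real.cos_sub] at c1
  rw [Real.cos_add] at c2
  have hH : 2 * Real.sin φ * inradius m = Real.cos φ := two_mul_sin_mul_inradius hm
  have e : (1 - Real.cos (k * (2 * φ))) * (2 * inradius m) * Real.sin φ =
      (1 - Real.cos (k * (2 * φ))) * Real.cos φ := by
    rw [← hH]; ring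
  refine le_of_mul_le_mul_right ?_ hs
  rw [e]
  rcases abs_cases (Real.sin (k * (2 * φ))) with ⟨h, -⟩ | ⟨h, -⟩ <;> rw [h] <;> linarith

lemma cos_lt_one_of_lt {k : ℕ} (hk0 : 0 < k) (hk : k < m) :
    Real.cos (k * (2 * (Real.pi / m))) < 1 := by
  obtain ⟨h0, h1, hs, hc, hp⟩ := polygon_angle_bounds hm
  refine lt_of_le_of_ne (Real.cos_le_one _) fun h => ?_
  have := (Real.cos_eq_one_iff_of_lt_of_lt (x := k * (2 * (Real.pi / m))) ?_ ?_).1 h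
  · have hk0' : (0 : ℝ) < k := by exact_mod_cast hk0
    have : 0 < (k : ℝ) * (2 * (Real.pi / m)) := by positivity
    linarith
  · have := Real.pi_pos
    have : 0 ≤ (k : ℝ) * (2 * (Real.pi / m)) := by positivity
    linarith
  · have hk' : (k : ℝ) < m := by exact_mod_cast hk
    nlinarith

/-- Points of the closed sector over `[0, 1]` are at least as high over the side `[0, 1]` as over
any other side. -/
lemma im_sideMap_iterate_le {z : ℂ} {k : ℕ} (hk0 : 0 < k) (hk : k < m)
    (hz : |z.re - 1 / 2| * (2 * inradius m) ≤ z.im + inradius m) :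
    ((sideMap m)^[k] z).im ≤ z.im := by
  have hH := inradius_pos hm
  have h1 := (sideMap_iterate_re_im hm k z).2
  have h2 := abs_sin_mul_le hm hk0 hk
  have h3 : -((z.re - 1 / 2) * Real.sin (k * (2 * (Real.pi / m)))) ≤
      |z.re - 1 / 2| * |Real.sin (k * (2 * (Real.pi / m)))| := by
    rw [← abs_mul]; exact neg_le_abs _
  have h4 := mul_le_mul_of_nonneg_left h2 (abs_nonneg (z.re - 1 / 2))
  have h5 := cos_lt_one_of_lt hm hk0 hk
  have h6 := mul_le_mul_of_nonneg_left hz (sub_nonneg.2 h5.le)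
  linarith

lemma im_sideMap_iterate_lt {z : ℂ} {k : ℕ} (hk0 : 0 < k) (hk : k < m)
    (hz : |z.re - 1 / 2| * (2 * inradius m) < z.im + inradius m) :
    ((sideMap m)^[k] z).im < z.im := by
  have hH := inradius_pos hm
  have h1 := (sideMap_iterate_re_im hm k z).2
  have h2 := abs_sin_mul_le hm hk0 hk
  have h3 : -((z.re - 1 / 2) * Real.sin (k * (2 * (Real.pi / m)))) ≤
      |z.re - 1 / 2| * |Real.sin (k * (2 * (Real.pi / m)))| := by
    rw [← abs_mul]; exact neg_le_abs _
  have h4 := mul_le_mul_of_nonneg_left h2 (abs_nonneg (z.re - 1 / 2))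
  have h5 := cos_lt_one_of_lt hm hk0 hk
  have h6 := mul_lt_mul_of_pos_left hz (sub_pos.2 h5)
  linarith

/-- Among the rotated copies of z, one of greatest height is no lower than its two neighbours. These
two comparisons are the inequalities of the sector. -/
lemma exists_sideMap_iterate_mem_sector (z : ℂ) : ∃ k < m,
    |((sideMap m)^[k] z).re - 1 / 2| * (2 * inradius m) ≤ ((sideMap m)^[k] z).im + inradius m := by
  obtain ⟨h0, h1, hs, hc, hp⟩ := polygon_angle_bounds hm
  have hne : (Finset.range m).Nonempty := ⟨0, Finset.mem_range.2 (by omega)⟩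
  obtain ⟨k, hk, hmax⟩ := Finset.exists_max_image (Finset.range m)
    (fun k => ((sideMap m)^[k] z).im) hne
  have hmax' : ∀ j, ((sideMap m)^[j] z).im ≤ ((sideMap m)^[k] z).im := by
    intro j
    have e : (sideMap m)^[j % m] z = (sideMap m)^[j] z :=
      Function.IsPeriodicPt.iterate_mod_apply (sideMap_iterate_self hm z) j
    rw [← e]
    exact hmax _ (Finset.mem_range.2 (Nat.mod_lt _ (by omega)))
  refine ⟨k, Finset.mem_range.1 hk, ?_⟩
  set y := (sideMap m)^[k] z with hy
  have a1 : ((sideMap m)^[1] y).im ≤ y.im := by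
    rw [hy, ← Function.iterate_add_apply]; exact hmax' _
  have a2 : ((sideMap m)^[m - 1] y).im ≤ y.im := by
    rw [hy, ← Function.iterate_add_apply]; exact hmax' _
  have b1 := (sideMap_iterate_re_im hm 1 y).2
  have b2 := (sideMap_iterate_re_im hm (m - 1) y).2
  have e1 : ((1 : ℕ) : ℝ) * (2 * (Real.pi / m)) = 2 * (Real.pi / m) := by simp
  have e2 : ((m - 1 : ℕ) : ℝ) * (2 * (Real.pi / m)) = 2 * Real.pi - 2 * (Real.pi / m) := by
    rw [Nat.cast_sub (by omega)]
    push_cast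
    linear_combination 2 * hp
  rw [e1] at b1
  rw [e2, Real.cos_two_pi_sub, Real.sin_two_pi_sub] at b2
  have hH := two_mul_sin_mul_inradius hm
  have hs2 := Real.sin_two_mul (Real.pi / m)
  have hc2 : Real.cos (2 * (Real.pi / m)) = 1 - 2 * Real.sin (Real.pi / m) ^ 2 := by
    rw [Real.cos_two_mul, Real.cos_sq']; ring
  have key : |y.re - 1 / 2| * Real.sin (2 * (Real.pi / m)) ≤
      (y.im + inradius m) * (1 - Real.cos (2 * (Real.pi / m))) := by
    rcases abs_cases (y.re - 1 / 2) with ⟨h, -⟩ | ⟨h, -⟩ <;> rw [h] <;> linarith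
  rw [hs2, hc2, ← hH] at key
  have h2 : 0 < 2 * Real.sin (Real.pi / m) ^ 2 := by positivity
  refine le_of_mul_le_mul_right ?_ h2
  linarith

lemma closedPolygon_vertex_mem (j : ℕ) : (sideMap m)^[j] 0 ∈ closedPolygon m := by
  refine subset_convexHull ℝ _ ?_
  have e : (sideMap m)^[j % m] (0 : ℂ) = (sideMap m)^[j] 0 :=
    Function.IsPeriodicPt.iterate_mod_apply (sideMap_iterate_self hm 0) j
  rw [← e]
  exact mem_iUnion.2 ⟨⟨j % m, Nat.mod_lt _ (by omega)⟩, 0, rfl, rfl⟩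

lemma sideMap_mem_closedPolygon {z : ℂ} (hz : z ∈ closedPolygon m) :
    sideMap m z ∈ closedPolygon m := by
  obtain ⟨ζ, hζ, h⟩ := sideMap_eq m
  have hc : Convex ℝ (sideMap m ⁻¹' closedPolygon m) := by
    intro x hx y hy a b ha hb hab
    have e : sideMap m (a • x + b • y) = a • sideMap m x + b • sideMap m y := by
      simp only [h, Complex.real_smul]
      have : (a : ℂ) + b = 1 := by exact_mod_cast hab
      linear_combination -this
    rw [mem_preimage, e]
    exact convex_convexHull ℝ _ hx hy ha hb hab
  refine convexHull_min ?_ hc hz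
  intro x hx
  obtain ⟨j, y, hy, rfl⟩ := mem_iUnion.1 hx
  rw [mem_singleton_iff] at hy
  subst hy
  rw [mem_preimage, ← Function.iterate_succ_apply' (sideMap m)]
  exact closedPolygon_vertex_mem hm _

lemma sideMap_iterate_mem_closedPolygon (k : ℕ) {z : ℂ} (hz : z ∈ closedPolygon m) :
    (sideMap m)^[k] z ∈ closedPolygon m := by
  induction k with
  | zero => exact hz
  | succ k ih =>
    rw [Function.iterate_succ_apply']
    exact sideMap_mem_closedPolygon hm ih

lemma im_nonpos_of_mem_closedPolygon {z : ℂ} (hz : z ∈ closedPolygon m) : z.im ≤ 0 := by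
  have hc : Convex ℝ {z : ℂ | z.im ≤ 0} := convex_halfSpace_im_le 0
  refine convexHull_min ?_ hc hz
  intro x hx
  obtain ⟨j, y, hy, rfl⟩ := mem_iUnion.1 hx
  rw [mem_singleton_iff] at hy
  subst hy
  rcases Nat.eq_zero_or_pos j.1 with h | h
  · rw [h]; simp
  · refine (im_sideMap_iterate_le hm h j.2 ?_).trans (by simp)
    norm_num
    linarith

/-- The mean of the vertices is fixed by the rotation, whose only fixed point is the centre. -/
lemma polygonCenter_mem : (⟨1 / 2, -inradius m⟩ : ℂ) ∈ closedPolygon m := by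
  obtain ⟨h0, h1, hs, hc, hp⟩ := polygon_angle_bounds hm
  have hm0 : (0 : ℝ) < m := by exact_mod_cast (by omega : 0 < m)
  have key := (convex_convexHull ℝ (onSides m {0})).sum_mem (t := Finset.range m)
    (w := fun _ => (m : ℝ)⁻¹) (z := fun j => (sideMap m)^[j] 0) (fun _ _ => by positivity)
    (by simp [hm0.ne']) (fun j _ => closedPolygon_vertex_mem hm j)
  set S := ∑ j ∈ Finset.range m, (sideMap m)^[j] (0 : ℂ) with hS
  have hshift : ∑ j ∈ Finset.range m, sideMap m ((sideMap m)^[j] 0) = S := by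
    have e1 : ∑ j ∈ Finset.range m, sideMap m ((sideMap m)^[j] (0 : ℂ)) =
        ∑ j ∈ Finset.range m, (sideMap m)^[j + 1] (0 : ℂ) :=
      Finset.sum_congr rfl fun j _ => (Function.iterate_succ_apply' _ _ _).symm
    have e2 := Finset.sum_range_succ' (fun j => (sideMap m)^[j] (0 : ℂ)) m
    have e3 := Finset.sum_range_succ (fun j => (sideMap m)^[j] (0 : ℂ)) m
    rw [e1, hS]
    rw [e2, sideMap_iterate_self hm] at e3
    simpa using e3
  obtain ⟨ζ, hζ, h⟩ := sideMap_eq m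
  have hS2 : ζ * S + m = S := by
    have : ∑ j ∈ Finset.range m, sideMap m ((sideMap m)^[j] (0 : ℂ)) = ζ * S + m := by
      simp only [h, Finset.sum_add_distrib, ← Finset.mul_sum]
      simp [hS]
    rw [← this, hshift]
  have hfix : ∀ w : ℂ, sideMap m w = w → w = ⟨1 / 2, -inradius m⟩ := by
    intro w hw
    obtain ⟨i1, i2⟩ := sideMap_iterate_re_im hm 1 w
    have hc1 := cos_lt_one_of_lt hm one_pos (by omega)
    simp only [Function.iterate_one, hw, Nat.cast_one, one_mul] at i1 i2 hc1
    set c := Real.cos (2 * (Real.pi / m))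
    set s := Real.sin (2 * (Real.pi / m))
    have hcs : c ^ 2 + s ^ 2 = 1 := Real.cos_sq_add_sin_sq _
    have hd : (2 - 2 * c) ≠ 0 := by linarith
    have u0 : (2 - 2 * c) * (w.re - 1 / 2) = 0 := by
      linear_combination (1 - c) * i1 + s * i2 - (w.re - 1 / 2) * hcs
    have v0 : (2 - 2 * c) * (w.im + inradius m) = 0 := by
      linear_combination (1 - c) * i2 - s * i1 - (w.im + inradius m) * hcs
    have u1 := (mul_eq_zero.1 u0).resolve_left hd
    have v1 := (mul_eq_zero.1 v0).resolve_left hd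
    apply Complex.ext
    · change w.re = 1 / 2; linarith
    · change w.im = -inradius m; linarith
  have hfin : (m : ℂ)⁻¹ * S = ⟨1 / 2, -inradius m⟩ := by
    apply hfix
    have hm0' : (m : ℂ) ≠ 0 := by exact_mod_cast hm0.ne'
    rw [h]
    field_simp
    exact hS2
  rw [← hfin]
  rw [← Finset.smul_sum, Complex.real_smul, ← hS] at key
  have key' : (m : ℂ)⁻¹ * S ∈ convexHull ℝ (onSides m {0}) := by simpa using key
  exact key'

/-- A point which lies strictly below all sides belongs to the polygon. -/
lemma mem_closedPolygon_of_im_neg {z : ℂ} (hz : ∀ k < m, ((sideMap m)^[k] z).im < 0) :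
    z ∈ closedPolygon m := by
  obtain ⟨k, hk, hsec⟩ := exists_sideMap_iterate_mem_sector hm z
  have hH := inradius_pos hm
  have him := hz k hk
  set y := (sideMap m)^[k] z with hy
  suffices hyP : y ∈ closedPolygon m by
    have e : z = (sideMap m)^[m - k] y := by
      rw [hy, ← Function.iterate_add_apply, Nat.sub_add_cancel hk.le, sideMap_iterate_self hm]
    rw [e]
    exact sideMap_iterate_mem_closedPolygon hm _ hyP
  have v0 := closedPolygon_vertex_mem hm 0
  have v1 := closedPolygon_vertex_mem hm 1
  have vc := polygonCenter_mem hm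
  simp only [Function.iterate_zero, id, Function.iterate_one] at v0 v1
  have v1' : (1 : ℂ) ∈ closedPolygon m := by simpa [sideMap] using v1
  have h1 := abs_le.1 (le_refl |y.re - 1 / 2|)
  have habs := abs_nonneg (y.re - 1 / 2)
  have hv : 0 ≤ y.im + inradius m := le_trans (by positivity) hsec
  -- These are the barycentric coordinates of the rotated point in the triangle with vertices 0, 1
  -- and the centre.
  have key := (convex_convexHull ℝ (onSides m {0})).sum_mem (t := (Finset.univ : Finset (Fin 3)))
    (w := ![((y.im + inradius m) / inradius m) / 2 - (y.re - 1 / 2),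
      ((y.im + inradius m) / inradius m) / 2 + (y.re - 1 / 2), -y.im / inradius m])
    (z := ![(0 : ℂ), 1, ⟨1 / 2, -inradius m⟩]) ?_ ?_ ?_
  · unfold closedPolygon
    convert key
    rw [Fin.sum_univ_three]
    simp only [Matrix.cons_val_zero, Matrix.cons_val_one, Matrix.cons_val]
    apply Complex.ext
    · simp only [Complex.add_re, Complex.smul_re, Complex.zero_re, Complex.one_re, smul_eq_mul]
      field_simp
      ring
    · simp only [Complex.add_im, Complex.smul_im, Complex.zero_im, Complex.one_im, smul_eq_mul]
      field_simp
      ring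
  · have hle : |y.re - 1 / 2| ≤ ((y.im + inradius m) / inradius m) / 2 := by
      rw [div_div, le_div_iff₀ (by positivity)]
      linarith
    intro i _
    fin_cases i
    · simp only [Fin.zero_eta, Matrix.cons_val_zero]
      linarith [le_abs_self (y.re - 1 / 2)]
    · simp only [Fin.mk_one, Matrix.cons_val_one, Matrix.cons_val_zero]
      linarith [neg_abs_le (y.re - 1 / 2)]
    · simp only [Fin.reduceFinMk, Matrix.cons_val]
      exact div_nonneg (by linarith) hH.le
  · rw [Fin.sum_univ_three]
    simp only [Matrix.cons_val_zero, Matrix.cons_val_one, Matrix.cons_val]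
    field_simp
    ring
  · intro i _
    fin_cases i
    exacts [v0, v1', vc]

omit hm in
lemma continuous_sideMap (m : ℕ) : Continuous (sideMap m) := by
  obtain ⟨ζ, -, h⟩ := sideMap_eq m
  rw [funext h]
  fun_prop

omit hm in
lemma isClosed_closedPolygon (m : ℕ) : IsClosed (closedPolygon m) := by
  refine (Set.Finite.isCompact_convexHull (𝕜 := ℝ) ?_).isClosed
  refine Set.finite_iUnion fun j => ?_
  simp

/-- A frontier point cannot lie strictly below all sides, hence it lies on the line of some side.
The half-planes of the two neighbouring sides then confine it to that side. -/
lemma frontier_closedPolygon_subset :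
    frontier (closedPolygon m) ⊆ onSides m (segment ℝ 0 1) := by
  obtain ⟨h0, h1, hs, hc, hp⟩ := polygon_angle_bounds hm
  intro z hz
  have hzP : z ∈ closedPolygon m := (isClosed_closedPolygon m).frontier_subset hz
  have hI : ¬ ∀ k < m, ((sideMap m)^[k] z).im < 0 := by
    intro h
    have hopen : IsOpen {z : ℂ | ∀ k < m, ((sideMap m)^[k] z).im < 0} := by
      have : {z : ℂ | ∀ k < m, ((sideMap m)^[k] z).im < 0} =
          ⋂ k ∈ Finset.range m, {z : ℂ | ((sideMap m)^[k] z).im < 0} := by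
        ext; simp
      rw [this]
      refine isOpen_biInter_finset fun k _ => ?_
      exact isOpen_lt (Complex.continuous_im.comp ((continuous_sideMap m).iterate k))
        continuous_const
    have hsub : {z : ℂ | ∀ k < m, ((sideMap m)^[k] z).im < 0} ⊆ closedPolygon m :=
      fun z hz => mem_closedPolygon_of_im_neg hm hz
    exact hz.2 (interior_maximal hsub hopen h)
  push Not at hI
  obtain ⟨k, hk, hzk⟩ := hI
  have hyP := sideMap_iterate_mem_closedPolygon hm k hzP
  set y := (sideMap m)^[k] z with hy
  have hy0 : y.im = 0 := le_antisymm (im_nonpos_of_mem_closedPolygon hm hyP) hzk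
  have a1 := im_nonpos_of_mem_closedPolygon hm (sideMap_iterate_mem_closedPolygon hm 1 hyP)
  have a2 := im_nonpos_of_mem_closedPolygon hm (sideMap_iterate_mem_closedPolygon hm (m - 1) hyP)
  have b1 := (sideMap_iterate_re_im hm 1 y).2
  have b2 := (sideMap_iterate_re_im hm (m - 1) y).2
  have e1 : ((1 : ℕ) : ℝ) * (2 * (Real.pi / m)) = 2 * (Real.pi / m) := by simp
  have e2 : ((m - 1 : ℕ) : ℝ) * (2 * (Real.pi / m)) = 2 * Real.pi - 2 * (Real.pi / m) := by
    rw [Nat.cast_sub (by omega)]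
    push_cast
    linear_combination 2 * hp
  rw [e1, hy0] at b1
  rw [e2, Real.cos_two_pi_sub, Real.sin_two_pi_sub, hy0] at b2
  have hH := two_mul_sin_mul_inradius hm
  have hs2 := Real.sin_two_mul (Real.pi / m)
  have hc2 : Real.cos (2 * (Real.pi / m)) = 1 - 2 * Real.sin (Real.pi / m) ^ 2 := by
    rw [Real.cos_two_mul, Real.cos_sq']; ring
  have hk1 : inradius m * (1 - Real.cos (2 * (Real.pi / m))) = Real.sin (2 * (Real.pi / m)) / 2 := by
    rw [hs2, hc2]
    linear_combination Real.sin (Real.pi / m) * hH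
  have hsin2 : 0 < Real.sin (2 * (Real.pi / m)) := by rw [hs2]; positivity
  have c1 : -(y.re - 1 / 2) ≤ 1 / 2 := by
    refine le_of_mul_le_mul_right ?_ hsin2
    linarith
  have c2 : y.re - 1 / 2 ≤ 1 / 2 := by
    refine le_of_mul_le_mul_right ?_ hsin2
    linarith
  have hseg : y ∈ segment ℝ (0 : ℂ) 1 := by
    refine ⟨1 - y.re, y.re, by linarith, by linarith, by ring, ?_⟩
    apply Complex.ext <;> simp [hy0]
  have e : (sideMap m)^[(m - k) % m] y = z := by
    rw [Function.IsPeriodicPt.iterate_mod_apply (sideMap_iterate_self hm y), hy,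
      ← Function.iterate_add_apply, Nat.sub_add_cancel hk.le, sideMap_iterate_self hm]
  exact mem_iUnion.2 ⟨⟨(m - k) % m, Nat.mod_lt _ (by omega)⟩, y, hseg, e⟩

end Polygon

/-- The lower base angle min(ϑ, π - 2ϑ) never exceeds π/3, so the lower part of the kite fits into
the equilateral triangle below [0, 1]. This is why every m ≥ 3 is admissible. -/
lemma sqrt_three_bounds {κ : ℝ} (hκ0 : 0 < κ) (hκ1 : κ < 1) {z : ℂ} (hz : z ∈ invariantKite κ)
    (hz0 : z.im ≤ 0) : -z.im ≤ √3 * z.re ∧ -z.im ≤ √3 * (1 - z.re) := by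
  obtain ⟨x0, x1⟩ := KochParam.re_mem_of_invariantKite hκ0 hκ1 hz
  have hs : √3 ^ 2 = 3 := Real.sq_sqrt (by norm_num)
  have hs0 : 0 < √3 := by positivity
  have he : 0 < 1 - κ ^ 2 := by nlinarith
  have hY : 0 ≤ -z.im := by linarith
  obtain ⟨-, ⟨z3, z4⟩, z5, z6⟩ := hz
  have key : ∀ X : ℝ, 0 ≤ X → (1 - κ ^ 2) * -z.im ≤ 2 * κ * X →
      (4 * κ ^ 2 - (1 - κ ^ 2) ^ 2) * -z.im ≤ 4 * κ * (1 - κ ^ 2) * X → -z.im ≤ √3 * X := by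
    intro X hX h1 h2
    generalize -z.im = Y at *
    generalize 1 - κ ^ 2 = e at *
    -- The first case is ϑ ≤ π/3; in the second, π - 2ϑ ≤ π/3.
    rcases le_total (2 * κ) (√3 * e) with h | h
    · have a1 := mul_le_mul_of_nonneg_right h hX
      have a2 : e * Y ≤ e * (√3 * X) := by linarith
      exact le_of_mul_le_mul_left a2 he
    · have a1 : 4 * κ * e ≤ √3 * (4 * κ ^ 2 - e ^ 2) := by
        have : 0 ≤ (√3 * (2 * κ) + e) * (2 * κ - √3 * e) := mul_nonneg (by positivity) (by linarith)
        linear_combination this - 2 * κ * e * hs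
      have a2 := mul_le_mul_of_nonneg_right a1 hX
      have a3 : 0 < 4 * κ ^ 2 - e ^ 2 := by
        have : e < 2 * κ := by
          have : 1 * e < √3 * e := by
            gcongr
            nlinarith
          linarith
        nlinarith
      have a4 : (4 * κ ^ 2 - e ^ 2) * Y ≤ (4 * κ ^ 2 - e ^ 2) * (√3 * X) := by linarith
      exact le_of_mul_le_mul_left a4 a3
  exact ⟨key _ x0 z3 z5, key _ (by linarith) z4 z6⟩

section Sides

variable {m : ℕ} (hm : 3 ≤ m) {κ : ℝ} (hκ0 : 0 < κ) (hκ1 : κ < 1)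
include hm

/-- The inequality says that the apex of the equilateral triangle below [0, 1] does not rise above
any other side. For m = 3 it is an equality, and for m ≥ 4 the inradius is at least 1/2. -/
lemma cos_add_nonneg {k : ℕ} (hk0 : 0 < k) (hk : k < m) :
    0 ≤ √3 * Real.cos (k * (2 * (Real.pi / m))) +
      2 * (1 - Real.cos (k * (2 * (Real.pi / m)))) * inradius m := by
  obtain ⟨h0, h1, hs, hc, hp⟩ := polygon_angle_bounds hm
  have hH := two_mul_sin_mul_inradius hm
  have hs0 : 0 < √3 := by positivity
  have hs3 : √3 ^ 2 = 3 := Real.sq_sqrt (by norm_num)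
  rcases hm.eq_or_lt with h3 | h4
  · subst h3
    have hcos : Real.cos (k * (2 * (Real.pi / (3 : ℕ)))) = -1 / 2 := by
      have : k = 1 ∨ k = 2 := by omega
      rcases this with rfl | rfl
      · have : ((1 : ℕ) : ℝ) * (2 * (Real.pi / (3 : ℕ))) = Real.pi - Real.pi / 3 := by
          push_cast; ring
        rw [this, Real.cos_pi_sub, Real.cos_pi_div_three]; norm_num
      · have : ((2 : ℕ) : ℝ) * (2 * (Real.pi / (3 : ℕ))) = Real.pi / 3 + Real.pi := by
          push_cast; ring
        rw [this, Real.cos_add_pi, Real.cos_pi_div_three]; norm_num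
    rw [hcos]
    push_cast at hH
    rw [Real.cos_pi_div_three, Real.sin_pi_div_three] at hH
    nlinarith
  · have hm' : (4 : ℝ) ≤ m := by exact_mod_cast h4
    have hπ := Real.pi_pos
    have hle : Real.pi / m ≤ Real.pi / 4 := by gcongr
    have hsc : Real.sin (Real.pi / m) ≤ Real.cos (Real.pi / m) := by
      rw [← Real.cos_pi_div_two_sub]
      exact Real.cos_le_cos_of_nonneg_of_le_pi h0.le (by linarith) (by linarith)
    have hH2 : 1 / 2 ≤ inradius m := by
      refine le_of_mul_le_mul_left ?_ hs
      linarith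
    have c1 := Real.cos_le_one (k * (2 * (Real.pi / m)))
    have c2 := Real.neg_one_le_cos (k * (2 * (Real.pi / m)))
    have hs2 : √3 ≤ 2 := by nlinarith
    have := mul_le_mul_of_nonneg_left hH2 (sub_nonneg.2 c1)
    nlinarith

include hκ0 hκ1

/-- The part of an open subset of the kite below `[0, 1]` lies strictly below all sides. -/
lemma im_neg_of_mem_kite {U : Set ℂ} (hU : IsOpen U) (hUk : U ⊆ invariantKite κ) {z : ℂ}
    (hz : z ∈ U) (hz0 : z.im < 0) (k : ℕ) : ((sideMap m)^[k] z).im < 0 := by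
  have hred : (sideMap m)^[k % m] z = (sideMap m)^[k] z :=
    Function.IsPeriodicPt.iterate_mod_apply (sideMap_iterate_self hm z) k
  rw [← hred]
  have hk : k % m < m := Nat.mod_lt _ (by omega)
  generalize k % m = k at hk
  rcases Nat.eq_zero_or_pos k with rfl | hk0
  · exact hz0
  have hV : IsOpen (U ∩ {z : ℂ | z.im < 0}) :=
    hU.inter (isOpen_lt Complex.continuous_im continuous_const)
  have hs0 : 0 < √3 := by positivity
  have hs3 : √3 ^ 2 = 3 := Real.sq_sqrt (by norm_num)
  have hH := inradius_pos hm
  set c := Real.cos (k * (2 * (Real.pi / m))) with hc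
  set s := Real.sin (k * (2 * (Real.pi / m))) with hs
  have hcs : c ^ 2 + s ^ 2 = 1 := Real.cos_sq_add_sin_sq _
  have hle : ∀ z ∈ U ∩ {z : ℂ | z.im < 0},
      -s * z.re + c * z.im ≤ inradius m * (1 - c) - s * (1 / 2) := by
    rintro z ⟨hzU, hz0⟩
    obtain ⟨b1, b2⟩ := sqrt_three_bounds hκ0 hκ1 (hUk hzU) (le_of_lt hz0)
    have hz0' : z.im < 0 := hz0
    have k1 : |s| ≤ (1 - c) * (2 * inradius m) := abs_sin_mul_le hm hk0 hk
    have k2 : 0 ≤ √3 * c + 2 * (1 - c) * inradius m := cos_add_nonneg hm hk0 hk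
    have k3 : |z.re - 1 / 2| * √3 ≤ √3 / 2 + z.im := by
      rcases abs_cases (z.re - 1 / 2) with ⟨h, -⟩ | ⟨h, -⟩ <;> rw [h] <;> linarith
    have k4 : -(s * (z.re - 1 / 2)) ≤ |s| * |z.re - 1 / 2| := by
      rw [← abs_mul]; exact neg_le_abs _
    have k5 : |s| * (|z.re - 1 / 2| * √3) ≤ (1 - c) * (2 * inradius m) * (√3 / 2 + z.im) := by
      refine (mul_le_mul_of_nonneg_left k3 (abs_nonneg _)).trans
        (mul_le_mul_of_nonneg_right k1 ?_)
      exact le_trans (by positivity) k3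
    have k6 := mul_nonneg k2 (show 0 ≤ -z.im by linarith)
    have k7 := mul_le_mul_of_nonneg_right k4 hs0.le
    refine le_of_mul_le_mul_right ?_ hs0
    linarith
  have hcs0 : -s ≠ 0 ∨ c ≠ 0 := by
    by_contra! h
    rw [neg_eq_zero] at h
    rw [h.1, h.2] at hcs
    norm_num at hcs
  have := lt_of_isOpen_of_le hV hcs0 hle (z := z) ⟨hz, hz0⟩
  have h2 := (sideMap_iterate_re_im hm k z).2
  linarith

/-- Copies along different sides of an open subset of the kite and of the upper triangle are
disjoint. -/
lemma sideMap_iterate_ne {U : Set ℂ} (hU : IsOpen U) (hUk : U ⊆ invariantKite κ) {z z' : ℂ}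
    (hz : z ∈ U) (hz' : 0 ≤ z'.im) (hk' : z' ∈ invariantKite κ) {j k : ℕ} (hj : j < m) (hk : k < m)
    (hjk : j ≠ k) : (sideMap m)^[j] z ≠ (sideMap m)^[k] z' := by
  intro heq
  obtain ⟨d, hd0, hd, rfl⟩ : ∃ d, 0 < d ∧ d < m ∧ z = (sideMap m)^[d] z' := by
    rcases lt_or_gt_of_ne hjk with h | h
    · refine ⟨k - j, by omega, by omega, ?_⟩
      apply (sideMap_injective m).iterate j
      rw [heq, ← Function.iterate_add_apply]
      congr 2; omega
    · refine ⟨m - (j - k), by omega, by omega, ?_⟩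
      apply (sideMap_injective m).iterate j
      rw [heq, ← Function.iterate_add_apply]
      have e : j + (m - (j - k)) = k + m := by omega
      rw [e, Function.iterate_add_apply, sideMap_iterate_self hm]
  have hback : (sideMap m)^[m - d] ((sideMap m)^[d] z') = z' := by
    rw [← Function.iterate_add_apply, Nat.sub_add_cancel hd.le, sideMap_iterate_self hm]
  have hH := inradius_pos hm
  obtain ⟨x0, x1⟩ := KochParam.re_mem_of_invariantKite hκ0 hκ1 hk'
  have hsec' : |z'.re - 1 / 2| * (2 * inradius m) ≤ z'.im + inradius m := by
    have : |z'.re - 1 / 2| ≤ 1 / 2 := by rw [abs_le]; constructor <;> linarith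
    nlinarith
  have h1 := im_sideMap_iterate_le hm hd0 hd hsec'
  -- If the common point is below the side of z, it is below all sides, also that of z'. Otherwise
  -- openness puts it strictly inside the sector of z, so its height over the side of z' is strictly
  -- smaller, against `h1`.
  rcases lt_or_ge ((sideMap m)^[d] z').im 0 with h | h
  · have := im_neg_of_mem_kite hm hκ0 hκ1 hU hUk hz h (m - d)
    rw [hback] at this
    linarith
  · have y0 := lt_of_isOpen_of_le (a := -1) (b := 0) (c := 0) hU (by simp)
      (fun w hw => by
        have := (KochParam.re_mem_of_invariantKite hκ0 hκ1 (hUk hw)).1; linarith) hz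
    have y1 := lt_of_isOpen_of_le (a := 1) (b := 0) (c := 1) hU (by simp)
      (fun w hw => by
        have := (KochParam.re_mem_of_invariantKite hκ0 hκ1 (hUk hw)).2; linarith) hz
    have hsec : |((sideMap m)^[d] z').re - 1 / 2| * (2 * inradius m) <
        ((sideMap m)^[d] z').im + inradius m := by
      have : |((sideMap m)^[d] z').re - 1 / 2| < 1 / 2 := by
        rw [abs_lt]; constructor <;> linarith
      nlinarith
    have h2 := im_sideMap_iterate_lt hm (show 0 < m - d by omega) (show m - d < m by omega) hsec
    rw [hback] at h2
    linarith

end Sides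

/-! ### The cells of the pre-fractal domains -/

/-- The similarity which maps `[0, 1]` to the segment of the pre-fractal curve with the word `w`
along the side `j`. -/
noncomputable def cellMap (m : ℕ) (α : ℝ) (j : ℕ) (w : List (Fin 4)) : ℂ → ℂ :=
  (sideMap m)^[j] ∘ wordMap α w

lemma mem_onSides_iterateSet {m : ℕ} {α : ℝ} {n : ℕ} {S : Set ℂ} {x : ℂ} :
    x ∈ onSides m (iterateSet α n S) ↔
      ∃ j < m, ∃ w : List (Fin 4), w.length = n ∧ ∃ z ∈ S, cellMap m α j w z = x := by
  simp only [onSides, iterateSet, mem_iUnion, mem_image, mem_ofPred_eq, cellMap,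
    Function.comp_apply]
  constructor
  · rintro ⟨j, y, ⟨w, hw, z, hz, rfl⟩, rfl⟩
    exact ⟨j.1, j.2, w, hw, z, hz, rfl⟩
  · rintro ⟨j, hj, w, hw, z, hz, rfl⟩
    exact ⟨⟨j, hj⟩, _, ⟨w, hw, z, hz, rfl⟩, rfl⟩

lemma wordMap_append (α : ℝ) (v w : List (Fin 4)) (z : ℂ) :
    wordMap α (v ++ w) z = wordMap α v (wordMap α w z) := by
  induction v with
  | nil => rfl
  | cons i v ih =>
    change kochMap α i (wordMap α (v ++ w) z) = kochMap α i (wordMap α v (wordMap α w z))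
    rw [ih]

lemma cellMap_append (m : ℕ) (α : ℝ) (j : ℕ) (v w : List (Fin 4)) (z : ℂ) :
    cellMap m α j (v ++ w) z = cellMap m α j v (wordMap α w z) := by
  simp [cellMap, wordMap_append]

lemma isOpenMap_of_affine {f : ℂ → ℂ} {a b : ℂ} (ha : a ≠ 0) (hf : ∀ z, f z = a * z + b) :
    IsOpenMap f := by
  have : f = (Homeomorph.addRight b) ∘ (Homeomorph.mulLeft₀ a ha) := by
    funext z; simp [hf]
  rw [this]
  exact (Homeomorph.isOpenMap _).comp (Homeomorph.isOpenMap _)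

/-- The open kite with diagonal `[0, 1]` and angles of tangent `t`. -/
def openKite (t : ℝ) : Set ℂ := {z | |z.im| < t * z.re ∧ |z.im| < t * (1 - z.re)}

lemma isOpen_openKite (t : ℝ) : IsOpen (openKite t) := by
  have hc1 : Continuous fun z : ℂ => |z.im| := by fun_prop
  have hc2 : Continuous fun z : ℂ => t * z.re := by fun_prop
  have hc3 : Continuous fun z : ℂ => t * (1 - z.re) := by fun_prop
  exact (isOpen_lt hc1 hc2).inter (isOpen_lt hc1 hc3)

lemma mem_segment_zero_one {z : ℂ} : z ∈ segment ℝ (0 : ℂ) 1 ↔ z.im = 0 ∧ 0 ≤ z.re ∧ z.re ≤ 1 := by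
  constructor
  · rintro ⟨a, b, ha, hb, hab, rfl⟩
    simp only [smul_zero, zero_add, Complex.smul_im, Complex.one_im, Complex.smul_re,
      Complex.one_re, smul_eq_mul, mul_zero, mul_one, true_and]
    constructor <;> linarith
  · rintro ⟨h0, h1, h2⟩
    refine ⟨1 - z.re, z.re, by linarith, h1, by ring, ?_⟩
    apply Complex.ext <;> simp [h0]

namespace KochParam

variable {α η κ t : ℝ} (h : KochParam α η κ t)
include h

lemma exists_wordMap_affine (w : List (Fin 4)) :
    ∃ a b : ℂ, ‖a‖ = ((1 + κ ^ 2) / 4) ^ w.length ∧ ∀ z, wordMap α w z = a * z + b := by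
  induction w with
  | nil => exact ⟨1, 0, by simp, fun z => by simp [wordMap]⟩
  | cons i w ih =>
    obtain ⟨a, b, ha, hab⟩ := ih
    refine ⟨kochLin κ i * a, kochLin κ i * b + kochOff κ i, ?_, fun z => ?_⟩
    · rw [norm_mul, ha, norm_kochLin, List.length_cons, pow_succ _ w.length, mul_comm]
    · change kochMap α i (wordMap α w z) = _
      rw [h.kochMap_eq, hab]; ring

lemma exists_cellMap_affine (m j : ℕ) (w : List (Fin 4)) :
    ∃ a b : ℂ, a ≠ 0 ∧ ‖a‖ = ((1 + κ ^ 2) / 4) ^ w.length ∧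
      ∀ z, cellMap m α j w z = a * z + b := by
  obtain ⟨a, b, ha, hab⟩ := h.exists_wordMap_affine w
  obtain ⟨ζ, hζ, hs⟩ := sideMap_eq m
  have key : ∃ a b : ℂ, ‖a‖ = ((1 + κ ^ 2) / 4) ^ w.length ∧
      ∀ z, cellMap m α j w z = a * z + b := by
    induction j with
    | zero => exact ⟨a, b, ha, hab⟩
    | succ j ih =>
      obtain ⟨a', b', ha', hab'⟩ := ih
      refine ⟨ζ * a', ζ * b' + 1, by rw [norm_mul, hζ, one_mul, ha'], fun z => ?_⟩
      have : cellMap m α (j + 1) w z = sideMap m (cellMap m α j w z) := by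
        simp only [cellMap, Function.comp_apply]
        rw [Function.iterate_succ_apply']
      rw [this, hs, hab']; ring
  obtain ⟨a, b, ha, hab⟩ := key
  refine ⟨a, b, ?_, ha, hab⟩
  rw [← norm_pos_iff, ha]
  positivity

lemma continuous_cellMap (m j : ℕ) (w : List (Fin 4)) : Continuous (cellMap m α j w) := by
  obtain ⟨a, b, -, -, hab⟩ := h.exists_cellMap_affine m j w
  rw [funext hab]
  fun_prop

lemma isOpenMap_cellMap (m j : ℕ) (w : List (Fin 4)) : IsOpenMap (cellMap m α j w) := by
  obtain ⟨a, b, ha, -, hab⟩ := h.exists_cellMap_affine m j w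
  exact isOpenMap_of_affine ha hab

lemma cellMap_injective (m j : ℕ) (w : List (Fin 4)) : Function.Injective (cellMap m α j w) := by
  obtain ⟨a, b, ha, -, hab⟩ := h.exists_cellMap_affine m j w
  intro x y hxy
  rw [hab, hab] at hxy
  simpa [ha] using hxy

lemma isOpenMap_wordMap (w : List (Fin 4)) : IsOpenMap (wordMap α w) := by
  simpa [cellMap] using h.isOpenMap_cellMap 0 0 w

lemma isOpenMap_kochMap (i : Fin 4) : IsOpenMap (kochMap α i) := by
  simpa [wordMap] using h.isOpenMap_wordMap [i]

lemma kochMap_injective (i : Fin 4) : Function.Injective (kochMap α i) := by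
  simpa [wordMap, cellMap] using h.cellMap_injective 0 0 [i]

lemma wordMap_mapsTo_upperTriangle (w : List (Fin 4)) :
    MapsTo (wordMap α w) (upperTriangle κ) (upperTriangle κ) := by
  induction w with
  | nil => exact mapsTo_id _
  | cons i w ih => exact (h.kochMap_mapsTo_upperTriangle i).comp ih

lemma wordMap_mapsTo_invariantKite (w : List (Fin 4)) :
    MapsTo (wordMap α w) (invariantKite κ) (invariantKite κ) := by
  induction w with
  | nil => exact mapsTo_id _
  | cons i w ih => exact (h.kochMap_mapsTo_invariantKite i).comp ih

/-- Common first letters are cancelled by injectivity, and at the first difference a line separates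
the two images. Openness of U makes the inequality on its side strict, so the other set may be
closed and touch the line. -/
lemma wordMap_ne {U : Set ℂ} (hU : IsOpen U) (hUk : U ⊆ invariantKite κ) {z z' : ℂ}
    (hz : z ∈ U) (hz' : z' ∈ upperTriangle κ) {w w' : List (Fin 4)} (hlen : w.length = w'.length)
    (hne : w ≠ w') : wordMap α w z ≠ wordMap α w' z' := by
  induction w generalizing w' with
  | nil =>
    have : w' = [] := List.length_eq_zero_iff.1 (by simpa using hlen.symm)
    exact absurd this.symm hne
  | cons i v ih =>
    match w', hlen, hne with
    | i' :: v', hlen, hne =>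
      intro heq
      change kochMap α i (wordMap α v z) = kochMap α i' (wordMap α v' z') at heq
      rcases eq_or_ne i i' with rfl | hi
      · exact ih (by simpa using hlen) (fun hv => hne (by rw [hv])) (h.kochMap_injective i heq)
      · obtain ⟨a, b, c, hab, h1, h2⟩ := h.exists_separating_line hi
        have hV : IsOpen (kochMap α i '' (wordMap α v '' U)) :=
          h.isOpenMap_kochMap i _ (h.isOpenMap_wordMap v U hU)
        have h3 := lt_of_isOpen_of_le hV hab (c := c) (by
          rintro _ ⟨_, ⟨y, hy, rfl⟩, rfl⟩
          exact h1 _ (h.wordMap_mapsTo_invariantKite v (hUk hy)))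
          (mem_image_of_mem _ (mem_image_of_mem _ hz))
        have h4 := h2 _ (h.wordMap_mapsTo_upperTriangle v' hz')
        rw [heq] at h3
        linarith

/-- The open set condition: an open part of the kite in one cell does not meet the upper triangle of
another cell. -/
lemma cellMap_ne {m : ℕ} (hm : 3 ≤ m) {U : Set ℂ} (hU : IsOpen U) (hUk : U ⊆ invariantKite κ)
    {z z' : ℂ} (hz : z ∈ U) (hz' : z' ∈ upperTriangle κ) {j j' : ℕ} (hj : j < m) (hj' : j' < m)
    {w w' : List (Fin 4)} (hlen : w.length = w'.length) (hne : (j, w) ≠ (j', w')) :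
    cellMap m α j w z ≠ cellMap m α j' w' z' := by
  have hz'' := h.wordMap_mapsTo_upperTriangle w' hz'
  rcases eq_or_ne j j' with rfl | hjj
  · intro heq
    exact h.wordMap_ne hU hUk hz hz' hlen (fun hw => hne (by rw [hw]))
      ((sideMap_injective m).iterate j heq)
  · refine sideMap_iterate_ne hm h.κ_pos h.κ_lt (h.isOpenMap_wordMap w U hU) ?_
      (mem_image_of_mem _ hz) hz''.1 (h.upperTriangle_subset_invariantKite hz'') hj hj' hjj
    rintro _ ⟨y, hy, rfl⟩
    exact h.wordMap_mapsTo_invariantKite w (hUk hy)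

lemma openKite_subset_invariantKite : openKite t ⊆ invariantKite κ := by
  rintro z ⟨h1, h2⟩
  have ht := h.t_pos
  rcases lt_or_ge z.im 0 with hz | hz
  · rw [abs_of_neg hz] at h1 h2
    exact h.doubleTriangle_subset_invariantKite
      (lowerTriangle_subset_doubleTriangle ht ⟨hz, h1, h2⟩)
  · rw [abs_of_nonneg hz] at h1 h2
    have x0 : 0 ≤ z.re := by by_contra! hc; nlinarith
    have x1 : 0 ≤ 1 - z.re := by by_contra! hc; nlinarith
    refine h.upperTriangle_subset_invariantKite ⟨hz, h1.le.trans ?_, h2.le.trans ?_⟩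
    · exact mul_le_mul_of_nonneg_right h.t_le x0
    · exact mul_le_mul_of_nonneg_right h.t_le x1

lemma segment_subset_upperTriangle : segment ℝ (0 : ℂ) 1 ⊆ upperTriangle κ := by
  intro z hz
  obtain ⟨h0, h1, h2⟩ := mem_segment_zero_one.1 hz
  have := h.κ_pos
  refine ⟨h0.ge, ?_, ?_⟩ <;> rw [h0]
  · positivity
  · exact mul_nonneg this.le (by linarith)

end KochParam

/-! ### The pre-fractal domains -/

/-- The closed polygonal set whose interior is the pre-fractal domain. -/
noncomputable def closedPrefractal (m : ℕ) (α : ℝ) (n : ℕ) : Set ℂ :=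
  closedPolygon m ∪ ⋃ k ∈ {k : ℕ | k < n}, onSides m (iterateSet α k (bump α))

lemma mem_closedPrefractal {m : ℕ} {α : ℝ} {n : ℕ} {x : ℂ} :
    x ∈ closedPrefractal m α n ↔ x ∈ closedPolygon m ∨ ∃ j < m, ∃ w : List (Fin 4),
      w.length < n ∧ ∃ z ∈ bump α, cellMap m α j w z = x := by
  simp only [closedPrefractal, mem_union, mem_iUnion, mem_onSides_iterateSet, mem_ofPred_eq]
  constructor
  · rintro (h | ⟨k, hk, j, hj, w, rfl, z, hz⟩)
    · exact Or.inl h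
    · exact Or.inr ⟨j, hj, w, hk, z, hz⟩
  · rintro (h | ⟨j, hj, w, hk, z, hz⟩)
    · exact Or.inl h
    · exact Or.inr ⟨w.length, hk, j, hj, w, rfl, z, hz⟩

lemma prefractalDomain_eq (m : ℕ) (α : ℝ) (n : ℕ) :
    prefractalDomain m α n = interior (closedPrefractal m α n) := rfl

lemma closedPrefractal_mono (m : ℕ) (α : ℝ) : Monotone (closedPrefractal m α) := by
  intro n n' hn x hx
  rw [mem_closedPrefractal] at hx ⊢
  rcases hx with h | ⟨j, hj, w, hw, z⟩
  · exact Or.inl h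
  · exact Or.inr ⟨j, hj, w, hw.trans_le hn, z⟩

lemma prefractalDomain_mono (m : ℕ) (α : ℝ) : Monotone (prefractalDomain m α) :=
  fun _ _ hn => interior_mono (closedPrefractal_mono m α hn)

lemma closedPrefractal_succ (m : ℕ) (α : ℝ) (n : ℕ) :
    closedPrefractal m α (n + 1) =
      closedPrefractal m α n ∪ onSides m (iterateSet α n (bump α)) := by
  ext x
  simp only [mem_union, mem_closedPrefractal, mem_onSides_iterateSet]
  constructor
  · rintro (h | ⟨j, hj, w, hw, z⟩)
    · exact Or.inl (Or.inl h)
    · rcases Nat.lt_succ_iff_lt_or_eq.1 hw with hw | hw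
      · exact Or.inl (Or.inr ⟨j, hj, w, hw, z⟩)
      · exact Or.inr ⟨j, hj, w, hw, z⟩
  · rintro ((h | ⟨j, hj, w, hw, z⟩) | ⟨j, hj, w, hw, z⟩)
    · exact Or.inl h
    · exact Or.inr ⟨j, hj, w, by omega, z⟩
    · exact Or.inr ⟨j, hj, w, by omega, z⟩

lemma isCompact_bump (α : ℝ) : IsCompact (bump α) :=
  Set.Finite.isCompact_convexHull (𝕜 := ℝ) (by simp)

lemma onSides_iterateSet_eq (m : ℕ) (α : ℝ) (n : ℕ) (S : Set ℂ) :
    onSides m (iterateSet α n S) =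
      ⋃ c ∈ Finset.range m ×ˢ (List.finite_length_eq (Fin 4) n).toFinset,
        cellMap m α c.1 c.2 '' S := by
  ext x
  simp only [mem_onSides_iterateSet, mem_iUnion, Finset.mem_product, Finset.mem_range,
    Set.Finite.mem_toFinset, mem_ofPred_eq, mem_image, exists_prop, Prod.exists]
  constructor
  · rintro ⟨j, hj, w, hw, z⟩
    exact ⟨j, w, ⟨hj, hw⟩, z⟩
  · rintro ⟨j, w, ⟨hj, hw⟩, z⟩
    exact ⟨j, hj, w, hw, z⟩

namespace KochParam

variable {α η κ t : ℝ} (h : KochParam α η κ t) {m : ℕ} (hm : 3 ≤ m)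
include h

lemma isCompact_onSides_iterateSet (n : ℕ) {S : Set ℂ} (hS : IsCompact S) :
    IsCompact (onSides m (iterateSet α n S)) := by
  rw [onSides_iterateSet_eq]
  exact Finset.isCompact_biUnion _ fun c _ => hS.image (h.continuous_cellMap m _ _)

lemma isOpen_onSides_iterateSet (n : ℕ) {S : Set ℂ} (hS : IsOpen S) :
    IsOpen (onSides m (iterateSet α n S)) := by
  rw [onSides_iterateSet_eq]
  exact isOpen_biUnion fun c _ => h.isOpenMap_cellMap m _ _ S hS

lemma isCompact_closedPrefractal (n : ℕ) : IsCompact (closedPrefractal m α n) := by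
  induction n with
  | zero =>
    have : closedPrefractal m α 0 = closedPolygon m := by
      ext x; simp [mem_closedPrefractal]
    rw [this]
    refine Set.Finite.isCompact_convexHull (𝕜 := ℝ) (Set.finite_iUnion fun j => ?_)
    simp
  | succ n ih =>
    rw [closedPrefractal_succ]
    exact ih.union (h.isCompact_onSides_iterateSet n (isCompact_bump α))

lemma kochMap_zero_zero : kochMap α 0 0 = 0 := by
  obtain ⟨⟨r, i⟩, -⟩ := h.kochMap_re_im 0
  apply Complex.ext <;> simp [r, i]

lemma kochMap_three_one : kochMap α 3 1 = 1 := by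
  obtain ⟨-, -, -, r, i⟩ := h.kochMap_re_im 1
  apply Complex.ext
  · rw [r]; simp; ring
  · rw [i]; simp

include hm

/-- The inner triangles of the `n`-th generation belong to the pre-fractal domain. -/
lemma cellMap_lowerTriangle_mem {j : ℕ} (hj : j < m) {n : ℕ} {w : List (Fin 4)}
    (hw : w.length = n) {z : ℂ} (hz : z ∈ lowerTriangle t) :
    cellMap m α j w z ∈ prefractalDomain m α n := by
  have key : ∀ n : ℕ, ∀ w : List (Fin 4), w.length = n → ∀ z ∈ lowerTriangle t,
      cellMap m α j w z ∈ closedPrefractal m α n := by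
    intro n
    induction n with
    | zero =>
      intro w hw z hz
      rw [List.length_eq_zero_iff] at hw
      subst hw
      rw [mem_closedPrefractal]
      left
      refine sideMap_iterate_mem_closedPolygon hm j (mem_closedPolygon_of_im_neg hm fun k _ => ?_)
      exact im_neg_of_mem_kite hm h.κ_pos h.κ_lt (isOpen_lowerTriangle t)
        ((lowerTriangle_subset_doubleTriangle h.t_pos).trans
          h.doubleTriangle_subset_invariantKite) hz hz.1 k
    | succ n ih =>
      intro w hw z hz
      -- The last letter is the map applied first, so removing it passes to the parent cell.
      obtain ⟨v, i, rfl⟩ : ∃ v i, w = v ++ [i] := by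
        rcases List.eq_nil_or_concat w with rfl | ⟨v, i, rfl⟩
        · simp at hw
        · exact ⟨v, i, by simp⟩
      have hv : v.length = n := by simpa using hw
      rw [cellMap_append, closedPrefractal_succ]
      rcases h.kochMap_mapsTo_lowerTriangle i hz with hi | hi
      · exact Or.inl (ih v hv _ hi)
      · exact Or.inr (mem_onSides_iterateSet.2 ⟨j, hj, v, hv, _, hi, rfl⟩)
  rw [prefractalDomain_eq]
  refine interior_maximal ?_ (h.isOpenMap_cellMap m j w _ (isOpen_lowerTriangle t))
    (mem_image_of_mem _ hz)
  rintro _ ⟨y, hy, rfl⟩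
  exact key n w hw y hy

/-- The open upper triangles of the `n`-th generation do not meet the pre-fractal domain. -/
lemma cellMap_upperTriangleInt_notMem {j : ℕ} (hj : j < m) {n : ℕ} {w : List (Fin 4)}
    (hw : w.length = n) {z : ℂ} (hz : z ∈ upperTriangleInt κ) :
    cellMap m α j w z ∉ closedPrefractal m α n := by
  have hopen : ∀ v : List (Fin 4), IsOpen (wordMap α v '' upperTriangleInt κ) := fun v =>
    h.isOpenMap_wordMap v _ (isOpen_upperTriangleInt κ)
  have hsub : ∀ v : List (Fin 4), wordMap α v '' upperTriangleInt κ ⊆ upperTriangle κ := by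
    rintro v _ ⟨y, hy, rfl⟩
    exact h.wordMap_mapsTo_upperTriangle v (upperTriangleInt_subset κ hy)
  rw [mem_closedPrefractal]
  rintro (hP | ⟨j', hj', w', hw', z', hz', heq⟩)
  · have h1 := lt_of_isOpen_of_le (a := 0) (b := -1) (c := 0) (hopen w) (by simp)
      (fun y hy => by have := (hsub w hy).1; linarith) (mem_image_of_mem _ hz)
    have h2 := sideMap_iterate_mem_closedPolygon hm (m - j) hP
    rw [cellMap, Function.comp_apply, ← Function.iterate_add_apply, Nat.sub_add_cancel hj.le,
      sideMap_iterate_self hm] at h2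
    have h3 := im_nonpos_of_mem_closedPolygon hm h2
    linarith
  -- The prefix v gives the ancestor cell of the generation of the bump. If it is the cell of the
  -- bump, an edge of the bump separates; otherwise the open set condition applies.
  · obtain ⟨v, i, v', hwv, hv⟩ : ∃ v i v', w = v ++ (i :: v') ∧ v.length = w'.length := by
      have hlt : w'.length < w.length := by omega
      refine ⟨w.take w'.length, w[w'.length], w.drop (w'.length + 1), ?_, ?_⟩
      · rw [← List.drop_eq_getElem_cons, List.take_append_drop]
      · simp; omega
    subst hwv
    rw [cellMap_append] at heq
    by_cases hc : (j, v) = (j', w')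
    · obtain ⟨rfl, rfl⟩ := Prod.mk.inj hc
      have heq' := h.cellMap_injective m j v heq
      obtain ⟨a, b, c, hab, h1, h2⟩ := h.exists_separating_line_bump i
      have h3 := lt_of_isOpen_of_le (h.isOpenMap_kochMap i _ (hopen v')) hab (c := c) (by
        rintro _ ⟨y, hy, rfl⟩
        exact h1 y (hsub v' hy)) (mem_image_of_mem _ (mem_image_of_mem _ hz))
      have h4 := h2 z' hz'
      rw [heq'] at h4
      exact absurd h4 (not_le.2 h3)
    · refine h.cellMap_ne hm (hopen (i :: v'))
        ((hsub (i :: v')).trans h.upperTriangle_subset_invariantKite) (mem_image_of_mem _ hz)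
        (h.bump_subset_upperTriangle hz') hj hj' hv hc heq.symm

/-- The middle part of a segment of the `n`-th generation lies in the interior of the next
pre-fractal set. -/
lemma cellMap_middle_mem {j : ℕ} (hj : j < m) {n : ℕ} {w : List (Fin 4)} (hw : w.length = n)
    {x : ℂ} (hx0 : x.im = 0) (hx1 : (1 + κ ^ 2) / 4 < x.re) (hx2 : x.re < 1 - (1 + κ ^ 2) / 4) :
    cellMap m α j w x ∈ interior (closedPrefractal m α (n + 1)) := by
  have hκ := h.κ_pos
  have ht := h.t_pos
  have hκ' : 0 < (1 + κ ^ 2) / 4 := by positivity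
  -- The part of this neighbourhood on or above the base lies in the bump, the part below in the
  -- inner triangle.
  let N : Set ℂ := {y | (1 - κ ^ 2) * y.im < 2 * κ * (y.re - (1 + κ ^ 2) / 4) ∧
    (1 - κ ^ 2) * y.im < 2 * κ * (1 - (1 + κ ^ 2) / 4 - y.re) ∧
    -y.im < t * y.re ∧ -y.im < t * (1 - y.re)}
  have hN : IsOpen N := by
    have hc1 : Continuous fun y : ℂ => (1 - κ ^ 2) * y.im := by fun_prop
    have hc2 : Continuous fun y : ℂ => 2 * κ * (y.re - (1 + κ ^ 2) / 4) := by fun_prop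
    have hc3 : Continuous fun y : ℂ => 2 * κ * (1 - (1 + κ ^ 2) / 4 - y.re) := by fun_prop
    have hc4 : Continuous fun y : ℂ => -y.im := by fun_prop
    have hc5 : Continuous fun y : ℂ => t * y.re := by fun_prop
    have hc6 : Continuous fun y : ℂ => t * (1 - y.re) := by fun_prop
    exact (isOpen_lt hc1 hc2).inter ((isOpen_lt hc1 hc3).inter ((isOpen_lt hc4 hc5).inter
      (isOpen_lt hc4 hc6)))
  have hxN : x ∈ N := by
    simp only [N, mem_ofPred_eq, hx0]
    refine ⟨?_, ?_, ?_, ?_⟩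
    · have : 0 < 2 * κ * (x.re - (1 + κ ^ 2) / 4) := mul_pos (by positivity) (by linarith)
      linarith
    · have : 0 < 2 * κ * (1 - (1 + κ ^ 2) / 4 - x.re) := mul_pos (by positivity) (by linarith)
      linarith
    · have : 0 < t * x.re := mul_pos ht (by linarith)
      linarith
    · have : 0 < t * (1 - x.re) := mul_pos ht (by linarith)
      linarith
  refine interior_maximal ?_ (h.isOpenMap_cellMap m j w _ hN) (mem_image_of_mem _ hxN)
  rintro _ ⟨y, ⟨y1, y2, y3, y4⟩, rfl⟩
  rw [closedPrefractal_succ]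
  rcases lt_or_ge y.im 0 with hy | hy
  · left
    have := h.cellMap_lowerTriangle_mem hm hj hw (z := y) ⟨hy, y3, y4⟩
    exact interior_subset this
  · right
    refine mem_onSides_iterateSet.2 ⟨j, hj, w, hw, y, ?_, rfl⟩
    rw [h.bump_eq]
    exact ⟨hy, y1.le, y2.le⟩

/-- The two outer pieces of a segment are again segments of the next curve, and the middle piece is
covered from both sides. -/
lemma segment_cell_mem {j : ℕ} (hj : j < m) {n : ℕ} {w : List (Fin 4)} (hw : w.length = n)
    {x : ℂ} (hx : x ∈ segment ℝ (0 : ℂ) 1) : cellMap m α j w x ∈ prefractalCurves m α (n + 1) ∨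
      cellMap m α j w x ∈ interior (closedPrefractal m α (n + 1)) := by
  obtain ⟨hx0, hx1, hx2⟩ := mem_segment_zero_one.1 hx
  have hκ' : 0 < (1 + κ ^ 2) / 4 := by positivity
  rcases le_or_gt x.re ((1 + κ ^ 2) / 4) with h1 | h1
  · left
    refine mem_onSides_iterateSet.2 ⟨j, hj, w ++ [0], by simp [hw],
      (⟨x.re / ((1 + κ ^ 2) / 4), 0⟩ : ℂ), ?_, ?_⟩
    · exact mem_segment_zero_one.2 ⟨rfl, div_nonneg hx1 hκ'.le, (div_le_one hκ').2 h1⟩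
    · rw [cellMap_append]
      congr 1
      obtain ⟨⟨r, i⟩, -⟩ := h.kochMap_re_im ⟨x.re / ((1 + κ ^ 2) / 4), 0⟩
      change kochMap α 0 (⟨x.re / ((1 + κ ^ 2) / 4), 0⟩ : ℂ) = x
      apply Complex.ext
      · rw [r]; field_simp
      · rw [i, hx0]; simp
  rcases le_or_gt (1 - (1 + κ ^ 2) / 4) x.re with h2 | h2
  · left
    refine mem_onSides_iterateSet.2 ⟨j, hj, w ++ [3], by simp [hw],
      (⟨1 - (1 - x.re) / ((1 + κ ^ 2) / 4), 0⟩ : ℂ), ?_, ?_⟩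
    · have a1 : 0 ≤ (1 - x.re) / ((1 + κ ^ 2) / 4) := div_nonneg (by linarith) hκ'.le
      have a2 : (1 - x.re) / ((1 + κ ^ 2) / 4) ≤ 1 := (div_le_one hκ').2 (by linarith)
      refine mem_segment_zero_one.2 ⟨rfl, ?_, ?_⟩ <;> dsimp only <;> linarith
    · rw [cellMap_append]
      congr 1
      obtain ⟨-, -, -, r, i⟩ := h.kochMap_re_im ⟨1 - (1 - x.re) / ((1 + κ ^ 2) / 4), 0⟩
      change kochMap α 3 (⟨1 - (1 - x.re) / ((1 + κ ^ 2) / 4), 0⟩ : ℂ) = x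
      apply Complex.ext
      · rw [r]; field_simp; ring
      · rw [i, hx0]; simp
  · exact Or.inr (h.cellMap_middle_mem hm hj hw hx0 h1 h2)

/-- The base of the bump lies on the old segment, and its other two edges are the images of [0, 1]
under the middle similitudes. -/
lemma bump_frontier_cell_mem {j : ℕ} (hj : j < m) {n : ℕ} {w : List (Fin 4)} (hw : w.length = n)
    {x : ℂ} (hx : x ∈ frontier (bump α)) : cellMap m α j w x ∈ prefractalCurves m α (n + 1) ∨
      cellMap m α j w x ∈ interior (closedPrefractal m α (n + 1)) := by
  have hκ := h.κ_pos
  have hκ2 := h.κ_sq_lt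
  have hκ' : 0 < (1 + κ ^ 2) / 4 := by positivity
  have he : 0 < 1 - κ ^ 2 := by linarith
  have hxb : x ∈ bump α := (isCompact_bump α).isClosed.frontier_subset hx
  have hcases : x.im = 0 ∨ (1 - κ ^ 2) * x.im = 2 * κ * (x.re - (1 + κ ^ 2) / 4) ∨
      (1 - κ ^ 2) * x.im = 2 * κ * (1 - (1 + κ ^ 2) / 4 - x.re) := by
    by_contra! hc
    obtain ⟨c1, c2, c3⟩ := hc
    have hb := hxb
    rw [h.bump_eq] at hb
    obtain ⟨b1, b2, b3⟩ := hb
    refine hx.2 (interior_maximal (s := bump α) (t := {y : ℂ | 0 < y.im ∧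
      (1 - κ ^ 2) * y.im < 2 * κ * (y.re - (1 + κ ^ 2) / 4) ∧
      (1 - κ ^ 2) * y.im < 2 * κ * (1 - (1 + κ ^ 2) / 4 - y.re)}) ?_ ?_ ?_)
    · rw [h.bump_eq]
      rintro y ⟨y1, y2, y3⟩
      exact ⟨y1.le, y2.le, y3.le⟩
    · have hc0 : Continuous fun y : ℂ => y.im := by fun_prop
      have hc1 : Continuous fun y : ℂ => (1 - κ ^ 2) * y.im := by fun_prop
      have hc2 : Continuous fun y : ℂ => 2 * κ * (y.re - (1 + κ ^ 2) / 4) := by fun_prop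
      have hc3 : Continuous fun y : ℂ => 2 * κ * (1 - (1 + κ ^ 2) / 4 - y.re) := by fun_prop
      exact (isOpen_lt continuous_const hc0).inter ((isOpen_lt hc1 hc2).inter (isOpen_lt hc1 hc3))
    · exact ⟨lt_of_le_of_ne b1 c1.symm, lt_of_le_of_ne b2 c2, lt_of_le_of_ne b3 c3⟩
  rw [h.bump_eq] at hxb
  obtain ⟨b1, b2, b3⟩ := hxb
  have him : x.im ≤ κ / 2 := by
    refine le_of_mul_le_mul_left ?_ he
    linarith
  have hs1 : 0 ≤ 2 * x.im / κ := by positivity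
  have hs2 : 2 * x.im / κ ≤ 1 := by rw [div_le_one hκ]; linarith
  have h2κ : 0 < 2 * κ := by positivity
  rcases hcases with h0 | h0 | h0
  · refine h.segment_cell_mem hm hj hw (mem_segment_zero_one.2 ⟨h0, ?_, ?_⟩)
    · rw [h0, mul_zero] at b2
      have := nonneg_of_mul_nonneg_right b2 h2κ
      linarith
    · rw [h0, mul_zero] at b3
      have := nonneg_of_mul_nonneg_right b3 h2κ
      linarith
  · left
    refine mem_onSides_iterateSet.2 ⟨j, hj, w ++ [1], by simp [hw], (⟨2 * x.im / κ, 0⟩ : ℂ),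
      mem_segment_zero_one.2 ⟨rfl, hs1, hs2⟩, ?_⟩
    rw [cellMap_append]
    congr 1
    obtain ⟨-, ⟨r, i⟩, -⟩ := h.kochMap_re_im ⟨2 * x.im / κ, 0⟩
    change kochMap α 1 (⟨2 * x.im / κ, 0⟩ : ℂ) = x
    apply Complex.ext
    · rw [r]
      refine mul_left_cancel₀ h2κ.ne' ?_
      have : (1 - κ ^ 2) * (2 * x.im / κ) * κ = 2 * ((1 - κ ^ 2) * x.im) := by field_simp
      linarith
    · rw [i]; field_simp; ring
  · left
    refine mem_onSides_iterateSet.2 ⟨j, hj, w ++ [2], by simp [hw], (⟨1 - 2 * x.im / κ, 0⟩ : ℂ),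
      mem_segment_zero_one.2 ⟨rfl, by dsimp only; linarith, by dsimp only; linarith⟩, ?_⟩
    rw [cellMap_append]
    congr 1
    obtain ⟨-, -, ⟨r, i⟩, -⟩ := h.kochMap_re_im ⟨1 - 2 * x.im / κ, 0⟩
    change kochMap α 2 (⟨1 - 2 * x.im / κ, 0⟩ : ℂ) = x
    apply Complex.ext
    · rw [r]
      refine mul_left_cancel₀ h2κ.ne' ?_
      have : (1 - κ ^ 2) * (2 * x.im / κ) * κ = 2 * ((1 - κ ^ 2) * x.im) := by field_simp
      linarith
    · rw [i]; field_simp; ring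

lemma frontier_closedPrefractal_subset (n : ℕ) :
    frontier (closedPrefractal m α n) ⊆ prefractalCurves m α n := by
  induction n with
  | zero =>
    have e : closedPrefractal m α 0 = closedPolygon m := by
      ext x; simp [mem_closedPrefractal]
    rw [e]
    refine (frontier_closedPolygon_subset hm).trans ?_
    have e2 : iterateSet α 0 (segment ℝ (0 : ℂ) 1) = segment ℝ 0 1 := by
      simp [iterateSet, wordMap]
    rw [prefractalCurves, e2]
  | succ n ih =>
    intro z hz
    have hznot : z ∉ interior (closedPrefractal m α (n + 1)) := hz.2
    rw [closedPrefractal_succ] at hz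
    rcases frontier_union_subset _ _ hz with ⟨hz1, -⟩ | ⟨-, hz2⟩
    · obtain ⟨j, hj, w, hw, x, hx, rfl⟩ := mem_onSides_iterateSet.1 (ih hz1)
      exact (h.segment_cell_mem hm hj hw hx).resolve_right hznot
    · have hclosed := (h.isCompact_onSides_iterateSet (m := m) n (isCompact_bump α)).isClosed
      have hmem := hclosed.frontier_subset hz2
      obtain ⟨j, hj, w, hw, x, hx, rfl⟩ := mem_onSides_iterateSet.1 hmem
      refine (h.bump_frontier_cell_mem hm hj hw ⟨subset_closure hx, fun hint => ?_⟩).resolve_right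
        hznot
      refine hz2.2 (interior_maximal ?_ (h.isOpenMap_cellMap m j w _ isOpen_interior)
        (mem_image_of_mem _ hint))
      rintro _ ⟨y, hy, rfl⟩
      exact mem_onSides_iterateSet.2 ⟨j, hj, w, hw, y, interior_subset hy, rfl⟩

lemma frontier_prefractalDomain_subset (n : ℕ) :
    frontier (prefractalDomain m α n) ⊆ prefractalCurves m α n :=
  frontier_interior_subset.trans (h.frontier_closedPrefractal_subset hm n)

/-- Arbitrarily close to each point of the curve there are points of the open upper triangle of its
cell, which the pre-fractal set does not meet. -/
lemma prefractalCurves_disjoint (n : ℕ) {x : ℂ} (hx : x ∈ prefractalCurves m α n) :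
    x ∉ prefractalDomain m α n := by
  obtain ⟨j, hj, w, hw, z, hz, rfl⟩ := mem_onSides_iterateSet.1 hx
  obtain ⟨z0, z1, z2⟩ := mem_segment_zero_one.1 hz
  have hκ := h.κ_pos
  intro hmem
  -- The point 1/2 + iκ/4 is an interior point of the upper triangle.
  have hc : Continuous fun ε : ℝ => cellMap m α j w ((1 - ε : ℝ) * z + ε * ⟨1 / 2, κ / 4⟩) :=
    (h.continuous_cellMap m j w).comp (by fun_prop)
  have h0 : cellMap m α j w ((1 - (0 : ℝ) : ℝ) * z + (0 : ℝ) * ⟨1 / 2, κ / 4⟩) =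
      cellMap m α j w z := by simp
  have h1 : ∀ᶠ ε : ℝ in 𝓝[>] 0,
      cellMap m α j w ((1 - ε : ℝ) * z + ε * ⟨1 / 2, κ / 4⟩) ∈ prefractalDomain m α n := by
    refine (hc.tendsto 0).eventually_mem ?_ |>.filter_mono nhdsWithin_le_nhds
    rw [h0]
    exact isOpen_interior.mem_nhds hmem
  have h2 : ∀ᶠ ε : ℝ in 𝓝[>] 0, ε < 1 :=
    (eventually_lt_nhds (show (0 : ℝ) < 1 by norm_num)).filter_mono nhdsWithin_le_nhds
  obtain ⟨ε, hε, hε1, hε0⟩ := (h1.and (h2.and self_mem_nhdsWithin)).exists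
  have hε0' : 0 < ε := hε0
  refine h.cellMap_upperTriangleInt_notMem hm hj hw (z := (1 - ε : ℝ) * z + ε * (⟨1 / 2, κ / 4⟩ : ℂ)) ?_
    (interior_subset (s := closedPrefractal m α n) hε)
  have e1 : ((1 - ε : ℝ) * z + ε * (⟨1 / 2, κ / 4⟩ : ℂ)).re = (1 - ε) * z.re + ε * (1 / 2) := by
    simp only [Complex.add_re, Complex.re_ofReal_mul]
  have e2 : ((1 - ε : ℝ) * z + ε * (⟨1 / 2, κ / 4⟩ : ℂ)).im = ε * (κ / 4) := by
    simp only [Complex.add_im, Complex.im_ofReal_mul, z0, mul_zero, zero_add]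
  have a1 : 0 ≤ (1 - ε) * z.re := mul_nonneg (by linarith) z1
  have a2 : 0 ≤ (1 - ε) * (1 - z.re) := mul_nonneg (by linarith) (by linarith)
  have a3 : 0 < ε * κ := by positivity
  have a4 := mul_nonneg hκ.le a1
  have a5 := mul_nonneg hκ.le a2
  refine ⟨?_, ?_, ?_⟩
  · rw [e2]; positivity
  · rw [e1, e2]; linarith
  · rw [e1, e2]; linarith

/-- The points of the inner triangles on a line perpendicular to the base accumulate at the base. -/
lemma segment_cell_mem_frontier {j : ℕ} (hj : j < m) {n : ℕ} {w : List (Fin 4)}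
    (hw : w.length = n) {z : ℂ} (hz : z ∈ lowerTriangle t) :
    cellMap m α j w z.re ∈ frontier (prefractalDomain m α n) := by
  obtain ⟨z1, z2, z3⟩ := hz
  have ht := h.t_pos
  have hseg : (z.re : ℂ) ∈ segment ℝ (0 : ℂ) 1 := by
    refine mem_segment_zero_one.2 ⟨by simp, ?_, ?_⟩
    · rw [Complex.ofReal_re]; by_contra! hc; nlinarith
    · rw [Complex.ofReal_re]; by_contra! hc; nlinarith
  refine ⟨?_, ?_⟩
  · have hc : Continuous fun ε : ℝ => cellMap m α j w ⟨z.re, ε * z.im⟩ := by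
      have e : ∀ ε : ℝ, (⟨z.re, ε * z.im⟩ : ℂ) = z.re + ε * (z.im * Complex.I) := by
        intro ε; apply Complex.ext <;> simp
      simp only [e]
      exact (h.continuous_cellMap m j w).comp (by fun_prop)
    have h0 : cellMap m α j w ⟨z.re, 0 * z.im⟩ = cellMap m α j w z.re := by
      congr 1; apply Complex.ext <;> simp
    have h1 : Tendsto (fun ε : ℝ => cellMap m α j w ⟨z.re, ε * z.im⟩) (𝓝[>] 0)
        (𝓝 (cellMap m α j w z.re)) := by
      rw [← h0]
      exact (hc.tendsto 0).mono_left nhdsWithin_le_nhds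
    refine mem_closure_of_tendsto h1 ?_
    have h2 : ∀ᶠ ε : ℝ in 𝓝[>] 0, ε < 1 :=
      (eventually_lt_nhds (show (0 : ℝ) < 1 by norm_num)).filter_mono nhdsWithin_le_nhds
    filter_upwards [h2, self_mem_nhdsWithin] with ε hε1 hε0
    have hε0' : 0 < ε := hε0
    have a1 := mul_pos hε0' (neg_pos.2 z1)
    refine h.cellMap_lowerTriangle_mem hm hj hw ⟨?_, ?_, ?_⟩ <;> dsimp only
    · linarith
    · nlinarith
    · nlinarith
  · rw [prefractalDomain_eq, interior_interior]
    exact h.prefractalCurves_disjoint hm n (mem_onSides_iterateSet.2 ⟨j, hj, w, hw, _, hseg, rfl⟩)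

/-- The vertices of the pre-fractal curves do not belong to the limit domain. -/
lemma vertex_notMem_fractalDomain {j : ℕ} (hj : j < m) (w : List (Fin 4)) :
    cellMap m α j w 0 ∉ fractalDomain m α ∧ cellMap m α j w 1 ∉ fractalDomain m α := by
  -- Since 0 and 1 are fixed by the outer similitudes, padding a word with the letter 0 or 3 shows
  -- that a vertex belongs to every later curve.
  have z0 : ∀ k, wordMap α (List.replicate k 0) 0 = 0 := by
    intro k
    induction k with
    | zero => rfl
    | succ k ih =>
      rw [List.replicate_succ]
      change kochMap α 0 (wordMap α _ 0) = 0
      rw [ih, h.kochMap_zero_zero]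
  have z1 : ∀ k, wordMap α (List.replicate k 3) 1 = 1 := by
    intro k
    induction k with
    | zero => rfl
    | succ k ih =>
      rw [List.replicate_succ]
      change kochMap α 3 (wordMap α _ 1) = 1
      rw [ih, h.kochMap_three_one]
  constructor
  · intro hmem
    obtain ⟨n, hn⟩ := mem_iUnion.1 hmem
    refine h.prefractalCurves_disjoint hm (w.length + n) ?_
      (prefractalDomain_mono m α (Nat.le_add_left n w.length) hn)
    refine mem_onSides_iterateSet.2 ⟨j, hj, w ++ List.replicate n 0, by simp, 0,
      left_mem_segment ℝ 0 1, ?_⟩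
    rw [cellMap_append, z0]
  · intro hmem
    obtain ⟨n, hn⟩ := mem_iUnion.1 hmem
    refine h.prefractalCurves_disjoint hm (w.length + n) ?_
      (prefractalDomain_mono m α (Nat.le_add_left n w.length) hn)
    refine mem_onSides_iterateSet.2 ⟨j, hj, w ++ List.replicate n 3, by simp, 1,
      right_mem_segment ℝ 0 1, ?_⟩
    rw [cellMap_append, z1]

end KochParam

/-! ### The orthogonal projection on the pre-fractal curve -/

lemma mem_openKite_ofReal {t : ℝ} (ht : 0 < t) {z : ℂ} (hz : z ∈ lowerTriangle t) :
    0 < z.re ∧ z.re < 1 ∧ (z.re : ℂ) ∈ openKite t := by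
  obtain ⟨z1, z2, z3⟩ := hz
  have h0 : 0 < z.re := by
    by_contra! hc
    nlinarith
  have h1 : z.re < 1 := by
    by_contra! hc
    nlinarith
  refine ⟨h0, h1, ?_, ?_⟩
  · simpa using mul_pos ht h0
  · simpa using mul_pos ht (sub_pos.2 h1)

/-- A disc about a point of the lower triangle which touches the base lies in the triangle with the
double base angles, except for the point of contact. -/
lemma mem_doubleTriangle_of_norm_sub_le {t : ℝ} (ht : 0 < t) {z y : ℂ}
    (hz : z ∈ lowerTriangle t) (hy : ‖y - z‖ ≤ |z.im|) (hne : y ≠ z.re) :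
    y ∈ doubleTriangle t := by
  obtain ⟨z1, z2, z3⟩ := hz
  have hs : (y.re - z.re) ^ 2 + (y.im - z.im) ^ 2 ≤ z.im ^ 2 := by
    have h1 : ‖y - z‖ ^ 2 ≤ |z.im| ^ 2 := by gcongr
    rw [Complex.sq_norm, Complex.normSq_apply, sq_abs, Complex.sub_re, Complex.sub_im] at h1
    nlinarith
  have h2 : |y.im - z.im| ≤ -z.im := by
    rw [← abs_of_neg z1]
    exact (Complex.abs_im_le_norm (y - z)).trans hy
  have hy0 : y.im < 0 := by
    refine lt_of_le_of_ne (by linarith [(abs_le.1 h2).2]) fun h0 => hne ?_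
    rw [h0] at hs
    have : (y.re - z.re) ^ 2 = 0 := le_antisymm (by nlinarith) (sq_nonneg _)
    apply Complex.ext
    · rw [Complex.ofReal_re]
      linarith [pow_eq_zero_iff (two_ne_zero) |>.1 this]
    · rw [Complex.ofReal_im, h0]
  -- This is Cauchy–Schwarz with the normal (2t, 1 - t²), of length 1 + t². Geometrically, a slanted
  -- side of the lower triangle bisects the angle between the base and the doubled side, so z is
  -- closer to the base than to the doubled side.
  have key : ∀ u v s : ℝ, 0 ≤ s → u ^ 2 + v ^ 2 ≤ s ^ 2 →
      -((1 - t ^ 2) * v) - 2 * t * u ≤ (1 + t ^ 2) * s := by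
    intro u v s hs0 huv
    refine (le_abs_self _).trans (abs_le_of_sq_le_sq ?_ (by positivity))
    nlinarith [sq_nonneg ((1 - t ^ 2) * u - 2 * t * v), sq_nonneg (1 + t ^ 2),
      mul_le_mul_of_nonneg_left huv (sq_nonneg (1 + t ^ 2))]
  have k1 := key (y.re - z.re) (y.im - z.im) (-z.im) (by linarith) (by linarith)
  have k2 := key (-(y.re - z.re)) (y.im - z.im) (-z.im) (by linarith) (by linarith)
  exact ⟨hy0, by linarith, by linarith⟩

lemma l1Norm_ofReal_mul {s : ℝ} (hs : 0 ≤ s) (z : ℂ) : l1Norm (s * z) = s * l1Norm z := by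
  simp [l1Norm, abs_mul, abs_of_nonneg hs, mul_add]

lemma l1Norm_ne_zero {z : ℂ} (hz : z ≠ 0) : l1Norm z ≠ 0 := by
  intro h0
  have h1 := abs_nonneg z.re
  have h2 := abs_nonneg z.im
  unfold l1Norm at h0
  exact hz (Complex.ext (abs_eq_zero.1 (by linarith)) (abs_eq_zero.1 (by linarith)))

namespace KochParam

variable {α η κ t : ℝ} (h : KochParam α η κ t) {m : ℕ} (hm : 3 ≤ m)
include h

lemma dist_cellMap (m j : ℕ) (w : List (Fin 4)) (y z : ℂ) :
    dist (cellMap m α j w y) (cellMap m α j w z) = ((1 + κ ^ 2) / 4) ^ w.length * ‖y - z‖ := by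
  obtain ⟨a, b, -, ha, hab⟩ := h.exists_cellMap_affine m j w
  rw [hab, hab, dist_eq_norm, ← ha, ← norm_mul]
  congr 1
  ring

lemma cellMap_surjective (m j : ℕ) (w : List (Fin 4)) : Function.Surjective (cellMap m α j w) := by
  obtain ⟨a, b, ha, -, hab⟩ := h.exists_cellMap_affine m j w
  intro y
  exact ⟨(y - b) / a, by rw [hab]; field_simp; ring⟩

lemma innerFiber_eq (m n : ℕ) : innerFiber m α η n = onSides m (iterateSet α n (lowerTriangle t)) := by
  rw [innerFiber, innerTriangle_eq h.t_pos h.t_eq]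

lemma isOpen_innerFiber (m n : ℕ) : IsOpen (innerFiber m α η n) := by
  rw [h.innerFiber_eq]
  exact h.isOpen_onSides_iterateSet n (isOpen_lowerTriangle t)

include hm

lemma doubleTriangle_cell_notMem {j : ℕ} (hj : j < m) (w : List (Fin 4)) {z : ℂ}
    (hz : z ∈ doubleTriangle t) : cellMap m α j w z ∉ prefractalCurves m α w.length := by
  intro hmem
  obtain ⟨j', hj', w', hw', z', hz', heq⟩ := mem_onSides_iterateSet.1 hmem
  by_cases hc : (j, w) = (j', w')
  · obtain ⟨rfl, rfl⟩ := Prod.mk.injEq .. ▸ hc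
    have := h.cellMap_injective m j w heq
    rw [this] at hz'
    exact hz.1.ne (mem_segment_zero_one.1 hz').1
  · exact h.cellMap_ne hm (isOpen_doubleTriangle t) h.doubleTriangle_subset_invariantKite hz
      (h.segment_subset_upperTriangle hz') hj hj' hw'.symm hc heq.symm

/-- A different boundary point at no greater distance would lie in the doubled triangle, which
contains no point of the curve. The nearest point is thus unique, and the choice in `projOn` is
forced. -/
lemma footPoint_cellMap {j : ℕ} (hj : j < m) {n : ℕ} {w : List (Fin 4)} (hw : w.length = n) {z : ℂ}
    (hz : z ∈ lowerTriangle t) : footPoint m α n (cellMap m α j w z) = cellMap m α j w z.re := by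
  subst hw
  have hfr := h.segment_cell_mem_frontier hm hj (w := w) rfl hz
  have hnorm : ‖(z.re : ℂ) - z‖ = |z.im| := by
    have : (z.re : ℂ) - z = -(z.im * Complex.I) := by
      apply Complex.ext <;> simp
    rw [this]; simp
  have huniq : ∀ y ∈ frontier (prefractalDomain m α w.length),
      dist (cellMap m α j w z) y ≤ dist (cellMap m α j w z) (cellMap m α j w z.re) →
      y = cellMap m α j w z.re := by
    intro y hy hd
    obtain ⟨y, rfl⟩ := h.cellMap_surjective m j w y
    have hρ : 0 < ((1 + κ ^ 2) / 4) ^ w.length := by positivity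
    rw [h.dist_cellMap, h.dist_cellMap, norm_sub_rev z, norm_sub_rev z, hnorm] at hd
    by_contra hne
    exact h.doubleTriangle_cell_notMem hm hj w
      (mem_doubleTriangle_of_norm_sub_le h.t_pos hz (le_of_mul_le_mul_left hd hρ)
        fun he => hne (by rw [he])) (h.frontier_prefractalDomain_subset hm _ hy)
  have hinf : dist (cellMap m α j w z) (cellMap m α j w z.re) =
      Metric.infDist (cellMap m α j w z) (frontier (prefractalDomain m α w.length)) := by
    refine le_antisymm ?_ (Metric.infDist_le_dist_of_mem hfr)
    by_contra! hc
    obtain ⟨y, hy, hd⟩ := (Metric.infDist_lt_iff ⟨_, hfr⟩).1 hc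
    rw [huniq y hy hd.le] at hd
    exact lt_irrefl _ hd
  obtain ⟨h1, h2⟩ := Classical.epsilon_spec (p := fun y =>
    y ∈ frontier (prefractalDomain m α w.length) ∧
      dist (cellMap m α j w z) y =
        Metric.infDist (cellMap m α j w z) (frontier (prefractalDomain m α w.length)))
    ⟨_, hfr, hinf⟩
  exact huniq _ h1 (h2.trans hinf.symm).le

/-- The open set condition only compares with upper triangles. A common point of two inner triangles
has one foot, and this would lie both in the open kite of one cell and on the segment of the other.
-/
lemma eq_of_cellMap_lowerTriangle_eq {j j' : ℕ} (hj : j < m) (hj' : j' < m) {w w' : List (Fin 4)}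
    (hlen : w.length = w'.length) {z z' : ℂ} (hz : z ∈ lowerTriangle t) (hz' : z' ∈ lowerTriangle t)
    (heq : cellMap m α j w z = cellMap m α j' w' z') : (j, w) = (j', w') := by
  by_contra hne
  have h1 := h.footPoint_cellMap hm hj hlen hz
  have h2 := h.footPoint_cellMap hm hj' (w := w') rfl hz'
  rw [heq, h2] at h1
  obtain ⟨-, -, hk⟩ := mem_openKite_ofReal h.t_pos hz
  obtain ⟨a1, a2, -⟩ := mem_openKite_ofReal h.t_pos hz'
  exact h.cellMap_ne hm (isOpen_openKite t) h.openKite_subset_invariantKite hk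
    (h.segment_subset_upperTriangle (mem_segment_zero_one.2
      ⟨Complex.ofReal_im _, a1.le, a2.le⟩)) hj hj' hlen hne h1.symm

lemma innerPoint_cellMap {j : ℕ} (hj : j < m) {n : ℕ} {w : List (Fin 4)} (hw : w.length = n) {z : ℂ}
    (hz : z ∈ lowerTriangle t) :
    innerPoint m α η n (cellMap m α j w z) = cellMap m α j w z.re +
      (t * min z.re (1 - z.re) / |z.im| : ℝ) * (cellMap m α j w z - cellMap m α j w z.re) := by
  subst hw
  have ht := h.t_pos
  obtain ⟨a0, a1, -⟩ := mem_openKite_ofReal ht hz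
  obtain ⟨b0, b1, b2⟩ := hz
  have hmin : 0 < min z.re (1 - z.re) := lt_min a0 (by linarith)
  -- This is the parameter at which the ray leaves the triangle: its depth below the abscissa re z
  -- is t · min(re z, 1 - re z).
  set τ := t * min z.re (1 - z.re) / |z.im| with hτ
  have hτ0 : 0 < τ := div_pos (mul_pos ht hmin) (abs_pos.2 b0.ne)
  have hτb : τ * -z.im = t * min z.re (1 - z.re) := by
    have := b0.ne
    rw [hτ, abs_of_neg b0]; field_simp
  have hline : ∀ s : ℝ, cellMap m α j w z.re + s * (cellMap m α j w z - cellMap m α j w z.re) =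
      cellMap m α j w ⟨z.re, s * z.im⟩ := by
    intro s
    obtain ⟨a, b, -, -, hab⟩ := h.exists_cellMap_affine m j w
    rw [hab, hab, hab]
    have : (⟨z.re, s * z.im⟩ : ℂ) = z.re + s * (z - z.re) := by
      apply Complex.ext <;> simp
    rw [this]; ring
  have hT : ∀ s : ℝ, 0 < s → s < τ → (⟨z.re, s * z.im⟩ : ℂ) ∈ lowerTriangle t := by
    intro s hs0 hsτ
    have h1 : s * -z.im < t * min z.re (1 - z.re) := by
      rw [← hτb]; exact mul_lt_mul_of_pos_right hsτ (by linarith)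
    refine ⟨mul_neg_of_pos_of_neg hs0 b0, ?_, ?_⟩
    · have := mul_le_mul_of_nonneg_left (min_le_left z.re (1 - z.re)) ht.le
      dsimp only; linarith
    · have := mul_le_mul_of_nonneg_left (min_le_right z.re (1 - z.re)) ht.le
      dsimp only; linarith
  have hmem : ∀ s : ℝ, 0 < s → s < τ →
      cellMap m α j w ⟨z.re, s * z.im⟩ ∈ innerFiber m α η w.length := by
    intro s hs0 hsτ
    rw [h.innerFiber_eq]
    exact mem_onSides_iterateSet.2 ⟨j, hj, w, rfl, _, hT s hs0 hsτ, rfl⟩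
  have hcont : Tendsto (fun s : ℝ => cellMap m α j w ⟨z.re, s * z.im⟩) (𝓝[<] τ)
      (𝓝 (cellMap m α j w ⟨z.re, τ * z.im⟩)) := by
    have : Continuous fun s : ℝ => cellMap m α j w (z.re + (s * z.im : ℝ) * Complex.I) :=
      (h.continuous_cellMap m j w).comp (by fun_prop)
    have := (this.tendsto τ).mono_left (nhdsWithin_le_nhds (s := Iio τ))
    simpa only [Complex.mk_eq_add_mul_I] using this
  have hev : ∀ᶠ s : ℝ in 𝓝[<] τ, 0 < s ∧ s < τ :=
    ((eventually_gt_nhds hτ0).filter_mono nhdsWithin_le_nhds).and self_mem_nhdsWithin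
  have hleast : IsLeast {s : ℝ | 0 < s ∧
      cellMap m α j w z.re + s * (cellMap m α j w z - cellMap m α j w z.re) ∈
        frontier (innerFiber m α η w.length) \ prefractalCurves m α w.length} τ := by
    refine ⟨⟨hτ0, ?_, ?_⟩, ?_⟩
    · rw [hline, (h.isOpen_innerFiber m _).frontier_eq]
      refine ⟨mem_closure_of_tendsto hcont (hev.mono fun s hs => hmem s hs.1 hs.2), ?_⟩
      rw [h.innerFiber_eq]
      intro hin
      -- An inner triangle that contained the end point would, being open, contain nearby points of
      -- the ray, hence be the triangle of the same cell. The end point lies on the boundary of that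
      -- one.
      obtain ⟨j', hj', w', hw', z', hz', heq⟩ := mem_onSides_iterateSet.1 hin
      have hnear : ∀ᶠ s : ℝ in 𝓝[<] τ,
          cellMap m α j w ⟨z.re, s * z.im⟩ ∈ cellMap m α j' w' '' lowerTriangle t :=
        hcont.eventually_mem ((h.isOpenMap_cellMap m j' w' _ (isOpen_lowerTriangle t)).mem_nhds
          ⟨z', hz', heq⟩)
      obtain ⟨s, ⟨z'', hz'', heq'⟩, hs0, hsτ⟩ := (hnear.and hev).exists
      have hjw := h.eq_of_cellMap_lowerTriangle_eq hm hj hj' hw'.symm (hT s hs0 hsτ) hz'' heq'.symm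
      obtain ⟨rfl, rfl⟩ := Prod.mk.injEq .. ▸ hjw
      have := h.cellMap_injective m j w heq
      rw [this] at hz'
      obtain ⟨-, c1, c2⟩ := hz'
      dsimp only at c1 c2
      rw [← mul_neg, hτb] at c1 c2
      rcases min_choice z.re (1 - z.re) with hmc | hmc <;> rw [hmc] at c1 c2
      · exact lt_irrefl _ c1
      · exact lt_irrefl _ c2
    · rw [hline]
      -- The end point lies on a slanted side of the inner triangle, hence still inside the doubled
      -- one.
      refine h.doubleTriangle_cell_notMem hm hj w ⟨mul_neg_of_pos_of_neg hτ0 b0, ?_, ?_⟩ <;>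
        dsimp only <;> rw [← mul_neg, hτb]
      · have := mul_le_mul_of_nonneg_left (min_le_left z.re (1 - z.re)) ht.le
        nlinarith [mul_pos ht hmin, mul_pos ht a0, sq_nonneg t]
      · have := mul_le_mul_of_nonneg_left (min_le_right z.re (1 - z.re)) ht.le
        nlinarith [mul_pos ht hmin, mul_pos ht (sub_pos.2 a1), sq_nonneg t]
    · rintro s ⟨hs0, hs⟩
      by_contra! hsτ
      rw [hline, (h.isOpen_innerFiber m _).frontier_eq] at hs
      exact hs.1.2 (hmem s hs0 hsτ)
  unfold innerPoint
  rw [h.footPoint_cellMap hm hj (w := w) rfl ⟨b0, b1, b2⟩]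
  dsimp only
  rw [hleast.csInf_eq]

/-- The three points are collinear, so the quotient of norms is the reciprocal of the ray parameter,
although the norm |x₁| + |x₂| is not invariant under the rotation of the cell. -/
lemma coeff_cellMap {j : ℕ} (hj : j < m) {n : ℕ} {w : List (Fin 4)} (hw : w.length = n) {z : ℂ}
    (hz : z ∈ lowerTriangle t) :
    coeff m α η n (cellMap m α j w z) = |z.im| / (t * min z.re (1 - z.re)) := by
  have hin : cellMap m α j w z ∈ innerFiber m α η n := by
    rw [h.innerFiber_eq]
    exact mem_onSides_iterateSet.2 ⟨j, hj, w, hw, z, hz, rfl⟩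
  obtain ⟨a0, a1, -⟩ := mem_openKite_ofReal h.t_pos hz
  have hmin : 0 < min z.re (1 - z.re) := lt_min a0 (by linarith)
  have hb := hz.1
  have hτ0 : 0 < t * min z.re (1 - z.re) / |z.im| :=
    div_pos (mul_pos h.t_pos hmin) (abs_pos.2 hb.ne)
  rw [coeff, if_pos hin, h.innerPoint_cellMap hm hj hw hz, h.footPoint_cellMap hm hj hw hz]
  have e : cellMap m α j w z.re - (cellMap m α j w z.re +
      (t * min z.re (1 - z.re) / |z.im| : ℝ) * (cellMap m α j w z - cellMap m α j w z.re)) =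
      (t * min z.re (1 - z.re) / |z.im| : ℝ) * (cellMap m α j w z.re - cellMap m α j w z) := by ring
  have hne : cellMap m α j w z.re - cellMap m α j w z ≠ 0 := by
    refine sub_ne_zero.2 fun hc => hb.ne ?_
    rw [← h.cellMap_injective m j w hc, Complex.ofReal_im]
  rw [e, l1Norm_ofReal_mul hτ0.le, div_mul_cancel_right₀ (l1Norm_ne_zero hne), inv_div]

end KochParam

/-! ### Continuous extensions of the coefficient functions across the curves -/

/-- A function on the plane with values in `[0, 1]` which vanishes outside `openKite t`, is equal to
one on the open segment from `0` to `1`, and is singular only at `0` and `1`. -/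
noncomputable def kiteFun (t : ℝ) (z : ℂ) : ℝ :=
  max 0 (t * min z.re (1 - z.re) - |z.im|) / max (t * min |z.re| |1 - z.re|) |z.im|

section kiteFun

variable {t : ℝ}

lemma kiteFun_den_nonneg (z : ℂ) : 0 ≤ max (t * min |z.re| |1 - z.re|) |z.im| :=
  (abs_nonneg _).trans (le_max_right _ _)

lemma kiteFun_num_le_den (ht : 0 < t) (z : ℂ) : max 0 (t * min z.re (1 - z.re) - |z.im|) ≤
    max (t * min |z.re| |1 - z.re|) |z.im| := by
  refine max_le (kiteFun_den_nonneg z) (le_trans ?_ (le_max_left _ _))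
  have : min z.re (1 - z.re) ≤ min |z.re| |1 - z.re| := min_le_min (le_abs_self _) (le_abs_self _)
  have := mul_le_mul_of_nonneg_left this ht.le
  linarith [abs_nonneg z.im]

lemma kiteFun_nonneg (t : ℝ) (z : ℂ) : 0 ≤ kiteFun t z :=
  div_nonneg (le_max_left _ _) (kiteFun_den_nonneg z)

lemma kiteFun_le_one (ht : 0 < t) (z : ℂ) : kiteFun t z ≤ 1 :=
  div_le_one_of_le₀ (kiteFun_num_le_den ht z) (kiteFun_den_nonneg z)

/-- The identity also holds where the denominator vanishes, since the numerator lies between zero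
and the denominator. -/
lemma kiteFun_mul_den (ht : 0 < t) (z : ℂ) :
    kiteFun t z * max (t * min |z.re| |1 - z.re|) |z.im| =
      max 0 (t * min z.re (1 - z.re) - |z.im|) := by
  rcases (kiteFun_den_nonneg (t := t) z).eq_or_lt with h0 | h0
  · have h1 := kiteFun_num_le_den ht z
    rw [← h0] at h1
    rw [← h0, mul_zero]
    exact le_antisymm (le_max_left _ _) h1
  · exact div_mul_cancel₀ _ h0.ne'

lemma mem_openKite_of_kiteFun_ne_zero (ht : 0 < t) {z : ℂ} (hz : kiteFun t z ≠ 0) :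
    z ∈ openKite t := by
  by_contra hn
  refine hz ?_
  have : t * min z.re (1 - z.re) - |z.im| ≤ 0 := by
    by_contra! hc
    refine hn ⟨?_, ?_⟩
    · have := mul_le_mul_of_nonneg_left (min_le_left z.re (1 - z.re)) ht.le
      linarith
    · have := mul_le_mul_of_nonneg_left (min_le_right z.re (1 - z.re)) ht.le
      linarith
  rw [kiteFun, max_eq_left this, zero_div]

lemma one_sub_kiteFun_of_mem (ht : 0 < t) {z : ℂ} (hz : z ∈ lowerTriangle t) :
    1 - kiteFun t z = |z.im| / (t * min z.re (1 - z.re)) := by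
  obtain ⟨a0, a1, -⟩ := mem_openKite_ofReal ht hz
  obtain ⟨b0, b1, b2⟩ := hz
  have hmin : 0 < min z.re (1 - z.re) := lt_min a0 (by linarith)
  have hlt : |z.im| < t * min z.re (1 - z.re) := by
    rw [abs_of_neg b0]
    rcases min_choice z.re (1 - z.re) with h | h <;> rw [h] <;> assumption
  rw [kiteFun, max_eq_right (by linarith), abs_of_pos a0, abs_of_pos (sub_pos.2 a1),
    max_eq_left hlt.le, sub_div, div_self (mul_pos ht hmin).ne']
  ring

lemma kiteFun_of_mem_Ioo (ht : 0 < t) {z : ℂ} (h0 : z.im = 0) (h1 : 0 < z.re) (h2 : z.re < 1) :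
    kiteFun t z = 1 := by
  have hmin : 0 < t * min z.re (1 - z.re) := mul_pos ht (lt_min h1 (by linarith))
  rw [kiteFun, h0, abs_zero, sub_zero, abs_of_pos h1, abs_of_pos (sub_pos.2 h2),
    max_eq_right hmin.le, max_eq_left hmin.le, div_self hmin.ne']

lemma measurable_kiteFun (t : ℝ) : Measurable (kiteFun t) := by
  have h1 : Continuous fun z : ℂ => max 0 (t * min z.re (1 - z.re) - |z.im|) := by fun_prop
  have h2 : Continuous fun z : ℂ => max (t * min |z.re| |1 - z.re|) |z.im| := by fun_prop
  exact h1.measurable.div h2.measurable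

lemma norm_le_kiteFun_den (ht : 0 < t) (z : ℂ) :
    min ‖z‖ ‖z - 1‖ ≤ (1 + t) / t * max (t * min |z.re| |1 - z.re|) |z.im| := by
  have key : min ‖z‖ ‖z - 1‖ ≤ min |z.re| |1 - z.re| + |z.im| := by
    rw [min_add]
    refine min_le_min (Complex.norm_le_abs_re_add_abs_im z) ?_
    have := Complex.norm_le_abs_re_add_abs_im (z - 1)
    simpa [abs_sub_comm] using this
  have h1 := le_max_left (t * min |z.re| |1 - z.re|) |z.im|
  have h2 := le_max_right (t * min |z.re| |1 - z.re|) |z.im|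
  refine key.trans ?_
  rw [div_mul_eq_mul_div, le_div_iff₀ ht]
  nlinarith

/-- With f = N/D, the identity (f - f')D = (N - N') - f'(D - D') and 0 ≤ f' ≤ 1 require only the
denominator at z. Hence z' is arbitrary, and D is comparable from below with the distance from z to
{0, 1}. -/
lemma abs_kiteFun_sub_le (ht : 0 < t) {z : ℂ} (h0 : z ≠ 0) (h1 : z ≠ 1) (z' : ℂ) :
    |kiteFun t z - kiteFun t z'| ≤ 2 * (1 + t) ^ 2 / t * ‖z - z'‖ / min ‖z‖ ‖z - 1‖ := by
  set D := max (t * min |z.re| |1 - z.re|) |z.im| with hD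
  set D' := max (t * min |z'.re| |1 - z'.re|) |z'.im| with hD'
  set N := max 0 (t * min z.re (1 - z.re) - |z.im|) with hN
  set N' := max 0 (t * min z'.re (1 - z'.re) - |z'.im|) with hN'
  have hre : |z.re - z'.re| ≤ ‖z - z'‖ := Complex.abs_re_le_norm (z - z')
  have him : |z.im - z'.im| ≤ ‖z - z'‖ := Complex.abs_im_le_norm (z - z')
  have him' : |(|z.im| - |z'.im|)| ≤ ‖z - z'‖ := (abs_abs_sub_abs_le_abs_sub _ _).trans him
  have hre' : |(1 - z.re) - (1 - z'.re)| ≤ ‖z - z'‖ := by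
    rw [sub_sub_sub_cancel_left, abs_sub_comm]; exact hre
  have hmin1 : |min z.re (1 - z.re) - min z'.re (1 - z'.re)| ≤ ‖z - z'‖ :=
    (abs_min_sub_min_le_max _ _ _ _).trans (max_le hre hre')
  have hmin2 : |(min |z.re| |1 - z.re|) - (min |z'.re| |1 - z'.re|)| ≤ ‖z - z'‖ :=
    (abs_min_sub_min_le_max _ _ _ _).trans (max_le ((abs_abs_sub_abs_le_abs_sub _ _).trans hre)
      ((abs_abs_sub_abs_le_abs_sub _ _).trans hre'))
  have hNN : |N' - N| ≤ (1 + t) * ‖z - z'‖ := by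
    rw [abs_sub_comm, hN, hN', max_comm 0, max_comm 0]
    refine (abs_max_sub_max_le_abs _ _ _).trans ?_
    have e : t * min z.re (1 - z.re) - |z.im| - (t * min z'.re (1 - z'.re) - |z'.im|) =
        t * (min z.re (1 - z.re) - min z'.re (1 - z'.re)) - (|z.im| - |z'.im|) := by ring
    rw [e]
    refine (abs_sub _ _).trans ?_
    rw [abs_mul, abs_of_pos ht]
    nlinarith
  have hDD : |D - D'| ≤ (1 + t) * ‖z - z'‖ := by
    refine (abs_max_sub_max_le_max _ _ _ _).trans (max_le ?_ ?_)
    · rw [← mul_sub, abs_mul, abs_of_pos ht]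
      nlinarith [norm_nonneg (z - z')]
    · nlinarith [norm_nonneg (z - z')]
  have hM : 0 < min ‖z‖ ‖z - 1‖ := lt_min (norm_pos_iff.2 h0) (norm_pos_iff.2 (sub_ne_zero.2 h1))
  have hle := norm_le_kiteFun_den ht z
  rw [← hD, div_mul_eq_mul_div, le_div_iff₀ ht] at hle
  have e1 : kiteFun t z * D = N := kiteFun_mul_den ht z
  have e2 : kiteFun t z' * D' = N' := kiteFun_mul_den ht z'
  have hD0 : 0 < D := by
    by_contra! hc
    nlinarith [mul_pos hM ht]
  have hprod : |kiteFun t z - kiteFun t z'| * D ≤ 2 * (1 + t) * ‖z - z'‖ := by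
    rw [← abs_of_pos hD0, ← abs_mul]
    have e : (kiteFun t z - kiteFun t z') * D = -(N' - N) - kiteFun t z' * (D - D') := by
      rw [← e1, ← e2]; ring
    rw [e]
    refine (abs_sub _ _).trans ?_
    rw [abs_neg, abs_mul, abs_of_nonneg (kiteFun_nonneg t z')]
    nlinarith [abs_nonneg (D - D'), kiteFun_le_one ht z', kiteFun_nonneg t z']
  rw [le_div_iff₀ hM, div_mul_eq_mul_div, le_div_iff₀ ht]
  have h3 := mul_le_mul_of_nonneg_left hle (abs_nonneg (kiteFun t z - kiteFun t z'))
  nlinarith [mul_le_mul_of_nonneg_left hprod (show 0 ≤ 1 + t by linarith)]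

end kiteFun

lemma abs_prod_sub_prod_le {ι : Type*} (s : Finset ι) {f g : ι → ℝ}
    (hf : ∀ i ∈ s, |f i| ≤ 1) (hg : ∀ i ∈ s, |g i| ≤ 1) :
    |∏ i ∈ s, f i - ∏ i ∈ s, g i| ≤ ∑ i ∈ s, |f i - g i| := by
  classical
  induction s using Finset.induction_on with
  | empty => simp
  | insert i s hi ih =>
    rw [Finset.prod_insert hi, Finset.prod_insert hi, Finset.sum_insert hi]
    have e : f i * ∏ j ∈ s, f j - g i * ∏ j ∈ s, g j =
        (f i - g i) * ∏ j ∈ s, f j + g i * (∏ j ∈ s, f j - ∏ j ∈ s, g j) := by ring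
    have ih' := ih (fun j hj => hf j (Finset.mem_insert_of_mem hj))
      (fun j hj => hg j (Finset.mem_insert_of_mem hj))
    have h1 : |∏ j ∈ s, f j| ≤ 1 := by
      rw [Finset.abs_prod]
      exact Finset.prod_le_one (fun _ _ => abs_nonneg _)
        fun j hj => hf j (Finset.mem_insert_of_mem hj)
    have h2 := hg i (Finset.mem_insert_self i s)
    rw [e]
    refine (abs_add_le _ _).trans (add_le_add ?_ ?_)
    · rw [abs_mul]
      exact mul_le_of_le_one_right (abs_nonneg _) h1
    · rw [abs_mul]
      exact (mul_le_of_le_one_left (abs_nonneg _) h2).trans ih'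

/-- The inverse of `cellMap`. -/
noncomputable def cellInv (m : ℕ) (α : ℝ) (c : ℕ × List (Fin 4)) (x : ℂ) : ℂ :=
  (x - cellMap m α c.1 c.2 0) / (cellMap m α c.1 c.2 1 - cellMap m α c.1 c.2 0)

/-- The indices of the cells of the `n`-th generation. -/
noncomputable def cells (m n : ℕ) : Finset (ℕ × List (Fin 4)) :=
  Finset.range m ×ˢ (List.finite_length_eq (Fin 4) n).toFinset

lemma mem_cells {m n : ℕ} {c : ℕ × List (Fin 4)} : c ∈ cells m n ↔ c.1 < m ∧ c.2.length = n := by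
  simp [cells]

/-- The product of the functions `1 - kiteFun t`, transported to the cells of the `n`-th
generation. -/
noncomputable def barrier (m : ℕ) (α t : ℝ) (n : ℕ) (x : ℂ) : ℝ :=
  ∏ c ∈ cells m n, (1 - kiteFun t (cellInv m α c x))

/-- A version of `coeff` which is continuous away from the vertices of the pre-fractal curve. -/
noncomputable def cutoff (m : ℕ) (α t : ℝ) (n : ℕ) : ℂ → ℝ :=
  (prefractalDomain m α n).indicator (barrier m α t n)

lemma isOpen_prefractalDomain (m : ℕ) (α : ℝ) (n : ℕ) : IsOpen (prefractalDomain m α n) :=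
  isOpen_interior

lemma continuous_cellInv (m : ℕ) (α : ℝ) (c : ℕ × List (Fin 4)) : Continuous (cellInv m α c) :=
  (continuous_id.sub continuous_const).div_const _

lemma measurable_cutoff (m : ℕ) (α t : ℝ) (n : ℕ) : Measurable (cutoff m α t n) := by
  refine Measurable.indicator ?_ isOpen_interior.measurableSet
  refine Finset.measurable_prod _ fun c _ => measurable_const.sub ?_
  exact (measurable_kiteFun t).comp (continuous_cellInv m α c).measurable

lemma barrier_mem_Icc {t : ℝ} (ht : 0 < t) (m : ℕ) (α : ℝ) (n : ℕ) (x : ℂ) :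
    barrier m α t n x ∈ Icc (0 : ℝ) 1 :=
  ⟨Finset.prod_nonneg fun _ _ => sub_nonneg.2 (kiteFun_le_one ht _),
    Finset.prod_le_one (fun _ _ => sub_nonneg.2 (kiteFun_le_one ht _))
      fun _ _ => sub_le_self _ (kiteFun_nonneg t _)⟩

lemma cutoff_mem_Icc {t : ℝ} (ht : 0 < t) (m : ℕ) (α : ℝ) (n : ℕ) (x : ℂ) :
    cutoff m α t n x ∈ Icc (0 : ℝ) 1 := by
  by_cases hx : x ∈ prefractalDomain m α n
  · rw [cutoff, indicator_of_mem hx]; exact barrier_mem_Icc ht m α n x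
  · rw [cutoff, indicator_of_notMem hx]; simp

namespace KochParam

variable {α η κ t : ℝ} (h : KochParam α η κ t) {m : ℕ} (hm : 3 ≤ m)
include h

lemma cellInv_cellMap (c : ℕ × List (Fin 4)) (z : ℂ) :
    cellInv m α c (cellMap m α c.1 c.2 z) = z := by
  obtain ⟨a, b, ha, -, hab⟩ := h.exists_cellMap_affine m c.1 c.2
  rw [cellInv, hab, hab, hab, add_sub_add_right_eq_sub, add_sub_add_right_eq_sub, ← mul_sub,
    ← mul_sub, mul_div_mul_left _ _ ha, sub_zero, sub_zero, div_one]

lemma cellMap_cellInv (c : ℕ × List (Fin 4)) (x : ℂ) :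
    cellMap m α c.1 c.2 (cellInv m α c x) = x := by
  obtain ⟨z, rfl⟩ := h.cellMap_surjective m c.1 c.2 x
  rw [h.cellInv_cellMap]

lemma norm_cellInv_sub (c : ℕ × List (Fin 4)) (x y : ℂ) :
    ‖cellInv m α c x - cellInv m α c y‖ = ‖x - y‖ / ((1 + κ ^ 2) / 4) ^ c.2.length := by
  have := h.dist_cellMap m c.1 c.2 (cellInv m α c x) (cellInv m α c y)
  rw [h.cellMap_cellInv, h.cellMap_cellInv, dist_eq_norm] at this
  rw [this]
  have : ((1 + κ ^ 2) / 4) ^ c.2.length ≠ 0 := by positivity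
  field_simp

/-- The contraction ratio cancels between numerator and denominator, so the constant is the same in
all cells of all generations. The uniformity in n rests on this. -/
lemma abs_kiteFun_cellInv_sub_le {c : ℕ × List (Fin 4)} {x : ℂ} (h0 : x ≠ cellMap m α c.1 c.2 0)
    (h1 : x ≠ cellMap m α c.1 c.2 1) (y : ℂ) :
    |kiteFun t (cellInv m α c x) - kiteFun t (cellInv m α c y)| ≤ 2 * (1 + t) ^ 2 / t * ‖x - y‖ /
      min ‖x - cellMap m α c.1 c.2 0‖ ‖x - cellMap m α c.1 c.2 1‖ := by
  have h0' : cellInv m α c x ≠ 0 := fun hc => h0 (by rw [← hc, h.cellMap_cellInv])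
  have h1' : cellInv m α c x ≠ 1 := fun hc => h1 (by rw [← hc, h.cellMap_cellInv])
  have key := abs_kiteFun_sub_le h.t_pos h0' h1' (cellInv m α c y)
  have hρ : 0 < ((1 + κ ^ 2) / 4) ^ c.2.length := by positivity
  have e0 : ‖cellInv m α c x‖ = ‖x - cellMap m α c.1 c.2 0‖ / ((1 + κ ^ 2) / 4) ^ c.2.length := by
    rw [← h.norm_cellInv_sub, h.cellInv_cellMap, sub_zero]
  have e1 : ‖cellInv m α c x - 1‖ =
      ‖x - cellMap m α c.1 c.2 1‖ / ((1 + κ ^ 2) / 4) ^ c.2.length := by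
    rw [← h.norm_cellInv_sub, h.cellInv_cellMap]
  rw [e0, e1, min_div_div_right hρ.le, h.norm_cellInv_sub, mul_div_assoc',
    div_div_div_cancel_right₀ hρ.ne'] at key
  exact key

lemma volume_cellMap_image {S : Set ℂ} (hS : volume S = 0) (j : ℕ) (w : List (Fin 4)) :
    volume (cellMap m α j w '' S) = 0 := by
  refine addHaar_image_eq_zero_of_differentiableOn_of_addHaar_eq_zero volume ?_ hS
  obtain ⟨a, b, -, -, hab⟩ := h.exists_cellMap_affine m j w
  rw [funext hab]
  fun_prop

lemma volume_prefractalCurves (n : ℕ) : volume (prefractalCurves m α n) = 0 := by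
  rw [prefractalCurves, onSides_iterateSet_eq]
  refine (measure_biUnion_null_iff (Finset.countable_toSet _)).2 fun c _ =>
    h.volume_cellMap_image (measure_mono_null (t := (LinearMap.ker Complex.imLm : Set ℂ)) ?_ ?_) _ _
  · intro z hz
    exact (mem_segment_zero_one.1 hz).1
  · refine Measure.addHaar_submodule volume _ fun htop => ?_
    have : Complex.I ∈ LinearMap.ker Complex.imLm := htop ▸ Submodule.mem_top
    simp at this

lemma frontier_innerFiber_subset (n : ℕ) : frontier (innerFiber m α η n) ⊆
    ⋃ c ∈ cells m n, cellMap m α c.1 c.2 '' frontier (lowerTriangle t) := by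
  have e : innerFiber m α η n = ⋃ c ∈ cells m n, cellInv m α c ⁻¹' lowerTriangle t := by
    rw [h.innerFiber_eq, onSides_iterateSet_eq]
    refine iUnion₂_congr fun c _ => ?_
    ext x
    constructor
    · rintro ⟨z, hz, rfl⟩
      rw [mem_preimage, h.cellInv_cellMap]
      exact hz
    · exact fun hx => ⟨_, hx, h.cellMap_cellInv c x⟩
  rw [(h.isOpen_innerFiber m n).frontier_eq, e]
  rintro x ⟨hx, hx'⟩
  have hcl : closure (⋃ c ∈ cells m n, cellInv m α c ⁻¹' lowerTriangle t) =
      ⋃ c ∈ cells m n, closure (cellInv m α c ⁻¹' lowerTriangle t) :=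
    Finset.closure_biUnion _ _
  rw [hcl] at hx
  simp only [mem_iUnion] at hx hx' ⊢
  obtain ⟨c, hc, hxc⟩ := hx
  refine ⟨c, hc, cellInv m α c x, ?_, h.cellMap_cellInv c x⟩
  rw [(isOpen_lowerTriangle t).frontier_eq]
  exact ⟨(continuous_cellInv m α c).closure_preimage_subset _ hxc, fun hT => hx' ⟨c, hc, hT⟩⟩

lemma volume_frontier_innerFiber (n : ℕ) : volume (frontier (innerFiber m α η n)) = 0 := by
  refine measure_mono_null (h.frontier_innerFiber_subset n) ?_
  refine (measure_biUnion_null_iff (Finset.countable_toSet _)).2 fun c _ =>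
    h.volume_cellMap_image ?_ _ _
  rw [← innerTriangle_eq h.t_pos h.t_eq]
  exact (convex_convexHull ℝ _).interior.addHaar_frontier volume

include hm

lemma notMem_openKite_of_mem {n : ℕ} {c c' : ℕ × List (Fin 4)} (hc : c ∈ cells m n)
    (hc' : c' ∈ cells m n) (hne : c ≠ c') {z : ℂ} (hz : z ∈ lowerTriangle t) :
    cellInv m α c' (cellMap m α c.1 c.2 z) ∉ openKite t := by
  obtain ⟨hj, hw⟩ := mem_cells.1 hc
  obtain ⟨hj', hw'⟩ := mem_cells.1 hc'
  intro hmem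
  have heq := h.cellMap_cellInv (m := m) c' (cellMap m α c.1 c.2 z)
  set z' := cellInv m α c' (cellMap m α c.1 c.2 z)
  have hlen : c.2.length = c'.2.length := hw.trans hw'.symm
  rcases lt_or_ge z'.im 0 with hi | hi
  · have hz' : z' ∈ lowerTriangle t := by
      obtain ⟨h1, h2⟩ := hmem
      rw [abs_of_neg hi] at h1 h2
      exact ⟨hi, h1, h2⟩
    exact hne (h.eq_of_cellMap_lowerTriangle_eq hm hj hj' hlen hz hz' heq.symm)
  · have hz' : z' ∈ upperTriangle κ := by
      obtain ⟨h1, h2⟩ := hmem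
      rw [abs_of_nonneg hi] at h1 h2
      have ht := h.t_pos
      have hk := h.t_le
      have a0 : 0 ≤ z'.re := by by_contra! hc; nlinarith
      have a1 : 0 ≤ 1 - z'.re := by by_contra! hc; nlinarith
      exact ⟨hi, by nlinarith, by nlinarith⟩
    exact h.cellMap_ne hm (isOpen_lowerTriangle t) ((lowerTriangle_subset_doubleTriangle
      h.t_pos).trans h.doubleTriangle_subset_invariantKite) hz hz' hj hj' hlen hne heq.symm

/-- On an inner triangle only the factor of its own cell is different from one. -/
lemma cutoff_cellMap {n : ℕ} {c : ℕ × List (Fin 4)} (hc : c ∈ cells m n) {z : ℂ}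
    (hz : z ∈ lowerTriangle t) : cutoff m α t n (cellMap m α c.1 c.2 z) = 1 - kiteFun t z := by
  obtain ⟨hj, hw⟩ := mem_cells.1 hc
  rw [cutoff, indicator_of_mem (h.cellMap_lowerTriangle_mem hm hj hw hz), barrier,
    Finset.prod_eq_single_of_mem c hc, h.cellInv_cellMap]
  intro c' hc' hne
  by_contra hk
  refine h.notMem_openKite_of_mem hm hc hc' hne.symm hz
    (mem_openKite_of_kiteFun_ne_zero h.t_pos fun h0 => hk ?_)
  rw [h0, sub_zero]

/-- A factor different from one would put x in the open kite of a cell. The lower half of that kite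
is in the inner fiber, its diagonal is on the curve, and its upper half is outside the domain. -/
lemma cutoff_of_notMem_innerFiber {n : ℕ} {x : ℂ} (hx : x ∈ prefractalDomain m α n)
    (hx' : x ∉ innerFiber m α η n) : cutoff m α t n x = 1 := by
  rw [cutoff, indicator_of_mem hx]
  refine Finset.prod_eq_one fun c hc => ?_
  obtain ⟨hj, hw⟩ := mem_cells.1 hc
  by_contra hk
  obtain ⟨h1, h2⟩ := mem_openKite_of_kiteFun_ne_zero h.t_pos (z := cellInv m α c x)
    fun h0 => hk (by rw [h0, sub_zero])
  have heq := h.cellMap_cellInv (m := m) c x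
  set z := cellInv m α c x
  have ht := h.t_pos
  have hk := h.t_le
  rcases lt_trichotomy z.im 0 with hi | hi | hi
  · rw [abs_of_neg hi] at h1 h2
    rw [h.innerFiber_eq] at hx'
    exact hx' (mem_onSides_iterateSet.2 ⟨c.1, hj, c.2, hw, z, ⟨hi, h1, h2⟩, heq⟩)
  · rw [hi, abs_zero] at h1 h2
    refine h.prefractalCurves_disjoint hm n (mem_onSides_iterateSet.2 ⟨c.1, hj, c.2, hw, z,
      mem_segment_zero_one.2 ⟨hi, ?_, ?_⟩, heq⟩) hx
    · exact (pos_of_mul_pos_right h1 ht.le).le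
    · linarith [pos_of_mul_pos_right h2 ht.le]
  · rw [abs_of_pos hi] at h1 h2
    have a0 : 0 < z.re := by by_contra! hc; nlinarith
    have a1 : 0 < 1 - z.re := by by_contra! hc; nlinarith
    refine h.cellMap_upperTriangleInt_notMem hm hj hw (z := z)
      ⟨hi, by nlinarith, by nlinarith⟩ ?_
    rw [heq]
    exact interior_subset hx

lemma coeff_eq_cutoff {n : ℕ} {x : ℂ} (hx : x ∉ prefractalCurves m α n) :
    coeff m α η n x = cutoff m α t n x := by
  by_cases hS : x ∈ innerFiber m α η n
  · rw [h.innerFiber_eq] at hS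
    obtain ⟨j, hj, w, hw, z, hz, rfl⟩ := mem_onSides_iterateSet.1 hS
    rw [h.coeff_cellMap hm hj hw hz, h.cutoff_cellMap hm (c := (j, w)) (mem_cells.2 ⟨hj, hw⟩) hz,
      one_sub_kiteFun_of_mem h.t_pos hz]
  · by_cases hΩ : x ∈ prefractalDomain m α n
    · rw [coeff, if_neg hS, if_pos (mem_union_left _ hΩ), h.cutoff_of_notMem_innerFiber hm hΩ hS]
    · rw [coeff, if_neg hS, cutoff, indicator_of_notMem hΩ, if_neg]
      rintro (hc | hc)
      · exact hΩ hc
      · refine hx (h.frontier_prefractalDomain_subset hm n ?_)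
        rw [(isOpen_prefractalDomain m α n).frontier_eq]
        exact ⟨closure_mono sdiff_subset hc, hΩ⟩

lemma coeff_ae_eq_cutoff (n : ℕ) (Ω : Set ℂ) :
    coeff m α η n =ᵐ[volume.restrict Ω] cutoff m α t n := by
  refine ae_restrict_of_ae ?_
  filter_upwards [measure_eq_zero_iff_ae_notMem.1 (h.volume_prefractalCurves (m := m) n)] with x hx
  exact h.coeff_eq_cutoff hm hx

end KochParam

/-! ### Multiplication of test functions by the coefficient functions -/

lemma exists_mem_segment_frontier {U : Set ℂ} (hU : IsOpen U) {x y : ℂ} (hx : x ∈ U) (hy : y ∉ U) :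
    ∃ p ∈ segment ℝ x y, p ∈ frontier U := by
  by_contra! hc
  refine hy ((convex_segment x y).isPreconnected.subset_of_closure_inter_subset hU
    ⟨x, left_mem_segment ℝ x y, hx⟩ ?_ (right_mem_segment ℝ x y))
  rintro p ⟨hp, hps⟩
  by_contra hpU
  exact hc p hps (by rw [hU.frontier_eq]; exact ⟨hp, hpU⟩)

lemma isOpen_fractalDomain (m : ℕ) (α : ℝ) : IsOpen (fractalDomain m α) :=
  isOpen_iUnion fun n => isOpen_prefractalDomain m α n

lemma cutoff_of_notMem {m : ℕ} {α t : ℝ} {n : ℕ} {x : ℂ} (hx : x ∉ prefractalDomain m α n) :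
    cutoff m α t n x = 0 := indicator_of_notMem hx _

lemma cutoff_of_mem {m : ℕ} {α t : ℝ} {n : ℕ} {x : ℂ} (hx : x ∈ prefractalDomain m α n) :
    cutoff m α t n x = barrier m α t n x := indicator_of_mem hx _

/-- The distance to the closer one of the two vertices of a cell. -/
noncomputable def vertexDist (m : ℕ) (α : ℝ) (c : ℕ × List (Fin 4)) (x : ℂ) : ℝ :=
  min ‖x - cellMap m α c.1 c.2 0‖ ‖x - cellMap m α c.1 c.2 1‖

lemma vertexDist_sub_le (m : ℕ) (α : ℝ) (c : ℕ × List (Fin 4)) (x y : ℂ) :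
    vertexDist m α c x - ‖x - y‖ ≤ vertexDist m α c y := by
  have hx : ∀ v : ℂ, ‖x - v‖ - ‖x - y‖ ≤ ‖y - v‖ := fun v => by
    have := norm_add_le (x - y) (y - v)
    rw [sub_add_sub_cancel] at this
    linarith
  refine le_min ?_ ?_
  · exact (sub_le_sub_right (min_le_left _ _) _).trans (hx _)
  · exact (sub_le_sub_right (min_le_right _ _) _).trans (hx _)

namespace KochParam

variable {α η κ t : ℝ} (h : KochParam α η κ t) {m : ℕ} (hm : 3 ≤ m)
include h

lemma abs_kiteFun_cellInv_sub_le_vertexDist {c : ℕ × List (Fin 4)} {x : ℂ}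
    (hx : 0 < vertexDist m α c x) (y : ℂ) :
    |kiteFun t (cellInv m α c x) - kiteFun t (cellInv m α c y)| ≤
      2 * (1 + t) ^ 2 / t * ‖x - y‖ / vertexDist m α c x := by
  obtain ⟨h0, h1⟩ := lt_min_iff.1 hx
  exact h.abs_kiteFun_cellInv_sub_le (sub_ne_zero.1 (norm_pos_iff.1 h0))
    (sub_ne_zero.1 (norm_pos_iff.1 h1)) y

/-- The number of cells enters, so this bound is not uniform in n. It serves only to show that
products with test functions are Lipschitz. -/
lemma abs_barrier_sub_le {n : ℕ} {ε : ℝ} (hε : 0 < ε) {x : ℂ}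
    (hx : ∀ c ∈ cells m n, ε ≤ vertexDist m α c x) (y : ℂ) :
    |barrier m α t n x - barrier m α t n y| ≤
      (cells m n).card * (2 * (1 + t) ^ 2 / t) / ε * ‖x - y‖ := by
  have ht := h.t_pos
  have h1 : ∀ z : ℂ, |1 - kiteFun t z| ≤ 1 := fun z => by
    rw [abs_of_nonneg (sub_nonneg.2 (kiteFun_le_one ht z))]
    linarith [kiteFun_nonneg t z]
  refine (abs_prod_sub_prod_le _ (fun c _ => h1 _) (fun c _ => h1 _)).trans ?_
  have h2 : ∀ c ∈ cells m n, |1 - kiteFun t (cellInv m α c x) - (1 - kiteFun t (cellInv m α c y))| ≤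
      2 * (1 + t) ^ 2 / t / ε * ‖x - y‖ := by
    intro c hc
    rw [sub_sub_sub_cancel_left, abs_sub_comm]
    refine (h.abs_kiteFun_cellInv_sub_le_vertexDist (hε.trans_le (hx c hc)) y).trans ?_
    rw [div_mul_eq_mul_div _ ε]
    exact div_le_div_of_nonneg_left (by positivity) hε (hx c hc)
  refine (Finset.sum_le_card_nsmul _ _ _ h2).trans (le_of_eq ?_)
  rw [nsmul_eq_mul]
  ring

lemma barrier_eq_zero {n : ℕ} {p : ℂ} (hp : p ∈ prefractalCurves m α n)
    (hv : ∀ c ∈ cells m n, 0 < vertexDist m α c p) : barrier m α t n p = 0 := by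
  obtain ⟨j, hj, w, hw, z, hz, rfl⟩ := mem_onSides_iterateSet.1 hp
  obtain ⟨z0, z1, z2⟩ := mem_segment_zero_one.1 hz
  have hc : (j, w) ∈ cells m n := mem_cells.2 ⟨hj, hw⟩
  obtain ⟨v0, v1⟩ := lt_min_iff.1 (hv _ hc)
  refine Finset.prod_eq_zero hc ?_
  have := h.cellInv_cellMap (m := m) (j, w) z
  dsimp only at this v0 v1
  rw [this, kiteFun_of_mem_Ioo h.t_pos z0, sub_self]
  · refine lt_of_le_of_ne z1 fun he => ?_
    have : z = 0 := Complex.ext he.symm z0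
    rw [this, sub_self, norm_zero] at v0
    exact lt_irrefl _ v0
  · refine lt_of_le_of_ne z2 fun he => ?_
    have : z = 1 := Complex.ext he z0
    rw [this, sub_self, norm_zero] at v1
    exact lt_irrefl _ v1

lemma isBounded_fractalDomain : Bornology.IsBounded (fractalDomain m α) := by
  have hA : IsCompact (upperTriangle κ) := by
    refine Metric.isCompact_of_isClosed_isBounded ?_ ?_
    · have h1 : Continuous fun z : ℂ => κ * z.re := by fun_prop
      have h2 : Continuous fun z : ℂ => κ * (1 - z.re) := by fun_prop
      exact (isClosed_le continuous_const Complex.continuous_im).inter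
        ((isClosed_le Complex.continuous_im h1).inter (isClosed_le Complex.continuous_im h2))
    · refine (Metric.isBounded_closedBall (x := (0 : ℂ)) (r := 1 + κ)).subset fun z hz => ?_
      have hκ := h.κ_pos
      obtain ⟨z1, z2, z3⟩ := hz
      have a0 : 0 ≤ z.re := by by_contra! hc; nlinarith
      have a1 : z.re ≤ 1 := by by_contra! hc; nlinarith
      rw [mem_closedBall_zero_iff]
      refine (Complex.norm_le_abs_re_add_abs_im z).trans ?_
      rw [abs_of_nonneg a0, abs_of_nonneg z1]
      nlinarith
  have hC : IsCompact (closedPrefractal m α 0 ∪ onSides m (iterateSet α 0 (upperTriangle κ))) :=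
    (h.isCompact_closedPrefractal 0).union (h.isCompact_onSides_iterateSet 0 hA)
  refine hC.isBounded.subset (iUnion_subset fun n => interior_subset.trans fun x hx => ?_)
  rcases mem_closedPrefractal.1 hx with hx | ⟨j, hj, w, -, z, hz, rfl⟩
  · exact Or.inl (mem_closedPrefractal.2 (Or.inl hx))
  · exact Or.inr (mem_onSides_iterateSet.2 ⟨j, hj, [], rfl, wordMap α w z,
      h.wordMap_mapsTo_upperTriangle w (h.bump_subset_upperTriangle hz), rfl⟩)

include hm

/-- Away from the vertices the barrier vanishes on the curve, so its extension by zero outside the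
domain remains Lipschitz: a segment that leaves the domain is cut at a frontier point. Points at
distance at least δ/2 are handled by the values lying in [0, 1]. -/
lemma abs_cutoff_sub_le {n : ℕ} {δ : ℝ} (hδ : 0 < δ) {x : ℂ}
    (hx : ∀ c ∈ cells m n, δ ≤ vertexDist m α c x) (y : ℂ) :
    |cutoff m α t n x - cutoff m α t n y| ≤
      (((cells m n).card * (2 * (1 + t) ^ 2 / t) + 1) / (δ / 2)) * ‖x - y‖ := by
  have ht := h.t_pos
  set M := (cells m n).card * (2 * (1 + t) ^ 2 / t) with hM
  have hM0 : 0 ≤ M := by positivity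
  rcases le_or_gt (δ / 2) ‖x - y‖ with hxy | hxy
  · have h1 := cutoff_mem_Icc ht m α n x
    have h2 := cutoff_mem_Icc ht m α n y
    have h3 : |cutoff m α t n x - cutoff m α t n y| ≤ 1 :=
      abs_le.2 ⟨by linarith [h1.1, h2.2], by linarith [h1.2, h2.1]⟩
    refine h3.trans ?_
    rw [div_mul_eq_mul_div, le_div_iff₀ (by positivity)]
    nlinarith
  have hseg : ∀ p ∈ segment ℝ x y, ‖x - p‖ ≤ ‖x - y‖ ∧ ‖p - y‖ ≤ ‖x - y‖ ∧
      ∀ c ∈ cells m n, δ / 2 ≤ vertexDist m α c p := by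
    intro p hp
    have h1 := dist_add_dist_of_mem_segment hp
    simp only [dist_eq_norm] at h1
    have h2 : ‖x - p‖ ≤ ‖x - y‖ := by linarith [norm_nonneg (p - y)]
    refine ⟨h2, by linarith [norm_nonneg (x - p)], fun c hc => ?_⟩
    linarith [vertexDist_sub_le m α c x p, hx c hc]
  have hδ2 : 0 < δ / 2 := by positivity
  have hbar : ∀ p ∈ segment ℝ x y, ∀ q, |barrier m α t n p - barrier m α t n q| ≤
      (M + 1) / (δ / 2) * ‖p - q‖ := by
    intro p hp q
    refine (h.abs_barrier_sub_le hδ2 (hseg p hp).2.2 q).trans ?_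
    gcongr
    linarith
  have hpos : 0 ≤ (M + 1) / (δ / 2) := by positivity
  have hzero : ∀ p ∈ segment ℝ x y, p ∈ frontier (prefractalDomain m α n) →
      barrier m α t n p = 0 := fun p hp hpf =>
    h.barrier_eq_zero (h.frontier_prefractalDomain_subset hm n hpf)
      fun c hc => hδ2.trans_le ((hseg p hp).2.2 c hc)
  by_cases hxΩ : x ∈ prefractalDomain m α n <;> by_cases hyΩ : y ∈ prefractalDomain m α n
  · rw [cutoff_of_mem hxΩ, cutoff_of_mem hyΩ]
    exact hbar x (left_mem_segment ℝ x y) y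
  · obtain ⟨p, hp, hpf⟩ := exists_mem_segment_frontier (isOpen_prefractalDomain m α n) hxΩ hyΩ
    rw [cutoff_of_mem hxΩ, cutoff_of_notMem hyΩ, ← hzero p hp hpf]
    exact (hbar x (left_mem_segment ℝ x y) p).trans
      (mul_le_mul_of_nonneg_left (hseg p hp).1 hpos)
  · obtain ⟨p, hp, hpf⟩ := exists_mem_segment_frontier (isOpen_prefractalDomain m α n) hyΩ hxΩ
    rw [segment_symm] at hp
    rw [cutoff_of_notMem hxΩ, cutoff_of_mem hyΩ, ← hzero p hp hpf]
    exact (hbar p hp y).trans (mul_le_mul_of_nonneg_left (hseg p hp).2.1 hpos)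
  · rw [cutoff_of_notMem hxΩ, cutoff_of_notMem hyΩ, sub_self, abs_zero]
    positivity

/-- The vertices of all generations lie outside the open limit domain, while the support is compact
inside it. Hence one δ serves every generation. -/
lemma exists_le_vertexDist {φ : ℂ → ℝ} (hφ : IsTestFunction (fractalDomain m α) φ) :
    ∃ δ > 0, ∀ x ∈ tsupport φ, ∀ c : ℕ × List (Fin 4), c.1 < m → δ ≤ vertexDist m α c x := by
  obtain ⟨δ, hδ, hsub⟩ :=
    hφ.2.1.isCompact.exists_cthickening_subset_open (isOpen_fractalDomain m α) hφ.2.2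
  refine ⟨δ, hδ, fun x hx c hc => ?_⟩
  obtain ⟨h0, h1⟩ := h.vertex_notMem_fractalDomain hm hc c.2
  have key : ∀ v, v ∉ fractalDomain m α → δ ≤ ‖x - v‖ := by
    intro v hv
    by_contra! hlt
    refine hv (hsub (Metric.mem_cthickening_of_dist_le v x δ _ hx ?_))
    rw [dist_comm, dist_eq_norm]
    exact hlt.le
  exact le_min (key _ h0) (key _ h1)

/-- In the splitting of the product, the difference of the cutoffs is multiplied by φ(x). It matters
only for x in the support, where the vertices are far away, and y is unrestricted. -/
lemma exists_lipschitzWith_cutoff_mul (n : ℕ) {φ : ℂ → ℝ}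
    (hφ : IsTestFunction (fractalDomain m α) φ) :
    ∃ L, LipschitzWith L fun x => cutoff m α t n x * φ x := by
  have ht := h.t_pos
  obtain ⟨δ, hδ, hv⟩ := h.exists_le_vertexDist hm hφ
  obtain ⟨D, hD⟩ := hφ.exists_lipschitz
  obtain ⟨B, hB⟩ := hφ.2.1.exists_bound_of_continuous hφ.1.continuous
  set M := ((cells m n).card * (2 * (1 + t) ^ 2 / t) + 1) / (δ / 2) with hM
  have hM0 : 0 ≤ M := by positivity
  have hB0 : 0 ≤ B := (norm_nonneg _).trans (hB 0)
  have key : ∀ x y, |φ x| * |cutoff m α t n x - cutoff m α t n y| ≤ B * (M * ‖x - y‖) := by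
    intro x y
    by_cases hx : x ∈ tsupport φ
    · exact mul_le_mul (hB x) (h.abs_cutoff_sub_le hm hδ
        (fun c hc => hv x hx c (mem_cells.1 hc).1) y) (abs_nonneg _) hB0
    · rw [image_eq_zero_of_notMem_tsupport hx, abs_zero, zero_mul]
      positivity
  refine ⟨⟨B * M + D, by positivity⟩, LipschitzWith.of_dist_le_mul fun x y => ?_⟩
  have h1 := hD.dist_le_mul x y
  have h2 := key x y
  have h3 := cutoff_mem_Icc ht m α n y
  rw [Real.dist_eq] at h1 ⊢
  rw [dist_eq_norm] at h1 ⊢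
  have e : cutoff m α t n x * φ x - cutoff m α t n y * φ y =
      φ x * (cutoff m α t n x - cutoff m α t n y) + cutoff m α t n y * (φ x - φ y) := by ring
  rw [e]
  refine (abs_add_le _ _).trans ?_
  rw [abs_mul, abs_mul, abs_of_nonneg h3.1]
  have h4 : cutoff m α t n y * |φ x - φ y| ≤ D * ‖x - y‖ :=
    (mul_le_of_le_one_left (abs_nonneg _) h3.2).trans h1
  calc _ ≤ B * (M * ‖x - y‖) + D * ‖x - y‖ := add_le_add h2 h4
    _ = (B * M + D) * ‖x - y‖ := by ring

/-- Each test function is unchanged by the cutoff functions of sufficiently late generations. -/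
lemma eventually_cutoff_mul_eq {φ : ℂ → ℝ} (hφ : IsTestFunction (fractalDomain m α) φ) :
    ∀ᶠ n in atTop, ∀ x, cutoff m α t n x * φ x = φ x := by
  obtain ⟨δ, hδ, hv⟩ := h.exists_le_vertexDist hm hφ
  obtain ⟨n₀, hn₀⟩ := hφ.2.1.isCompact.elim_directed_cover (prefractalDomain m α)
    (isOpen_prefractalDomain m α) hφ.2.2 (prefractalDomain_mono m α).directed_le
  have hκ2 := h.κ_sq_lt
  have hlim : Tendsto (fun n : ℕ => ((1 + κ ^ 2) / 4) ^ n * (1 + t)) atTop (𝓝 0) := by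
    simpa using (tendsto_pow_atTop_nhds_zero_of_lt_one (by positivity)
      (show (1 + κ ^ 2) / 4 < 1 by linarith)).mul_const (1 + t)
  -- Each point of an inner triangle of generation n is within ((1 + κ²)/4)^n (1 + t) of a vertex.
  -- Once this is below δ, the support misses the inner fiber.
  filter_upwards [hlim.eventually_lt_const hδ, eventually_ge_atTop n₀] with n hn hnn x
  by_cases hx : x ∈ tsupport φ
  · rw [h.cutoff_of_notMem_innerFiber hm (prefractalDomain_mono m α hnn (hn₀ hx)), one_mul]
    rw [h.innerFiber_eq]
    intro hmem
    obtain ⟨j, hj, w, hw, z, hz, rfl⟩ := mem_onSides_iterateSet.1 hmem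
    have h1 := (hv _ hx (j, w) hj).trans (min_le_left _ _)
    dsimp only at h1
    rw [← dist_eq_norm, h.dist_cellMap, hw, sub_zero] at h1
    obtain ⟨a0, a1, -⟩ := mem_openKite_ofReal h.t_pos hz
    obtain ⟨b0, b1, b2⟩ := hz
    have hz1 : ‖z‖ ≤ 1 + t := by
      refine (Complex.norm_le_abs_re_add_abs_im z).trans ?_
      rw [abs_of_pos a0, abs_of_neg b0]
      nlinarith [h.t_pos]
    have := mul_le_mul_of_nonneg_left hz1 (show 0 ≤ ((1 + κ ^ 2) / 4) ^ n by positivity)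
    linarith
  · rw [image_eq_zero_of_notMem_tsupport hx, mul_zero]

end KochParam

/-! ### The gradient bound -/

/-- The inner triangle of a cell. -/
def cellTriangle (m : ℕ) (α t : ℝ) (c : ℕ × List (Fin 4)) : Set ℂ :=
  cellInv m α c ⁻¹' lowerTriangle t

lemma isOpen_cellTriangle (m : ℕ) (α t : ℝ) (c : ℕ × List (Fin 4)) :
    IsOpen (cellTriangle m α t c) :=
  (isOpen_lowerTriangle t).preimage (continuous_cellInv m α c)

namespace KochParam

variable {α η κ t : ℝ} (h : KochParam α η κ t) {m : ℕ} (hm : 3 ≤ m)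
include h

lemma mem_cellTriangle_iff {c : ℕ × List (Fin 4)} {x : ℂ} :
    x ∈ cellTriangle m α t c ↔ ∃ z ∈ lowerTriangle t, cellMap m α c.1 c.2 z = x := by
  constructor
  · exact fun hx => ⟨_, hx, h.cellMap_cellInv c x⟩
  · rintro ⟨z, hz, rfl⟩
    rw [cellTriangle, mem_preimage, h.cellInv_cellMap]
    exact hz

lemma mem_innerFiber_iff {n : ℕ} {x : ℂ} :
    x ∈ innerFiber m α η n ↔ ∃ c ∈ cells m n, x ∈ cellTriangle m α t c := by
  rw [h.innerFiber_eq, mem_onSides_iterateSet]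
  constructor
  · rintro ⟨j, hj, w, hw, hz⟩
    exact ⟨(j, w), mem_cells.2 ⟨hj, hw⟩, h.mem_cellTriangle_iff.2 hz⟩
  · rintro ⟨c, hc, hx⟩
    obtain ⟨hj, hw⟩ := mem_cells.1 hc
    exact ⟨c.1, hj, c.2, hw, h.mem_cellTriangle_iff.1 hx⟩

/-- Hardy's inequality on an inner triangle, with the distance to the nearest base vertex. -/
lemma exists_hardy_cellTriangle {r : ℝ} (hr : 2 < r) : ∃ C : ℝ≥0, ∀ (c : ℕ × List (Fin 4))
    (φ : ℂ → ℝ), ContDiff ℝ ∞ φ → φ (cellMap m α c.1 c.2 0) = 0 → φ (cellMap m α c.1 c.2 1) = 0 →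
    ∫⁻ x in cellTriangle m α t c, ENNReal.ofReal (|φ x| / vertexDist m α c x) ^ r ≤
      C * ∫⁻ x in cellTriangle m α t c, ‖fderiv ℝ φ x‖ₑ ^ r := by
  obtain ⟨C, hC⟩ := exists_hardy_const hr
  refine ⟨2 * C, fun c φ hφ h0 h1 => ?_⟩
  have ht := h.t_pos
  have hρ : 0 < ((1 + κ ^ 2) / 4) ^ c.2.length := by positivity
  have hne : cellMap m α c.1 c.2 1 - cellMap m α c.1 c.2 0 ≠ 0 :=
    sub_ne_zero.2 fun he => one_ne_zero (h.cellMap_injective m c.1 c.2 he)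
  have hn0 : ∀ x, ‖x - cellMap m α c.1 c.2 0‖ =
      ‖cellInv m α c x‖ * ((1 + κ ^ 2) / 4) ^ c.2.length := fun x => by
    have := h.norm_cellInv_sub (m := m) c x (cellMap m α c.1 c.2 0)
    rw [h.cellInv_cellMap, sub_zero] at this
    rw [this, div_mul_cancel₀ _ hρ.ne']
  have hn1 : ∀ x, ‖x - cellMap m α c.1 c.2 1‖ =
      ‖cellInv m α c x - 1‖ * ((1 + κ ^ 2) / 4) ^ c.2.length := fun x => by
    have := h.norm_cellInv_sub (m := m) c x (cellMap m α c.1 c.2 1)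
    rw [h.cellInv_cellMap] at this
    rw [this, div_mul_cancel₀ _ hρ.ne']
  have hsq : ∀ z : ℂ, ‖z - 1‖ ^ 2 = ‖z‖ ^ 2 + 1 - 2 * z.re := fun z => by
    rw [Complex.sq_norm, Complex.sq_norm, Complex.normSq_apply, Complex.normSq_apply]
    simp only [Complex.sub_re, Complex.sub_im, Complex.one_re, Complex.one_im]
    ring
  set T := cellTriangle m α t c with hT
  -- The perpendicular bisector of the base cuts the triangle into halves, each star-shaped about
  -- its base vertex, which is also the closer of the two. This explains the factor 2 in the
  -- constant.
  set S₀ := cellInv m α c ⁻¹' (lowerTriangle t ∩ {z | z.re ≤ 1 / 2}) with hS₀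
  set S₁ := cellInv m α c ⁻¹' (lowerTriangle t ∩ {z | 1 / 2 ≤ z.re}) with hS₁
  have hTu : T ⊆ S₀ ∪ S₁ := fun x hx =>
    (le_total (cellInv m α c x).re (1 / 2)).imp (fun h => ⟨hx, h⟩) (fun h => ⟨hx, h⟩)
  have hS₀T : S₀ ⊆ T := fun x hx => hx.1
  have hS₁T : S₁ ⊆ T := fun x hx => hx.1
  have hm₀ : MeasurableSet S₀ := (continuous_cellInv m α c).measurable
    ((isOpen_lowerTriangle t).measurableSet.inter
      (isClosed_le Complex.continuous_re continuous_const).measurableSet)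
  have hm₁ : MeasurableSet S₁ := (continuous_cellInv m α c).measurable
    ((isOpen_lowerTriangle t).measurableSet.inter
      (isClosed_le continuous_const Complex.continuous_re).measurableSet)
  have hd₀ : ∀ x ∈ S₀, vertexDist m α c x = ‖x - cellMap m α c.1 c.2 0‖ := by
    rintro x ⟨-, hx⟩
    refine min_eq_left ?_
    rw [hn0, hn1]
    refine mul_le_mul_of_nonneg_right ?_ hρ.le
    refine le_of_sq_le_sq ?_ (norm_nonneg _)
    rw [hsq]
    have : (cellInv m α c x).re ≤ 1 / 2 := hx
    linarith
  have hd₁ : ∀ x ∈ S₁, vertexDist m α c x = ‖x - cellMap m α c.1 c.2 1‖ := by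
    rintro x ⟨-, hx⟩
    refine min_eq_right ?_
    rw [hn0, hn1]
    refine mul_le_mul_of_nonneg_right ?_ hρ.le
    refine le_of_sq_le_sq ?_ (norm_nonneg _)
    rw [hsq]
    have : 1 / 2 ≤ (cellInv m α c x).re := hx
    linarith
  have hst₀ : ∀ x ∈ S₀, ∀ s ∈ Ioo (0 : ℝ) 1,
      cellMap m α c.1 c.2 0 + s • (x - cellMap m α c.1 c.2 0) ∈ S₀ := by
    rintro x ⟨⟨x1, x2, x3⟩, x4⟩ s ⟨s0, s1⟩
    have e : cellInv m α c (cellMap m α c.1 c.2 0 + s • (x - cellMap m α c.1 c.2 0)) =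
        s * cellInv m α c x := by
      rw [cellInv, cellInv, Complex.real_smul, add_sub_cancel_left, mul_div_assoc]
    rw [hS₀, mem_preimage, e]
    set z := cellInv m α c x
    have x4' : z.re ≤ 1 / 2 := x4
    have a0 : 0 < z.re := by by_contra! hc; nlinarith
    refine ⟨⟨?_, ?_, ?_⟩, ?_⟩
    · rw [Complex.im_ofReal_mul]; exact mul_neg_of_pos_of_neg s0 x1
    · rw [Complex.im_ofReal_mul, Complex.re_ofReal_mul]; nlinarith
    · rw [Complex.im_ofReal_mul, Complex.re_ofReal_mul]; nlinarith
    · rw [mem_ofPred_eq, Complex.re_ofReal_mul]; nlinarith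
  have hst₁ : ∀ x ∈ S₁, ∀ s ∈ Ioo (0 : ℝ) 1,
      cellMap m α c.1 c.2 1 + s • (x - cellMap m α c.1 c.2 1) ∈ S₁ := by
    rintro x ⟨⟨x1, x2, x3⟩, x4⟩ s ⟨s0, s1⟩
    have e : cellInv m α c (cellMap m α c.1 c.2 1 + s • (x - cellMap m α c.1 c.2 1)) =
        (1 - s : ℝ) + s * cellInv m α c x := by
      rw [cellInv, cellInv, Complex.real_smul, Complex.ofReal_sub, Complex.ofReal_one]
      field_simp
      ring
    rw [hS₁, mem_preimage, e]
    set z := cellInv m α c x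
    have x4' : 1 / 2 ≤ z.re := x4
    have a0 : 0 < 1 - z.re := by by_contra! hc; nlinarith
    refine ⟨⟨?_, ?_, ?_⟩, ?_⟩ <;> simp only [mem_ofPred_eq, Complex.add_re, Complex.add_im,
      Complex.im_ofReal_mul, Complex.re_ofReal_mul, Complex.ofReal_re, Complex.ofReal_im]
    · nlinarith
    · nlinarith
    · nlinarith
    · nlinarith
  have b₀ : ∫⁻ x in S₀, ENNReal.ofReal (|φ x| / vertexDist m α c x) ^ r ≤
      C * ∫⁻ x in T, ‖fderiv ℝ φ x‖ₑ ^ r := by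
    rw [setLIntegral_congr_fun hm₀ fun x hx => by rw [hd₀ x hx]]
    refine (hC φ hφ _ h0 S₀ hm₀ hst₀).trans ?_
    gcongr
  have b₁ : ∫⁻ x in S₁, ENNReal.ofReal (|φ x| / vertexDist m α c x) ^ r ≤
      C * ∫⁻ x in T, ‖fderiv ℝ φ x‖ₑ ^ r := by
    rw [setLIntegral_congr_fun hm₁ fun x hx => by rw [hd₁ x hx]]
    refine (hC φ hφ _ h1 S₁ hm₁ hst₁).trans ?_
    gcongr
  calc _ ≤ ∫⁻ x in S₀ ∪ S₁, ENNReal.ofReal (|φ x| / vertexDist m α c x) ^ r :=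
        lintegral_mono_set hTu
    _ ≤ _ := lintegral_union_le _ _ _
    _ ≤ _ := add_le_add b₀ b₁
    _ = _ := by push_cast; ring

include hm

lemma pairwiseDisjoint_cellTriangle (n : ℕ) :
    (cells m n : Set (ℕ × List (Fin 4))).PairwiseDisjoint (cellTriangle m α t) := by
  intro c hc c' hc' hne
  rw [Function.onFun, Set.disjoint_left]
  intro x hx hx'
  obtain ⟨z, hz, rfl⟩ := h.mem_cellTriangle_iff.1 hx
  obtain ⟨z', hz', heq⟩ := h.mem_cellTriangle_iff.1 hx'
  obtain ⟨hj, hw⟩ := mem_cells.1 hc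
  obtain ⟨hj', hw'⟩ := mem_cells.1 hc'
  exact hne (h.eq_of_cellMap_lowerTriangle_eq hm hj hj' (hw.trans hw'.symm) hz hz' heq.symm)

lemma vertexDist_pos {n : ℕ} {c : ℕ × List (Fin 4)} (hc : c ∈ cells m n) {x : ℂ}
    (hx : x ∈ prefractalDomain m α n) : 0 < vertexDist m α c x := by
  obtain ⟨hj, -⟩ := mem_cells.1 hc
  obtain ⟨h0, h1⟩ := h.vertex_notMem_fractalDomain hm hj c.2
  have hxΩ : x ∈ fractalDomain m α := mem_iUnion.2 ⟨n, hx⟩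
  refine lt_min (norm_pos_iff.2 (sub_ne_zero.2 ?_)) (norm_pos_iff.2 (sub_ne_zero.2 ?_))
  · exact fun he => h0 (he ▸ hxΩ)
  · exact fun he => h1 (he ▸ hxΩ)

/-- A local Lipschitz estimate at x bounds the derivative of the product, so differentiability of
the cutoff is not needed. The singular term is the one to which Hardy's inequality applies. -/
lemma norm_fderiv_cutoff_mul_le_of_mem {n : ℕ} {c : ℕ × List (Fin 4)} (hc : c ∈ cells m n)
    {φ : ℂ → ℝ} (hφ : ContDiff ℝ ∞ φ) {x : ℂ} (hx : x ∈ cellTriangle m α t c) :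
    ‖fderiv ℝ (fun y => cutoff m α t n y * φ y) x‖ ≤
      ‖fderiv ℝ φ x‖ + 2 * (1 + t) ^ 2 / t * (|φ x| / vertexDist m α c x) := by
  have ht := h.t_pos
  obtain ⟨hj, hw⟩ := mem_cells.1 hc
  have hcut : ∀ y ∈ cellTriangle m α t c,
      cutoff m α t n y = 1 - kiteFun t (cellInv m α c y) := by
    intro y hy
    obtain ⟨z, hz, rfl⟩ := h.mem_cellTriangle_iff.1 hy
    rw [h.cutoff_cellMap hm hc hz, h.cellInv_cellMap]
  have hpos : 0 < vertexDist m α c x := by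
    obtain ⟨z, hz, rfl⟩ := h.mem_cellTriangle_iff.1 hx
    exact h.vertexDist_pos hm hc (h.cellMap_lowerTriangle_mem hm hj hw hz)
  refine le_of_forall_pos_le_add fun ε hε => norm_fderiv_le_of_lip' ℝ (by positivity) ?_
  have hd : HasFDerivAt φ (fderiv ℝ φ x) x :=
    (hφ.differentiable (by simp) x).hasFDerivAt
  have hlip : ∀ᶠ y in 𝓝 x, ‖φ y - φ x‖ ≤ (‖fderiv ℝ φ x‖ + ε) * ‖y - x‖ := by
    filter_upwards [hd.isLittleO.def hε] with y hy
    have := norm_add_le (φ y - φ x - fderiv ℝ φ x (y - x)) (fderiv ℝ φ x (y - x))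
    rw [sub_add_cancel] at this
    linarith [(fderiv ℝ φ x).le_opNorm (y - x)]
  filter_upwards [hlip, (isOpen_cellTriangle m α t c).mem_nhds hx] with y hy hyT
  have h1 := h.abs_kiteFun_cellInv_sub_le_vertexDist hpos y
  have h2 := cutoff_mem_Icc ht m α n y
  have e : cutoff m α t n y * φ y - cutoff m α t n x * φ x =
      cutoff m α t n y * (φ y - φ x) + (kiteFun t (cellInv m α c x) - kiteFun t (cellInv m α c y)) *
        φ x := by
    rw [hcut x hx, hcut y hyT]; ring
  rw [e]
  refine (norm_add_le _ _).trans ?_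
  rw [norm_mul, norm_mul, Real.norm_of_nonneg h2.1]
  have h3 : cutoff m α t n y * ‖φ y - φ x‖ ≤ (‖fderiv ℝ φ x‖ + ε) * ‖y - x‖ :=
    (mul_le_of_le_one_left (norm_nonneg _) h2.2).trans hy
  have h4 := mul_le_mul_of_nonneg_right h1 (norm_nonneg (φ x))
  rw [Real.norm_eq_abs]
  refine (add_le_add h3 h4).trans (le_of_eq ?_)
  rw [norm_sub_rev y x, Real.norm_eq_abs]
  ring

/-- Near such a point the cutoff is constant, equal to 1 inside the domain and to 0 outside. -/
lemma norm_fderiv_cutoff_mul_le_of_notMem {n : ℕ} {x : ℂ} (hx : x ∉ prefractalCurves m α n)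
    (hx' : x ∉ closure (innerFiber m α η n)) (φ : ℂ → ℝ) :
    ‖fderiv ℝ (fun y => cutoff m α t n y * φ y) x‖ ≤ ‖fderiv ℝ φ x‖ := by
  by_cases hΩ : x ∈ prefractalDomain m α n
  · have : (fun y => cutoff m α t n y * φ y) =ᶠ[𝓝 x] φ := by
      filter_upwards [(isOpen_prefractalDomain m α n).mem_nhds hΩ,
        isClosed_closure.isOpen_compl.mem_nhds hx'] with y hy hy'
      rw [h.cutoff_of_notMem_innerFiber hm hy fun hc => hy' (subset_closure hc), one_mul]
    rw [this.fderiv_eq]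
  · have hcl : x ∉ closure (prefractalDomain m α n) := fun hc =>
      hx (h.frontier_prefractalDomain_subset hm n
        (by rw [(isOpen_prefractalDomain m α n).frontier_eq]; exact ⟨hc, hΩ⟩))
    have : (fun y => cutoff m α t n y * φ y) =ᶠ[𝓝 x] fun _ => 0 := by
      filter_upwards [isClosed_closure.isOpen_compl.mem_nhds hcl] with y hy
      rw [cutoff_of_notMem fun hc => hy (subset_closure hc), zero_mul]
    rw [this.fderiv_eq]
    simp

/-- Multiplication of test functions by the cutoff functions is bounded for the `L^r` norm of the
gradient, uniformly in the generation. -/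
lemma exists_eLpNorm_gradient_cutoff_mul_le {r : ℝ} (hr : 2 < r) : ∃ C : ℝ≥0, ∀ n φ,
    IsTestFunction (fractalDomain m α) φ →
    eLpNorm (gradient fun x => cutoff m α t n x * φ x) (ENNReal.ofReal r)
        (volume.restrict (fractalDomain m α)) ≤
      C * eLpNorm (gradient φ) (ENNReal.ofReal r) (volume.restrict (fractalDomain m α)) := by
  have ht := h.t_pos
  have hr0 : 0 < r := by linarith
  obtain ⟨C, hC⟩ := h.exists_hardy_cellTriangle (m := m) hr
  set G : ℝ≥0 := ⟨2 * (1 + t) ^ 2 / t, by positivity⟩ with hG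
  -- The factor 2^(r-1) comes from (a + b)^r ≤ 2^(r-1)(a^r + b^r). `G` is the scale-invariant
  -- Lipschitz constant and `C` the Hardy constant, so nothing depends on n.
  set B : ℝ≥0 := 2 ^ (r - 1) * (1 + G ^ r * C) with hB
  refine ⟨B ^ (1 / r), fun n φ hφ => ?_⟩
  set Ω := fractalDomain m α with hΩ
  set A := ∫⁻ x in Ω, ‖fderiv ℝ φ x‖ₑ ^ r with hA
  have hsub : ∀ c ∈ cells m n, cellTriangle m α t c ⊆ Ω := by
    intro c hc x hx
    obtain ⟨hj, hw⟩ := mem_cells.1 hc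
    obtain ⟨z, hz, rfl⟩ := h.mem_cellTriangle_iff.1 hx
    exact mem_iUnion.2 ⟨n, h.cellMap_lowerTriangle_mem hm hj hw hz⟩
  have hmeasT : ∀ c, MeasurableSet (cellTriangle m α t c) := fun c =>
    (isOpen_cellTriangle m α t c).measurableSet
  let q : ℕ × List (Fin 4) → ℂ → ℝ≥0∞ := fun c => (cellTriangle m α t c).indicator fun x =>
    (G * ENNReal.ofReal (|φ x| / vertexDist m α c x)) ^ r
  have hqmeas : ∀ c, Measurable (q c) := by
    intro c
    refine Measurable.indicator ?_ (hmeasT c)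
    have h1 : Continuous (vertexDist m α c) := by unfold vertexDist; fun_prop
    exact (((hφ.1.continuous.abs.measurable.div h1.measurable).ennreal_ofReal).const_mul _).pow_const r
  have hpt : ∀ᵐ x ∂volume, ‖fderiv ℝ (fun y => cutoff m α t n y * φ y) x‖ₑ ^ r ≤
      2 ^ (r - 1) * (‖fderiv ℝ φ x‖ₑ ^ r + ∑ c ∈ cells m n, q c x) := by
    filter_upwards [measure_eq_zero_iff_ae_notMem.1 (h.volume_prefractalCurves (m := m) n),
      measure_eq_zero_iff_ae_notMem.1 (h.volume_frontier_innerFiber (m := m) n)] with x hx1 hx2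
    by_cases hx : x ∈ innerFiber m α η n
    · obtain ⟨c, hc, hxc⟩ := h.mem_innerFiber_iff.1 hx
      have h1 := h.norm_fderiv_cutoff_mul_le_of_mem hm hc hφ.1 hxc
      have h2 : ‖fderiv ℝ (fun y => cutoff m α t n y * φ y) x‖ₑ ≤
          ‖fderiv ℝ φ x‖ₑ + G * ENNReal.ofReal (|φ x| / vertexDist m α c x) := by
        rw [← ofReal_norm, ← ofReal_norm, ← ENNReal.ofReal_coe_nnreal, ← ENNReal.ofReal_mul G.coe_nonneg]
        exact (ENNReal.ofReal_le_ofReal h1).trans ENNReal.ofReal_add_le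
      have h3 : (G * ENNReal.ofReal (|φ x| / vertexDist m α c x)) ^ r ≤ ∑ c ∈ cells m n, q c x := by
        refine le_trans (le_of_eq ?_)
          (Finset.single_le_sum (f := fun c => q c x) (fun _ _ => zero_le) hc)
        simp only [q, indicator_of_mem hxc]
      calc _ ≤ _ := ENNReal.rpow_le_rpow h2 hr0.le
        _ ≤ _ := ENNReal.rpow_add_le_mul_rpow_add_rpow _ _ (by linarith)
        _ ≤ _ := by gcongr
    · have hcl : x ∉ closure (innerFiber m α η n) := fun hc =>
        hx2 (by rw [(h.isOpen_innerFiber m n).frontier_eq]; exact ⟨hc, hx⟩)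
      have h1 := h.norm_fderiv_cutoff_mul_le_of_notMem hm hx1 hcl φ
      have h2 : ‖fderiv ℝ (fun y => cutoff m α t n y * φ y) x‖ₑ ≤ ‖fderiv ℝ φ x‖ₑ :=
        enorm_le_iff_norm_le.2 h1
      have h3 : (1 : ℝ≥0∞) ≤ 2 ^ (r - 1) :=
        ENNReal.one_le_rpow (by norm_num) (by linarith)
      calc _ ≤ _ := ENNReal.rpow_le_rpow h2 hr0.le
        _ ≤ _ := le_self_add
        _ ≤ _ := le_mul_of_one_le_left' h3
  have hqint : ∫⁻ x in Ω, ∑ c ∈ cells m n, q c x ≤ G ^ r * C * A := by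
    rw [lintegral_finsetSum _ fun c _ => hqmeas c]
    calc ∑ c ∈ cells m n, ∫⁻ x in Ω, q c x
        ≤ ∑ c ∈ cells m n, G ^ r * C * ∫⁻ x in cellTriangle m α t c, ‖fderiv ℝ φ x‖ₑ ^ r := by
          refine Finset.sum_le_sum fun c hc => ?_
          obtain ⟨hj, -⟩ := mem_cells.1 hc
          obtain ⟨v0, v1⟩ := h.vertex_notMem_fractalDomain hm hj c.2
          -- The hypotheses of Hardy's inequality hold because both base vertices lie outside the
          -- limit domain.
          have hv : ∀ v, v ∉ Ω → φ v = 0 := fun v hv =>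
            image_eq_zero_of_notMem_tsupport fun hc => hv (hφ.2.2 hc)
          calc ∫⁻ x in Ω, q c x ≤ ∫⁻ x, q c x := setLIntegral_le_lintegral _ _
            _ = ∫⁻ x in cellTriangle m α t c,
                (G * ENNReal.ofReal (|φ x| / vertexDist m α c x)) ^ r :=
              lintegral_indicator (hmeasT c) _
            _ = G ^ r * ∫⁻ x in cellTriangle m α t c,
                ENNReal.ofReal (|φ x| / vertexDist m α c x) ^ r := by
              rw [← lintegral_const_mul' _ _ (ENNReal.rpow_ne_top_of_nonneg hr0.le
                ENNReal.coe_ne_top)]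
              refine lintegral_congr fun x => ?_
              rw [ENNReal.mul_rpow_of_nonneg _ _ hr0.le]
            _ ≤ _ := by
              rw [mul_assoc]
              exact mul_le_mul_right (hC c φ hφ.1 (hv _ v0) (hv _ v1)) _
      -- Disjointness of the inner triangles keeps the sum over the growing number of cells bounded
      -- by a single integral over the domain.
      _ = G ^ r * C * ∫⁻ x in ⋃ c ∈ cells m n, cellTriangle m α t c, ‖fderiv ℝ φ x‖ₑ ^ r := by
          rw [lintegral_biUnion_finset (h.pairwiseDisjoint_cellTriangle hm n) fun c _ => hmeasT c,
            Finset.mul_sum]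
      _ ≤ G ^ r * C * A := by
          gcongr
          exact lintegral_mono_set (iUnion₂_subset hsub)
  have hint : ∫⁻ x in Ω, ‖fderiv ℝ (fun y => cutoff m α t n y * φ y) x‖ₑ ^ r ≤ B * A := by
    refine (lintegral_mono_ae (ae_restrict_of_ae hpt)).trans ?_
    rw [lintegral_const_mul' _ _ (ENNReal.rpow_ne_top_of_nonneg (by linarith) (by norm_num)),
      lintegral_add_right _ (Finset.measurable_sum _ fun c _ => hqmeas c)]
    calc (2 : ℝ≥0∞) ^ (r - 1) * (A + ∫⁻ x in Ω, ∑ c ∈ cells m n, q c x)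
        ≤ 2 ^ (r - 1) * (A + G ^ r * C * A) := by gcongr
      _ = B * A := by
        rw [hB, ENNReal.coe_mul, ENNReal.coe_add, ENNReal.coe_mul,
          ENNReal.coe_rpow_of_nonneg _ hr0.le, ENNReal.coe_rpow_of_nonneg _ (by linarith)]
        push_cast
        ring
  have hp0 : ENNReal.ofReal r ≠ 0 := (ENNReal.ofReal_pos.2 hr0).ne'
  have henorm : ∀ f : ℂ → ℝ, eLpNorm (gradient f) (ENNReal.ofReal r) (volume.restrict Ω) =
      (∫⁻ x in Ω, ‖fderiv ℝ f x‖ₑ ^ r) ^ (1 / r) := by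
    intro f
    rw [eLpNorm_eq_lintegral_rpow_enorm_toReal hp0 ENNReal.ofReal_ne_top,
      ENNReal.toReal_ofReal hr0.le]
    congr 1
    refine lintegral_congr fun x => ?_
    rw [← ofReal_norm, norm_gradient, ofReal_norm]
  rw [henorm, henorm, ENNReal.coe_rpow_of_nonneg _ (by positivity),
    ← ENNReal.mul_rpow_of_nonneg _ _ (by positivity)]
  exact ENNReal.rpow_le_rpow hint (by positivity)

end KochParam

end KochFiber

theorem theorem6p2 (m : ℕ) (hm : 3 ≤ m) (α : ℝ) (hα2 : 2 < α) (hα4 : α < 4)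
    (η : ℝ) (hη0 : 0 < η)
    (hη : η ≤ min (Real.pi / 2 - KochFiber.kochAngle α) (KochFiber.kochAngle α / 2))
    (r : ℝ) (hr : 2 < r) (u : ℂ → ℝ)
    (hu : KochFiber.MemW10 (KochFiber.fractalDomain m α) r u)
    (s : ℝ) (hs2 : 2 < s) (hsr : s < r) :
    (∀ n : ℕ, KochFiber.MemW10 (KochFiber.fractalDomain m α) s
      (fun x => KochFiber.coeff m α η n x * u x)) ∧
    (∃ C : ℝ≥0, ∀ n : ℕ, KochFiber.sobolevNorm (KochFiber.fractalDomain m α) s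
      (fun x => KochFiber.coeff m α η n x * u x) ≤ C) ∧
    Tendsto (fun n : ℕ => KochFiber.sobolevNorm (KochFiber.fractalDomain m α) s
      (fun x => KochFiber.coeff m α η n x * u x - u x)) atTop (𝓝 0) := by
  obtain ⟨κ, t, h⟩ := KochFiber.exists_kochParam hα2 hα4 hη0 hη
  obtain ⟨C, hC⟩ := h.exists_eLpNorm_gradient_cutoff_mul_le hm hr
  refine KochFiber.multiplier_convergence (KochFiber.isOpen_fractalDomain m α)
    h.isBounded_fractalDomain.measure_lt_top.ne (by linarith) hsr hu
    (fun n => h.coeff_ae_eq_cutoff hm n _) (KochFiber.measurable_cutoff m α t)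
    (fun n x => ?_) (fun n φ hφ => h.exists_lipschitzWith_cutoff_mul hm n hφ) hC
    fun φ hφ => h.eventually_cutoff_mul_eq hm hφ
  obtain ⟨h0, h1⟩ := KochFiber.cutoff_mem_Icc h.t_pos m α n x
  rwa [Real.norm_of_nonneg h0]
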